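/- All simplicial objects are finite. For $k\ge 1$, a simplicial $k$-multicomplex is a finite multiset $\mathcal S$ of $(k+1)$-element sets (its facets); its non-empty faces are the non-empty subsets of its facets, $V(\mathcal S)$ is the union of its facets, and $G(\mathcal S)$ is the simple graph on $V(\mathcal S)$ whose edges are the pairs of distinct vertices lying in a common facet. $\mathcal S$ is a $k$-cycle if every $k$-element set is contained in an even number of elements of $\mathcal S$, counted with multiplicity; a $k$-circuit is a non-empty $k$-cycle that properly contains no non-empty $k$-cycle. A $\mathbb Z_2$-symmetric $k$-cycle $(\mathcal S,*)$ is a $k$-cycle $\mathcal S$ with an involution $*$ of $V(\mathcal S)$ that maps every facet to a facet of the same multiplicity and satisfies $F^*\neq F$ for every non-empty face $F$. It is $\mathbb Z_2$-irreducible if it is non-empty and $(\mathcal T,*|_{V(\mathcal T)})$ is not a $\mathbb Z_2$-symmetric $k$-cycle for any $\emptyset\ne\mathcal T\subsetneq\mathcal S$. For $0\le t\le d-1$ let $\Gamma_{t,d}$ be the group of order two generated by $I_{t,d}=\mathrm{diag}(1,\dots,1,-1,\dots,-1)$ ($t$ entries $1$ and $d-t$ entries $-1$). The pair $(G(\mathcal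 S),*)$ is $\Gamma_{t,d}$-rigid in $\mathbb R^d$ if there is a map $p:V(\mathcal S)\to\mathbb R^d$ with $p(u^*)=I_{t,d}\,p(u)$ for all $u\in V(\mathcal S)$ such that the framework $(G(\mathcal S),p)$ is infinitesimally rigid, that is, every $\dot p:V(\mathcal S)\to\mathbb R^d$ with $(p(i)-p(j))\cdot(\dot p(i)-\dot p(j))=0$ for all edges $ij$ has the form $\dot p(i)=Ap(i)+c$ for some skew-symmetric matrix $A$ and some $c\in\mathbb R^d$. **Lemma.** Let $k\ge 1$ and $0\le t\le k$. Let $(\mathcal S,*)$ be a $\mathbb Z_2$-irreducible $k$-cycle such that $\mathcal S=\mathcal T\sqcup\mathcal T^*$ (multiset sum) for some $k$-circuit $\mathcal T$ with $h:=|V(\mathcal T)\cap V(\mathcal T^*)|\le 2k$. Then $(G(\mathcal S),*)$ is $\Gamma_{t,k+1}$-rigid in $\mathbb R^{k+1}$ if and only if $h\ge\max\{2(k-t),\,k+1,\,2t\}$. -/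

import Mathlib

open scoped Matrix

namespace Z2Rigidity

/-! ### Graphs, frameworks and infinitesimal rigidity -/

section Rigidity

variable {V : Type*} {d : ℕ}

/-- A simple graph whose vertices are elements of `V`: a vertex set `G.verts : Set V` together with
a symmetric irreflexive adjacency relation on it. -/
abbrev Graph (V : Type*) := (⊤ : SimpleGraph V).Subgraph

/-- `q` is an infinitesimal motion of the framework `(G, p)` in `ℝ^d`. Only the values of `p` and
`q` on the vertex set of `G` matter. -/
def IsInfinitesimalMotion (G : Graph V) (p q : V → Fin d → ℝ) : Prop :=
  ∀ i j, G.Adj i j → (p i - p j) ⬝ᵥ (q i - q j) = 0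

/-- `q` is a trivial motion of `(G, p)`: `q i = A p(i) + c` on the vertices of `G`, for a
skew-symmetric matrix `A` and a vector `c`. -/
def IsTrivialMotion (G : Graph V) (p q : V → Fin d → ℝ) : Prop :=
  ∃ (A : Matrix (Fin d) (Fin d) ℝ) (c : Fin d → ℝ), Aᵀ = -A ∧ ∀ i ∈ G.verts, q i = A *ᵥ p i + c

/-- The framework `(G, p)` is infinitesimally rigid. -/
def IsInfinitesimallyRigid (G : Graph V) (p : V → Fin d → ℝ) : Prop :=
  ∀ q : V → Fin d → ℝ, IsInfinitesimalMotion G p q → IsTrivialMotion G p q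

/-- For a point group `Γ` (of order two) and a pairing `σ` of the set `X`, the point configuration
`p` is `Γ`-symmetric: `p (σ u) = γ (p u)` for all `u ∈ X`, `γ` the non-identity element of `Γ`. -/
def IsSymmetricConfiguration (Γ : Subgroup (Matrix.orthogonalGroup (Fin d) ℝ))
    (X : Set V) (σ : V → V) (p : V → Fin d → ℝ) : Prop :=
  ∀ γ ∈ Γ, γ ≠ 1 → ∀ u ∈ X, p (σ u) = (γ : Matrix (Fin d) (Fin d) ℝ) *ᵥ p u

/-- The graph `G` with the vertex pairing `σ : X → X` is `Γ`-rigid: it has an infinitesimally rigid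
`Γ`-symmetric realisation. -/
def IsGammaRigid (Γ : Subgroup (Matrix.orthogonalGroup (Fin d) ℝ))
    (G : Graph V) (X : Set V) (σ : V → V) : Prop :=
  ∃ p : V → Fin d → ℝ, IsSymmetricConfiguration Γ X σ p ∧ IsInfinitesimallyRigid G p

/-- The diagonal matrix `I_{t,d}`, with first `t` diagonal entries `1` and the others `-1`. -/
def signMatrix (t d : ℕ) : Matrix (Fin d) (Fin d) ℝ :=
  Matrix.diagonal fun i => if (i : ℕ) < t then 1 else -1

theorem signMatrix_mem (t d : ℕ) : signMatrix t d ∈ Matrix.orthogonalGroup (Fin d) ℝ := by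
  rw [Matrix.mem_orthogonalGroup_iff, signMatrix, Matrix.diagonal_transpose,
    Matrix.diagonal_mul_diagonal, ← Matrix.diagonal_one]
  congr 1
  funext i
  by_cases h : (i : ℕ) < t <;> simp [h]

/-- The point group `Γ_{t,d}` generated by `I_{t,d}`. -/
def Gam (t d : ℕ) : Subgroup (Matrix.orthogonalGroup (Fin d) ℝ) :=
  Subgroup.zpowers ⟨signMatrix t d, signMatrix_mem t d⟩

end Rigidity

/-! ### Simplicial multicomplexes -/

section Simplicial

variable {V : Type*} [DecidableEq V]

/-- A simplicial `k`-multicomplex: a multiset of `(k+1)`-sets. -/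
def IsMulticomplex (k : ℕ) (S : Multiset (Finset V)) : Prop :=
  ∀ F ∈ S, F.card = k + 1

/-- The vertex set `V(S)`. -/
def vertexSet (S : Multiset (Finset V)) : Finset V :=
  S.toFinset.biUnion id

/-- The graph `G(S)`: its vertices are the vertices of `S`, its edges are the pairs of distinct
vertices contained in some element of `S`. -/
def graphOf (S : Multiset (Finset V)) : Graph V where
  verts := {v | v ∈ vertexSet S}
  Adj u v := u ≠ v ∧ ∃ F ∈ S, u ∈ F ∧ v ∈ F
  adj_sub h := h.1
  edge_vert := by
    rintro u v ⟨-, F, hF, hu, -⟩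
    exact Finset.mem_biUnion.2 ⟨F, Multiset.mem_toFinset.2 hF, hu⟩
  symm := ⟨fun _ _ ⟨h, F, hF, hu, hv⟩ => ⟨h.symm, F, hF, hv, hu⟩⟩

/-- The mod 2 boundary: the `k`-subsets of `V(S)` that are contained in an odd number of elements
of `S`, counted with multiplicity. -/
def boundary (k : ℕ) (S : Multiset (Finset V)) : Finset (Finset V) :=
  ((vertexSet S).powersetCard k).filter fun F => Odd (S.countP fun U => F ⊆ U)

/-- A simplicial `k`-cycle. -/
def IsSimplicialCycle (k : ℕ) (S : Multiset (Finset V)) : Prop :=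
  IsMulticomplex k S ∧ boundary k S = ∅

/-- A simplicial `k`-circuit: a minimal non-empty simplicial `k`-cycle. -/
def IsSimplicialCircuit (k : ℕ) (S : Multiset (Finset V)) : Prop :=
  IsSimplicialCycle k S ∧ S ≠ 0 ∧ ∀ T, T < S → T ≠ 0 → ¬ IsSimplicialCycle k T

/-- The image `S*` of a multicomplex under a map of vertices. -/
def starImage (σ : V → V) (S : Multiset (Finset V)) : Multiset (Finset V) :=
  S.map fun F => F.image σ

/-- `σ` restricts to a free simplicial involution of `S`: it is an involution of `V(S)`, it maps
every facet to a facet of the same multiplicity, and it does not preserve any (non-empty) face. -/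
structure IsFreeSimplicialInvolution (S : Multiset (Finset V)) (σ : V → V) : Prop where
  mapsTo : ∀ v ∈ vertexSet S, σ v ∈ vertexSet S
  involutive : ∀ v ∈ vertexSet S, σ (σ v) = v
  simplicial : ∀ F ∈ S, S.count (F.image σ) = S.count F
  free : ∀ U ∈ S, ∀ F ⊆ U, F.Nonempty → F.image σ ≠ F

/-- A `ℤ₂`-symmetric `k`-cycle `(S, σ)`. -/
def IsSymmetricCycle (k : ℕ) (S : Multiset (Finset V)) (σ : V → V) : Prop :=
  IsSimplicialCycle k S ∧ IsFreeSimplicialInvolution S σ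

/-- A `ℤ₂`-irreducible `k`-cycle: a minimal non-empty `ℤ₂`-symmetric `k`-cycle. -/
def IsIrreducibleCycle (k : ℕ) (S : Multiset (Finset V)) (σ : V → V) : Prop :=
  IsSymmetricCycle k S σ ∧ S ≠ 0 ∧ ∀ T, T < S → T ≠ 0 → ¬ IsSymmetricCycle k T σ

end Simplicial

end Z2Rigidity

/-! Put `d = k + 1` and `X = V(T) ∩ V(T*)`, and let `P` contain one vertex of each pair `{u, σ u}`
in `X`, so that `h = 2|P|`. The halves `T` and `T*` meet only along `X`, so the question is how
large an affine subspace a symmetric placement of `X` can span.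

Affine functionals on ℝ^d split under `I_{t,d}` into invariant ones (a space of dimension `t + 1`)
and sign-changing ones (dimension `d - t`). A functional of either kind vanishes on `X` once it
vanishes on `P`. Hence two independent functionals vanish on `X` whenever `|P| ≤ t - 1` or `|P| ≤ k
- t - 1`, and also whenever `h ≤ k`, by plain dimension counting
(`exists_affineFunctional_pair_of_lt`). These are the failures of the three lower bounds on `h`. In
that case `T*` can be rotated about a subspace of codimension two while `T` stands still
(`exists_rotation`, `le_card_of_rigid`). If all three bounds hold, a generic symmetric placement of
`X` contains `k + 1` affinely independent points (`exists_holdsGenerically_ai`). These pin a rigid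
body, so a rigid realisation of `T` and its mirror image lock together (`exists_rigid_of_half`).

It remains to realise the circuit `T` rigidly with `X` placed symmetrically
(`Circuit.genericallyRigid`, for `k ≥ 2`). This follows Fogelsanger's method for minimal cycles, by
induction on the number of vertices outside `X`. If a facet contains an edge `uv` outside `X`,
contract it modulo two. The result is a sum of smaller circuits. Each lifts to a part of `T` in
which `u` and `v` have `k` common neighbours, so it is rigid by vertex splitting (`Rigid.split`,
`genericallyRigid_lift`), and minimality of the circuit forces these parts to move together
(`rigid_of_lifts`). If there is no such edge, `h ≤ 2k` forces a cross-polytope with apexes, which is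
treated directly.

Genericity is expressed through lines: rigidity together with faithfulness, and affine independence,
persist at all but finitely many points of any line through a good configuration, so finitely many
such conditions can be met at once.

Two degenerate cases remain. For `k = 1` irreducibility forces `X` to be empty, and a circuit made
of two copies of one facet cannot meet its image since the involution is free. -/

namespace Z2Rigidity

/-! ### Generic points on lines -/

section LinearAlgebra

variable {Q E W : Type*} [AddCommGroup Q] [Module ℝ Q] [FiniteDimensional ℝ Q]
  [AddCommGroup E] [Module ℝ E] [AddCommGroup W] [Module ℝ W] [FiniteDimensional ℝ W]

/-- Injectivity of a linear map is preserved along all but finitely many points of a line. -/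
theorem finite_setOf_not_injective (A B : Q →ₗ[ℝ] E) (hA : Function.Injective A) :
    {s : ℝ | ¬ Function.Injective (A + s • B)}.Finite := by
  obtain ⟨N, hN⟩ := A.exists_leftInverse_of_injective (LinearMap.ker_eq_bot.2 hA)
  have hN' : ∀ x, N (A x) = x := fun x => LinearMap.congr_fun hN x
  -- `N ∘ₗ (A + s • B)` is `1 + s • f`, so injectivity can fail only if `-s⁻¹` is one of the
  -- finitely many eigenvalues of `f`.
  let f : Module.End ℝ Q := N ∘ₗ B
  refine ((Module.End.finite_hasEigenvalue f).image fun μ => (-μ)⁻¹).subset ?_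
  intro s hs
  have hs' : ¬ Function.Injective (A + s • B) := hs
  rw [← LinearMap.ker_eq_bot, Submodule.eq_bot_iff] at hs'
  push Not at hs'
  obtain ⟨x, hx, hx0⟩ := hs'
  have h1 : x + s • f x = 0 := by
    have h2 : A x + s • B x = 0 := by simpa using hx
    have h3 := congrArg N h2
    simpa [f, hN'] using h3
  have hs0 : s ≠ 0 := by
    rintro rfl
    exact hx0 (by simpa using h1)
  refine ⟨-s⁻¹, ?_, by simp⟩
  refine Module.End.hasEigenvalue_of_hasEigenvector (x := x) ?_
  rw [Module.End.hasEigenvector_iff, Module.End.mem_eigenspace_iff]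
  refine ⟨?_, hx0⟩
  have h4 : s⁻¹ • (x + s • f x) = 0 := by rw [h1, smul_zero]
  rw [smul_add, smul_smul, inv_mul_cancel₀ hs0, one_smul] at h4
  rw [neg_smul]
  exact (neg_eq_of_add_eq_zero_right h4).symm

/-- If a linear system has exactly the solutions parametrised by `τ₀`, and the parametrised
solutions persist along a line, then there are no other solutions for almost all parameters. -/
theorem finite_setOf_not_ker_le (M₀ M₁ : Q →ₗ[ℝ] E) (τ₀ τ₁ : W →ₗ[ℝ] Q)
    (hτ : Function.Injective τ₀) (hk : ∀ q, M₀ q = 0 → ∃ a, τ₀ a = q)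
    (hM : ∀ (s : ℝ) a, (M₀ + s • M₁) ((τ₀ + s • τ₁) a) = 0) :
    {s : ℝ | ¬ (Function.Injective (τ₀ + s • τ₁) ∧
      ∀ q, (M₀ + s • M₁) q = 0 → ∃ a, (τ₀ + s • τ₁) a = q)}.Finite := by
  obtain ⟨π, hπ⟩ := τ₀.exists_leftInverse_of_injective (LinearMap.ker_eq_bot.2 hτ)
  have hπ' : ∀ x, π (τ₀ x) = x := fun x => LinearMap.congr_fun hπ x
  -- `π` reads off the parameter of a solution, so the system augmented by `π` is injective. Both
  -- this and the bijectivity of `π ∘ₗ τ₀` survive for almost all `s`; a solution then coincides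
  -- with the parametrised one having the same value of `π`.
  have h1 : Function.Injective (M₀.prod π) := by
    rw [← LinearMap.ker_eq_bot, Submodule.eq_bot_iff]
    intro q hq
    have hq' : M₀ q = 0 ∧ π q = 0 := by simpa [Prod.ext_iff] using hq
    obtain ⟨a, rfl⟩ := hk q hq'.1
    rw [hπ'] at hq'
    rw [hq'.2, map_zero]
  have h2 : Function.Injective (π ∘ₗ τ₀) := by
    rw [hπ]; exact Function.injective_id
  refine ((finite_setOf_not_injective _ (M₁.prod 0) h1).union
    (finite_setOf_not_injective _ (π ∘ₗ τ₁) h2)).subset ?_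
  intro s hs
  by_contra hcon
  simp only [Set.mem_union, Set.mem_ofPred_eq, not_or, not_not] at hcon
  obtain ⟨hi, hj⟩ := hcon
  have hcomp : π ∘ₗ τ₀ + s • (π ∘ₗ τ₁) = π ∘ₗ (τ₀ + s • τ₁) := by
    ext; simp
  rw [hcomp] at hj
  refine hs ⟨fun a b hab => hj (by simp only [LinearMap.comp_apply, hab]), fun q hq => ?_⟩
  obtain ⟨a, ha⟩ := LinearMap.injective_iff_surjective.1 hj (π q)
  refine ⟨a, hi ?_⟩
  have e1 := hM s a
  simp only [LinearMap.add_apply, LinearMap.smul_apply, LinearMap.comp_apply] at ha e1 hq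
  exact Prod.ext (e1.trans hq.symm) (by simpa using ha)

end LinearAlgebra

/-! ### Line-open properties of configurations, affine independence and affine functionals -/

section Generic

variable {V : Type*} {d : ℕ}

/-- A property of configurations that, if it holds at a point of a line, holds at all but finitely
many points of that line. -/
def LineOpen (P : (V → Fin d → ℝ) → Prop) : Prop :=
  ∀ p r, P p → {s : ℝ | ¬ P (p + s • r)}.Finite

/-- A line-open property that holds somewhere on the linear space `L`. -/
def HoldsGenerically (L : Submodule ℝ (V → Fin d → ℝ)) (P : (V → Fin d → ℝ) → Prop) : Prop :=
  LineOpen P ∧ ∃ p ∈ L, P p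

theorem LineOpen.and {P P' : (V → Fin d → ℝ) → Prop} (h : LineOpen P) (h' : LineOpen P') :
    LineOpen fun p => P p ∧ P' p := fun p r hp =>
  ((h p r hp.1).union (h' p r hp.2)).subset fun s hs => by
    by_contra hc
    simp only [Set.mem_union, Set.mem_ofPred_eq, not_or, not_not] at hc
    exact hs hc

/-- On the line through a witness of `P` and a witness of `P'`, each property fails at finitely many
points only, and the line stays in `L`. -/
theorem HoldsGenerically.and {L : Submodule ℝ (V → Fin d → ℝ)} {P P' : (V → Fin d → ℝ) → Prop}
    (h : HoldsGenerically L P) (h' : HoldsGenerically L P') :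
    HoldsGenerically L fun p => P p ∧ P' p := by
  refine ⟨h.1.and h'.1, ?_⟩
  obtain ⟨p, hpL, hp⟩ := h.2
  obtain ⟨r, hrL, hr⟩ := h'.2
  have h1 := h.1 p (r - p) hp
  -- The same line parametrised from its other end.
  have h2 := (h'.1 r (p - r) hr).image fun s => 1 - s
  obtain ⟨s, hs⟩ := (h1.union h2).infinite_compl.nonempty
  simp only [Set.mem_compl_iff, Set.mem_union, Set.mem_ofPred_eq, not_or, not_not,
    Set.mem_image, not_exists, not_and] at hs
  refine ⟨p + s • (r - p), L.add_mem hpL (L.smul_mem _ (L.sub_mem hrL hpL)), hs.1, ?_⟩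
  by_contra hc
  refine hs.2 (1 - s) ?_ (by ring)
  convert hc using 2
  module

theorem HoldsGenerically.forall_finset {L : Submodule ℝ (V → Fin d → ℝ)} {ι : Type*}
    (I : Finset ι) {P : ι → (V → Fin d → ℝ) → Prop} (h : ∀ i ∈ I, HoldsGenerically L (P i)) :
    HoldsGenerically L fun p => ∀ i ∈ I, P i p := by
  classical
  induction I using Finset.induction_on with
  | empty => exact ⟨fun p r _ => by simp, 0, L.zero_mem, by simp⟩
  | insert a I ha ih =>
    have := (h a (Finset.mem_insert_self _ _)).and
      (ih fun i hi => h i (Finset.mem_insert_of_mem hi))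
    simpa only [Finset.forall_mem_insert] using this

/-- The points `p v`, `v ∈ K`, are affinely independent. -/
def AI (p : V → Fin d → ℝ) (K : Finset V) : Prop :=
  LinearIndepOn ℝ (fun v => (p v, (1 : ℝ))) (K : Set V)

theorem AI.congr {p r : V → Fin d → ℝ} {K : Finset V} (h : AI p K) (hK : ∀ v ∈ K, r v = p v) :
    AI r K := by
  refine (linearIndepOn_congr ?_).2 h
  intro v hv
  simp [hK v (by simpa using hv)]

theorem ai_iff {p : V → Fin d → ℝ} {K : Finset V} :
    AI p K ↔ ∀ c : V → ℝ, ∑ v ∈ K, c v • p v = 0 → ∑ v ∈ K, c v = 0 → ∀ v ∈ K, c v = 0 := by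
  rw [AI, linearIndepOn_finset_iff]
  refine forall_congr' fun c => ?_
  have : ∑ v ∈ K, c v • (p v, (1 : ℝ)) = (∑ v ∈ K, c v • p v, ∑ v ∈ K, c v) := by
    simp [Prod.ext_iff, Prod.fst_sum, Prod.snd_sum]
  rw [this, Prod.mk_eq_zero, and_imp]

/-- Affine independence is injectivity of a linear map depending affinely on the configuration. The
homogenising coordinate is constant, so its direction is `0`. -/
theorem lineOpen_ai (K : Finset V) : LineOpen fun p : V → Fin d → ℝ => AI p K := by
  intro p r hp
  have key : ∀ p' : V → Fin d → ℝ, AI p' K ↔ Function.Injective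
      (Fintype.linearCombination ℝ fun v : K => (p' v, (1 : ℝ))) := by
    intro p'
    exact linearIndependent_iff_injective_fintypeLinearCombination
  refine (finite_setOf_not_injective _
    (Fintype.linearCombination ℝ fun v : K => (r v, (0 : ℝ))) ((key p).1 hp)).subset ?_
  intro s hs
  simp only [Set.mem_ofPred_eq] at hs ⊢
  rw [key] at hs
  convert hs using 3
  refine LinearMap.ext fun c => ?_
  simp only [LinearMap.add_apply, LinearMap.smul_apply, Fintype.linearCombination_apply,
    Finset.smul_sum, ← Finset.sum_add_distrib]
  refine Finset.sum_congr rfl fun i _ => Prod.ext ?_ ?_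
  · simp [smul_smul, mul_comm]
  · simp

/-- A point with a nonzero value of an affine functional vanishing on the others can be added. -/
theorem AI.insert_of_functional [DecidableEq V] {p : V → Fin d → ℝ} {K : Finset V} (h : AI p K) {v : V}
    (hv : v ∉ K) (a : Fin d → ℝ) (b : ℝ) (hK : ∀ u ∈ K, a ⬝ᵥ p u + b = 0)
    (hne : a ⬝ᵥ p v + b ≠ 0) : AI p (insert v K) := by
  rw [ai_iff] at h ⊢
  intro c h1 h2
  have h3 : ∑ u ∈ insert v K, c u * (a ⬝ᵥ p u + b) = 0 := by
    have := congrArg (fun x => a ⬝ᵥ x) h1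
    simp only [dotProduct_sum, dotProduct_smul, dotProduct_zero, smul_eq_mul] at this
    simp only [mul_add, Finset.sum_add_distrib, this, ← Finset.sum_mul, h2, zero_mul, add_zero]
  rw [Finset.sum_insert hv, Finset.sum_eq_zero fun u hu => by rw [hK u hu, mul_zero],
    add_zero, mul_eq_zero, or_iff_left hne] at h3
  rw [Finset.sum_insert hv, h3] at h1 h2
  intro u hu
  rcases Finset.mem_insert.1 hu with rfl | hu
  · exact h3
  · exact h c (by simpa using h1) (by simpa using h2) u hu

theorem finrank_affineFunctional : Module.finrank ℝ ((Fin d → ℝ) × ℝ) = d + 1 := by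
  simp

/-- Fewer than `d + 1` linear conditions on affine functionals have a nonzero solution. -/
theorem exists_affineFunctional {ι : Type*} [Fintype ι] (ℓ : ι → ((Fin d → ℝ) × ℝ) →ₗ[ℝ] ℝ)
    (h : Fintype.card ι + 1 ≤ d + 1) : ∃ α, α ≠ 0 ∧ ∀ i, ℓ i α = 0 := by
  have hlt : Module.finrank ℝ (ι → ℝ) < Module.finrank ℝ ((Fin d → ℝ) × ℝ) := by
    rw [finrank_affineFunctional, Module.finrank_fintype_fun_eq_card]; omega
  obtain ⟨α, hα, h0⟩ := Submodule.exists_mem_ne_zero_of_ne_bot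
    (LinearMap.ker_ne_bot_of_finrank_lt (f := LinearMap.pi ℓ) hlt)
  exact ⟨α, h0, fun i => congrFun (LinearMap.mem_ker.1 hα) i⟩

/-- Fewer than `d` linear conditions on affine functionals have two independent solutions. -/
theorem exists_affineFunctional_pair {ι : Type*} [Fintype ι]
    (ℓ : ι → ((Fin d → ℝ) × ℝ) →ₗ[ℝ] ℝ) (h : Fintype.card ι + 2 ≤ d + 1) :
    ∃ α β, LinearIndependent ℝ ![α, β] ∧ ∀ i, ℓ i α = 0 ∧ ℓ i β = 0 := by
  obtain ⟨α, h0, hα⟩ := exists_affineFunctional ℓ (by omega)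
  have h1 := LinearMap.finrank_range_add_finrank_ker (LinearMap.pi ℓ)
  have h2 := Submodule.finrank_le (LinearMap.range (LinearMap.pi ℓ))
  rw [finrank_affineFunctional] at h1
  rw [Module.finrank_fintype_fun_eq_card] at h2
  have h3 : 1 < Module.finrank ℝ (LinearMap.ker (LinearMap.pi ℓ)) := by omega
  obtain ⟨β, hβ⟩ := exists_linearIndependent_pair_of_one_lt_finrank h3
    (x := ⟨α, LinearMap.mem_ker.2 (funext hα)⟩) (by simpa [Subtype.ext_iff] using h0)
  refine ⟨α, β, ?_, fun i => ⟨hα i, congrFun (LinearMap.mem_ker.1 β.2) i⟩⟩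
  have := hβ.map' (Submodule.subtype _) (Submodule.ker_subtype _)
  have e : ![α, (β : (Fin d → ℝ) × ℝ)] = (LinearMap.ker (LinearMap.pi ℓ)).subtype ∘
      ![⟨α, LinearMap.mem_ker.2 (funext hα)⟩, β] := by
    ext i : 1
    fin_cases i <;> rfl
  rw [e]
  exact this

end Generic

end Z2Rigidity

namespace Z2Rigidity

/-! ### Infinitesimal rigidity of bodies -/

section Bodies

variable {V : Type*} {d : ℕ}

/-- Every motion of the part of the graph `R` on `B` is trivial. -/
def Rigid (R : V → V → Prop) (B : Finset V) (p : V → Fin d → ℝ) : Prop :=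
  ∀ q : V → Fin d → ℝ, (∀ u ∈ B, ∀ v ∈ B, R u v → (p u - p v) ⬝ᵥ (q u - q v) = 0) →
    ∃ (A : Matrix (Fin d) (Fin d) ℝ) (c : Fin d → ℝ), Aᵀ = -A ∧ ∀ v ∈ B, q v = A *ᵥ p v + c

/-- A nonzero trivial motion does not vanish on `B`. -/
def Faithful (B : Finset V) (p : V → Fin d → ℝ) : Prop :=
  ∀ (A : Matrix (Fin d) (Fin d) ℝ) (c : Fin d → ℝ), Aᵀ = -A →
    (∀ v ∈ B, A *ᵥ p v + c = 0) → A = 0 ∧ c = 0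

theorem dotProduct_mulVec_comm_of_skew {A : Matrix (Fin d) (Fin d) ℝ} (hA : Aᵀ = -A)
    (x y : Fin d → ℝ) : x ⬝ᵥ A *ᵥ y = -(y ⬝ᵥ A *ᵥ x) := by
  rw [Matrix.dotProduct_mulVec, ← Matrix.mulVec_transpose, hA, Matrix.neg_mulVec, neg_dotProduct,
    dotProduct_comm]

theorem dotProduct_mulVec_self_of_skew {A : Matrix (Fin d) (Fin d) ℝ} (hA : Aᵀ = -A)
    (x : Fin d → ℝ) : x ⬝ᵥ A *ᵥ x = 0 := by
  have := dotProduct_mulVec_comm_of_skew hA x x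
  linarith

theorem trivial_isMotion {A : Matrix (Fin d) (Fin d) ℝ} (hA : Aᵀ = -A) (c x y : Fin d → ℝ) :
    (x - y) ⬝ᵥ ((A *ᵥ x + c) - (A *ᵥ y + c)) = 0 := by
  rw [add_sub_add_right_eq_sub, ← Matrix.mulVec_sub]
  exact dotProduct_mulVec_self_of_skew hA _

/-- The differences from a vertex of an affinely independent set are linearly independent. -/
theorem AI.linearIndependent_sub {p : V → Fin d → ℝ} {K : Finset V} (h : AI p K)
    {v₀ : V} (hv₀ : v₀ ∈ K) {c : V → ℝ} (hc : ∑ v ∈ K, c v • (p v - p v₀) = 0) :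
    ∀ v ∈ K, v ≠ v₀ → c v = 0 := by
  classical
  rw [ai_iff] at h
  intro v hv hne
  have := h (fun u => c u - if u = v₀ then ∑ w ∈ K, c w else 0) ?_ ?_ v hv
  · simpa [hne] using this
  · simp only [sub_smul, Finset.sum_sub_distrib, ite_smul, zero_smul,
      Finset.sum_ite_eq', hv₀, if_true]
    rw [← hc]
    simp [smul_sub, Finset.sum_sub_distrib, Finset.sum_smul]
  · simp [Finset.sum_sub_distrib, hv₀]

/-- The differences of `d` affinely independent points of `ℝ^d` extend to a basis. -/
theorem AI.exists_basis {p : V → Fin d → ℝ} {K : Finset V} (h : AI p K) (hK : K.card = d)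
    {v₀ : V} (hv₀ : v₀ ∈ K) : ∃ w : Fin d → ℝ, ∃ b : V → Fin d → ℝ, b v₀ = w ∧
      (∀ v ∈ K, v ≠ v₀ → b v = p v - p v₀) ∧ LinearIndepOn ℝ b (K : Set V) := by
  classical
  have hcard : (K.erase v₀).card < d := by
    rw [Finset.card_erase_of_mem hv₀, hK]
    have := Finset.card_pos.2 ⟨v₀, hv₀⟩
    omega
  have hli : LinearIndepOn ℝ (fun v => p v - p v₀) ((K.erase v₀ : Finset V) : Set V) := by
    rw [linearIndepOn_finset_iff]
    intro c hc v hv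
    refine h.linearIndependent_sub hv₀ (c := c) ?_ v (Finset.mem_of_mem_erase hv)
      (Finset.ne_of_mem_erase hv)
    rw [← Finset.add_sum_erase _ _ hv₀, hc]
    simp
  obtain ⟨w, hw⟩ : ∃ w : Fin d → ℝ,
      w ∉ Submodule.span ℝ ((fun v => p v - p v₀) '' ((K.erase v₀ : Finset V) : Set V)) := by
    by_contra hcon
    push Not at hcon
    have htop := (Submodule.eq_top_iff' (p := Submodule.span ℝ
      ((fun v => p v - p v₀) '' ((K.erase v₀ : Finset V) : Set V)))).2 hcon
    have h1 := finrank_span_finset_le_card (R := ℝ) ((K.erase v₀).image fun v => p v - p v₀)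
    rw [Finset.coe_image, Set.finrank, htop, finrank_top, Module.finrank_fintype_fun_eq_card,
      Fintype.card_fin] at h1
    have := Finset.card_image_le (s := K.erase v₀) (f := fun v => p v - p v₀)
    omega
  refine ⟨w, fun v => if v = v₀ then w else p v - p v₀, by simp, fun v _ hv => by simp [hv], ?_⟩
  have e : (K : Set V) = insert v₀ ((K.erase v₀ : Finset V) : Set V) := by
    rw [← Finset.coe_insert, Finset.insert_erase hv₀]
  have heq : Set.EqOn (fun v => if v = v₀ then w else p v - p v₀) (fun v => p v - p v₀)
      ((K.erase v₀ : Finset V) : Set V) := by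
    intro v hv
    have : v ≠ v₀ := Finset.ne_of_mem_erase (by exact_mod_cast hv)
    simp [this]
  rw [e, linearIndepOn_insert (by simp)]
  refine ⟨(linearIndepOn_congr heq).2 hli, ?_⟩
  rw [Set.image_congr heq]
  simpa using hw

theorem span_eq_top_of_linearIndepOn {b : V → Fin d → ℝ} {K : Finset V}
    (h : LinearIndepOn ℝ b (K : Set V)) (hK : K.card = d) :
    Submodule.span ℝ (b '' K) = ⊤ := by
  have := LinearIndependent.span_eq_top_of_card_eq_finrank' (b := fun v : K => b v) h
    (by simp [hK])
  rwa [show Set.range (fun v : K => b v) = b '' K by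
    ext; simp] at this

theorem eq_zero_of_dotProduct_span {b : Set (Fin d → ℝ)} (hb : Submodule.span ℝ b = ⊤)
    {x : Fin d → ℝ} (hx : ∀ y ∈ b, y ⬝ᵥ x = 0) : x = 0 := by
  have : ∀ y, y ⬝ᵥ x = 0 := by
    intro y
    have hy : y ∈ Submodule.span ℝ b := hb ▸ Submodule.mem_top
    induction hy using Submodule.span_induction with
    | mem y hy => exact hx y hy
    | zero => simp
    | add y z _ _ hy hz => rw [add_dotProduct, hy, hz, add_zero]
    | smul a y _ hy => rw [smul_dotProduct, hy, smul_zero]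
  exact dotProduct_self_eq_zero.1 (this x)

/-- The normal direction of `d` affinely independent points of `ℝ^d`. -/
theorem AI.exists_normal {p : V → Fin d → ℝ} {K : Finset V} (h : AI p K) (hK : K.card = d)
    {v₀ : V} (hv₀ : v₀ ∈ K) : ∃ w : Fin d → ℝ, ∀ x : Fin d → ℝ,
      (∀ v ∈ K, (p v - p v₀) ⬝ᵥ x = 0) → w ⬝ᵥ x = 0 → x = 0 := by
  obtain ⟨w, b, hb₀, hb, hli⟩ := h.exists_basis hK hv₀
  refine ⟨w, fun x hx hw => eq_zero_of_dotProduct_span (span_eq_top_of_linearIndepOn hli hK) ?_⟩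
  rintro _ ⟨v, hv, rfl⟩
  by_cases hvv : v = v₀
  · rw [hvv, hb₀, hw]
  · rw [hb v hv hvv, hx v hv]

/-- If a skew `A` kills the differences of the points, its range is orthogonal to them. Since `A w`
is also orthogonal to `w`, it vanishes, and then the whole range is orthogonal to `w` too, hence
zero. So `d` points pin a body although they span only a hyperplane. -/
theorem AI.faithful {p : V → Fin d → ℝ} {K B : Finset V} (h : AI p K) (hK : K.card = d)
    (hne : K.Nonempty) (hKB : K ⊆ B) : Faithful B p := by
  obtain ⟨v₀, hv₀⟩ := hne
  obtain ⟨w, hw⟩ := h.exists_normal hK hv₀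
  intro A c hA hz
  have h1 : ∀ v ∈ K, A *ᵥ (p v - p v₀) = 0 := fun v hv => by
    rw [Matrix.mulVec_sub, sub_eq_zero]
    exact add_right_cancel ((hz v (hKB hv)).trans (hz v₀ (hKB hv₀)).symm)
  have h2 : ∀ y, ∀ v ∈ K, (p v - p v₀) ⬝ᵥ A *ᵥ y = 0 := fun y v hv => by
    rw [dotProduct_mulVec_comm_of_skew hA, h1 v hv, dotProduct_zero, neg_zero]
  have h3 : A *ᵥ w = 0 := hw _ (h2 w) (dotProduct_mulVec_self_of_skew hA w)
  have h4 : ∀ y, A *ᵥ y = 0 := fun y => hw _ (h2 y) (by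
    rw [dotProduct_mulVec_comm_of_skew hA, h3, dotProduct_zero, neg_zero])
  refine ⟨Matrix.ext_of_mulVec_single fun i => (h4 _).trans (Matrix.zero_mulVec _).symm, ?_⟩
  simpa [h4] using hz v₀ (hKB hv₀)

/-- A simplex on `d` vertices in `ℝ^d` is infinitesimally rigid. -/
theorem AI.rigid_clique {p : V → Fin d → ℝ} {K : Finset V} (h : AI p K) (hK : K.card = d)
    (hne : K.Nonempty) {R : V → V → Prop} (hR : ∀ u ∈ K, ∀ v ∈ K, u ≠ v → R u v) :
    Rigid R K p := by
  classical
  obtain ⟨v₀, hv₀⟩ := hne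
  obtain ⟨w, b, hb₀, hb, hli⟩ := h.exists_basis hK hv₀
  intro q hq
  have hq' : ∀ u ∈ K, ∀ v ∈ K, (p u - p v) ⬝ᵥ (q u - q v) = 0 := by
    intro u hu v hv
    by_cases huv : u = v
    · simp [huv]
    · exact hq u hu v hv (hR u hu v hv huv)
  let e : K ≃ Fin d := Fintype.equivFinOfCardEq (by simp [hK])
  let n : Fin d → V := fun i => e.symm i
  have hn : ∀ i, n i ∈ K := fun i => (e.symm i).2
  let f : V → Fin d → ℝ := fun v => q v - q v₀
  have hbf : ∀ u ∈ K, ∀ v ∈ K, u ≠ v₀ → v ≠ v₀ → b u ⬝ᵥ f v + b v ⬝ᵥ f u = 0 := by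
    intro u hu v hv hu0 hv0
    rw [hb u hu hu0, hb v hv hv0]
    have h1 := hq' u hu v hv
    have h2 := hq' u hu v₀ hv₀
    have h3 := hq' v hv v₀ hv₀
    simp only [f, sub_dotProduct, dotProduct_sub] at *
    linarith
  have hbf₀ : ∀ u ∈ K, u ≠ v₀ → b u ⬝ᵥ f u = 0 := by
    intro u hu hu0
    have := hbf u hu u hu hu0 hu0
    linarith
  let P : Matrix (Fin d) (Fin d) ℝ := Matrix.of fun i => b (n i)
  have hP : IsUnit P.det := by
    rw [← Matrix.isUnit_iff_isUnit_det, ← Matrix.linearIndependent_rows_iff_isUnit]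
    exact LinearIndependent.comp (ι := K) (v := fun v => b v) hli e.symm e.symm.injective
  -- The matrix in the basis `b` of the bilinear form that the required `A` must induce. The data
  -- determine all columns but that of `v₀`; this one is filled in by skew-symmetry, with `0` on the
  -- diagonal.
  let Ω : Matrix (Fin d) (Fin d) ℝ := Matrix.of fun i j =>
    if n j = v₀ then (if n i = v₀ then 0 else -(b v₀ ⬝ᵥ f (n i))) else b (n i) ⬝ᵥ f (n j)
  have hΩ : Ωᵀ = -Ω := by
    ext i j
    simp only [Ω, Matrix.transpose_apply, Matrix.neg_apply, Matrix.of_apply]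
    by_cases hi : n i = v₀ <;> by_cases hj : n j = v₀
    · simp [hi, hj]
    · simp [hi, hj]
    · simp [hi, hj]
    · simp only [hi, hj, if_false]
      have := hbf (n j) (hn j) (n i) (hn i) hj hi
      linarith
  have hPP : P⁻¹ * P = 1 := Matrix.nonsing_inv_mul P hP
  have hPT : P⁻¹ᵀ * Pᵀ = 1 := by
    rw [← Matrix.transpose_mul, Matrix.mul_nonsing_inv P hP, Matrix.transpose_one]
  refine ⟨P⁻¹ * Ω * P⁻¹ᵀ, q v₀ - (P⁻¹ * Ω * P⁻¹ᵀ) *ᵥ p v₀, ?_, ?_⟩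
  · simp only [Matrix.transpose_mul, Matrix.transpose_transpose, hΩ]
    simp [Matrix.mul_assoc]
  · intro v hv
    by_cases hvv : v = v₀
    · rw [hvv]; simp
    · obtain ⟨j, rfl⟩ : ∃ j, n j = v := ⟨e ⟨v, hv⟩, by simp [n]⟩
      have h1 : p (n j) - p v₀ = Pᵀ *ᵥ Pi.single j 1 := by
        rw [← hb _ hv hvv]
        ext i
        simp [P]
      have h2 : Ω *ᵥ Pi.single j 1 = P *ᵥ f (n j) := by
        ext i
        simp [Ω, P, hvv, Matrix.mulVec]
      have h3 : (P⁻¹ * Ω * P⁻¹ᵀ) *ᵥ (p (n j) - p v₀) = f (n j) := by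
        rw [h1, Matrix.mulVec_mulVec, Matrix.mul_assoc, hPT, Matrix.mul_one,
          ← Matrix.mulVec_mulVec, h2, Matrix.mulVec_mulVec, hPP, Matrix.one_mulVec]
      rw [Matrix.mulVec_sub] at h3
      have h4 : f (n j) = q (n j) - q v₀ := rfl
      rw [h4] at h3
      linear_combination -h3

/-- A motion of a rigid body that vanishes on `d` affinely independent points vanishes. -/
theorem Rigid.eq_zero {R : V → V → Prop} {B K : Finset V} {p q : V → Fin d → ℝ}
    (h : Rigid R B p) (hq : ∀ u ∈ B, ∀ v ∈ B, R u v → (p u - p v) ⬝ᵥ (q u - q v) = 0)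
    (hK : Faithful K p) (hKB : K ⊆ B) (h0 : ∀ v ∈ K, q v = 0) :
    ∀ v ∈ B, q v = 0 := by
  obtain ⟨A, c, hA, hAc⟩ := h q hq
  obtain ⟨rfl, rfl⟩ := hK A c hA fun v hv => by rw [← hAc v (hKB hv), h0 v hv]
  intro v hv
  simp [hAc v hv]

/-- Attaching vertices, each joined to `d` points of a rigid body. -/
theorem Rigid.attach [DecidableEq V] {R : V → V → Prop} {B M : Finset V} {p : V → Fin d → ℝ}
    (h : Rigid R B p)
    (hM : ∀ x ∈ M, ∃ K ⊆ B, K.card = d ∧ x ∉ K ∧ (∀ z ∈ K, R z x) ∧ AI p (insert x K)) :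
    Rigid R (B ∪ M) p := by
  intro q hq
  obtain ⟨A, c, hA, hAc⟩ := h q fun u hu v hv => hq u (Finset.mem_union_left _ hu) v
    (Finset.mem_union_left _ hv)
  refine ⟨A, c, hA, fun v hv => ?_⟩
  rcases Finset.mem_union.1 hv with hvB | hvM
  · exact hAc v hvB
  obtain ⟨K, hKB, hK, hvK, hR, hAI⟩ := hM v hvM
  have hli : LinearIndepOn ℝ (fun z => p z - p v) (K : Set V) := by
    rw [linearIndepOn_finset_iff]
    intro a ha z hz
    refine hAI.linearIndependent_sub (Finset.mem_insert_self v K) (c := a) ?_ z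
      (Finset.mem_insert_of_mem hz) (fun hzv => hvK (hzv ▸ hz))
    rw [Finset.sum_insert hvK, ha]
    simp
  rw [← sub_eq_zero]
  refine eq_zero_of_dotProduct_span (span_eq_top_of_linearIndepOn hli hK) ?_
  rintro _ ⟨z, hz, rfl⟩
  have h1 := hq z (Finset.mem_union_left _ (hKB hz)) v hv (hR z hz)
  have h2 := trivial_isMotion hA c (p z) (p v)
  rw [hAc z (hKB hz)] at h1
  simp only [dotProduct_sub, dotProduct_add] at *
  linarith

end Bodies

end Z2Rigidity

namespace Z2Rigidity

/-! ### Rigidity on lines of configurations -/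

section Lines

variable {V : Type*} {d : ℕ}

/-- The skew-symmetric matrices. -/
def skewMatrices (d : ℕ) : Submodule ℝ (Matrix (Fin d) (Fin d) ℝ) where
  carrier := {A | Aᵀ = -A}
  add_mem' {A A'} hA hA' := by
    have h : Aᵀ = -A := hA
    have h' : A'ᵀ = -A' := hA'
    change (A + A')ᵀ = -(A + A')
    rw [Matrix.transpose_add, h, h']
    abel
  zero_mem' := by simp
  smul_mem' a A hA := by
    have h : Aᵀ = -A := hA
    change (a • A)ᵀ = -(a • A)
    rw [Matrix.transpose_smul, h, smul_neg]

/-- The linear system with row directions `δ`. -/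
def rowMap (B : Finset V) (δ : V → V → Fin d → ℝ) : (B → Fin d → ℝ) →ₗ[ℝ] (B × B → ℝ) where
  toFun q uv := δ uv.1 uv.2 ⬝ᵥ (q uv.1 - q uv.2)
  map_add' q q' := by
    ext uv
    simp only [Pi.add_apply, ← dotProduct_add]
    congr 1
    abel
  map_smul' a q := by
    ext uv
    simp only [Pi.smul_apply, RingHom.id_apply, ← dotProduct_smul, smul_sub]

/-- The trivial motions at `p`. -/
def trivialMap (B : Finset V) (p : V → Fin d → ℝ) :
    (skewMatrices d × (Fin d → ℝ)) →ₗ[ℝ] (B → Fin d → ℝ) where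
  toFun a v := (a.1 : Matrix (Fin d) (Fin d) ℝ) *ᵥ p v + a.2
  map_add' a b := by
    ext v : 1
    simp only [Prod.fst_add, Prod.snd_add, Submodule.coe_add, Matrix.add_mulVec, Pi.add_apply]
    abel
  map_smul' s a := by
    ext v : 1
    simp [Matrix.smul_mulVec]

/-- The kernel lemma applied with skew matrices and translations as parameters; `Faithful` is the
injectivity of the parametrisation. The row directions are kept independent of `p`, because in
vertex splitting the row of the contracted edge is not a difference of points but the limit of its
direction. -/
theorem finite_setOf_not_rigid (B : Finset V) (δ₀ δ₁ : V → V → Fin d → ℝ)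
    (p r : V → Fin d → ℝ) (hf : Faithful B p)
    (hk : ∀ q : V → Fin d → ℝ, (∀ u ∈ B, ∀ v ∈ B, δ₀ u v ⬝ᵥ (q u - q v) = 0) →
      ∃ (A : Matrix (Fin d) (Fin d) ℝ) (c : Fin d → ℝ), Aᵀ = -A ∧ ∀ v ∈ B, q v = A *ᵥ p v + c)
    (hM : ∀ (s : ℝ) (A : Matrix (Fin d) (Fin d) ℝ), Aᵀ = -A → ∀ u ∈ B, ∀ v ∈ B,
      (δ₀ u v + s • δ₁ u v) ⬝ᵥ A *ᵥ ((p u + s • r u) - (p v + s • r v)) = 0) :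
    {s : ℝ | ¬ (Faithful B (p + s • r) ∧ ∀ q : V → Fin d → ℝ,
      (∀ u ∈ B, ∀ v ∈ B, (δ₀ u v + s • δ₁ u v) ⬝ᵥ (q u - q v) = 0) →
      ∃ (A : Matrix (Fin d) (Fin d) ℝ) (c : Fin d → ℝ), Aᵀ = -A ∧
        ∀ v ∈ B, q v = A *ᵥ (p + s • r) v + c)}.Finite := by
  classical
  -- Along the line the trivial motion with parameters `(A, c)` changes by `s • A *ᵥ r v`; the
  -- translation contributes nothing.
  let r' : (skewMatrices d × (Fin d → ℝ)) →ₗ[ℝ] (B → Fin d → ℝ) :=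
    trivialMap B r ∘ₗ (LinearMap.inl ℝ _ _ ∘ₗ LinearMap.fst ℝ _ _)
  have htriv : ∀ s : ℝ, trivialMap B p + s • r' = trivialMap B (p + s • r) := by
    intro s
    refine LinearMap.ext fun a => funext fun v => ?_
    simp [trivialMap, r', Matrix.mulVec_add, Matrix.mulVec_smul, add_right_comm]
  have hrow : ∀ s : ℝ, rowMap B δ₀ + s • rowMap B δ₁ = rowMap B fun u v => δ₀ u v + s • δ₁ u v := by
    intro s
    refine LinearMap.ext fun a => funext fun v => ?_
    simp [rowMap, add_dotProduct, smul_dotProduct]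
    ring
  have hext : ∀ q : B → Fin d → ℝ, ∃ q' : V → Fin d → ℝ, ∀ v : B, q' v = q v := fun q =>
    ⟨fun v => if h : v ∈ B then q ⟨v, h⟩ else 0, fun v => by simp⟩
  refine (finite_setOf_not_ker_le (rowMap B δ₀) (rowMap B δ₁) (trivialMap B p) r' ?_ ?_ ?_).subset
    ?_
  · rw [← LinearMap.ker_eq_bot, Submodule.eq_bot_iff]
    rintro ⟨⟨A, hA⟩, c⟩ hAc
    obtain ⟨rfl, rfl⟩ := hf A c hA fun v hv => congrFun (LinearMap.mem_ker.1 hAc) ⟨v, hv⟩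
    rfl
  · intro q hq
    obtain ⟨q', hq'⟩ := hext q
    obtain ⟨A, c, hA, hAc⟩ := hk q' fun u hu v hv => by
      rw [hq' ⟨u, hu⟩, hq' ⟨v, hv⟩]
      exact congrFun hq (⟨u, hu⟩, ⟨v, hv⟩)
    refine ⟨(⟨A, hA⟩, c), funext fun v => ?_⟩
    rw [← hq' v, hAc v v.2]
    rfl
  · intro s a
    rw [htriv, hrow]
    refine funext fun uv => ?_
    have := hM s a.1 a.1.2 uv.1 uv.1.2 uv.2 uv.2.2
    rw [Matrix.mulVec_sub] at this
    simp only [rowMap, trivialMap, LinearMap.coe_mk, AddHom.coe_mk, add_sub_add_right_eq_sub]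
    exact this
  · intro s hs hcon
    rw [htriv, hrow] at hcon
    refine hs ⟨fun A c hA h => ?_, fun q hq => ?_⟩
    · have := hcon.1 (a₁ := (⟨A, hA⟩, c)) (a₂ := 0) (by
        rw [map_zero]
        exact funext fun v => h v v.2)
      exact ⟨congrArg (fun a => (a.1 : Matrix (Fin d) (Fin d) ℝ)) this, congrArg Prod.snd this⟩
    · obtain ⟨a, ha⟩ := hcon.2 (fun v => q v) (funext fun uv => hq _ uv.1.2 _ uv.2.2)
      exact ⟨a.1, a.2, a.1.2, fun v hv => (congrFun ha ⟨v, hv⟩).symm⟩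

/-- Faithfulness accompanies rigidity because it makes the trivial motions a space of full
dimension, which the argument with kernels requires. -/
theorem lineOpen_rigid (R : V → V → Prop) (B : Finset V) :
    LineOpen fun p : V → Fin d → ℝ => Faithful B p ∧ Rigid R B p := by
  classical
  rintro p r ⟨hf, hp⟩
  have key : ∀ (p q : V → Fin d → ℝ) u v,
      (if R u v then p u - p v else 0) ⬝ᵥ (q u - q v) = 0 ↔
        (R u v → (p u - p v) ⬝ᵥ (q u - q v) = 0) := by
    intro p q u v
    by_cases h : R u v <;> simp [h]
  have hsum : ∀ (s : ℝ) u v, (if R u v then p u - p v else 0) +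
      s • (if R u v then r u - r v else 0) =
        if R u v then (p + s • r) u - (p + s • r) v else 0 := by
    intro s u v
    by_cases h : R u v
    · simp only [h, if_true, Pi.add_apply, Pi.smul_apply]
      module
    · simp [h]
  refine (finite_setOf_not_rigid B (fun u v => if R u v then p u - p v else 0)
    (fun u v => if R u v then r u - r v else 0) p r hf ?_ ?_).subset ?_
  · intro q hq
    exact hp q fun u hu v hv => (key p q u v).1 (hq u hu v hv)
  · intro s A hA u _ v _
    rw [hsum]
    by_cases h : R u v
    · simp only [h, if_true]
      exact dotProduct_mulVec_self_of_skew hA _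
    · simp [h]
  · intro s hs hcon
    refine hs ⟨hcon.1, fun q hq => hcon.2 q fun u hu v hv => ?_⟩
    rw [hsum, key]
    exact hq u hu v hv

/-- Vertex splitting: if the graph obtained from `R` on `B` by contracting the edge `uv` is rigid
and `u`, `v` have `d - 1` common neighbours in general position, then moving `u` off `v` gives a
rigid framework. -/
theorem Rigid.split [DecidableEq V] {R R' : V → V → Prop} {B Z : Finset V} {u v : V}
    {p : V → Fin d → ℝ} (hu : u ∈ B) (hv : v ∈ B) (hne : u ≠ v) (hpu : p u = p v)
    (hZB : Z ⊆ B) (huZ : u ∉ Z) (hvZ : v ∉ Z) (hZd : Z.card + 1 = d)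
    (hZ : ∀ z ∈ Z, R z u ∧ R z v) (hAI : AI p (insert v Z))
    (hf : Faithful (B.erase u) p) (hrig : Rigid R' (B.erase u) p)
    (hR' : ∀ x ∈ B.erase u, ∀ y ∈ B.erase u, R' x y → x ≠ y →
      R x y ∨ (x = v ∧ R u y) ∨ (y = v ∧ R x u))
    (hRuv : R u v) :
    ∃ w : Fin d → ℝ, {s : ℝ | ¬ (Faithful B (p + s • (Pi.single u w : V → Fin d → ℝ)) ∧
      Rigid R B (p + s • (Pi.single u w : V → Fin d → ℝ)))}.Finite := by
  have := Classical.decRel R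
  obtain ⟨w, hw⟩ := hAI.exists_normal (by rw [Finset.card_insert_of_notMem hvZ, hZd])
    (Finset.mem_insert_self v Z)
  let r : V → Fin d → ℝ := Pi.single u w
  have hru : r u = w := Pi.single_eq_same _ _
  have hrv : r v = 0 := Pi.single_eq_of_ne hne.symm _
  refine ⟨w, ?_⟩
  -- The edge `uv` has length zero at `p` and direction `s • w` further along the line, so its row
  -- is replaced by `w` for every `s`. The redundant row `(v, u)` is set to zero.
  let δ₀ : V → V → Fin d → ℝ := fun x y =>
    if x = u ∧ y = v then w else if R x y ∧ ¬ (x = v ∧ y = u) then p x - p y else 0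
  let δ₁ : V → V → Fin d → ℝ := fun x y =>
    if x = u ∧ y = v then 0 else if R x y ∧ ¬ (x = v ∧ y = u) then r x - r y else 0
  have hsum : ∀ (s : ℝ) x y, ¬ (x = u ∧ y = v) → δ₀ x y + s • δ₁ x y =
      if R x y ∧ ¬ (x = v ∧ y = u) then (p + s • r) x - (p + s • r) y else 0 := by
    intro s x y h
    simp only [δ₀, δ₁, h, if_false]
    by_cases h' : R x y ∧ ¬ (x = v ∧ y = u)
    · rw [if_pos h', if_pos h', if_pos h']
      simp only [Pi.add_apply, Pi.smul_apply]
      module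
    · rw [if_neg h', if_neg h', if_neg h', smul_zero, add_zero]
  have hsum' : ∀ s : ℝ, δ₀ u v + s • δ₁ u v = w := by
    intro s
    simp [δ₀, δ₁]
  have huv : ∀ s : ℝ, (p + s • r) u - (p + s • r) v = s • w := by
    intro s
    simp [hpu, hru, hrv]
  have hfin := finite_setOf_not_rigid B δ₀ δ₁ p r
    (fun A c hA h => hf A c hA fun x hx => h x (Finset.mem_of_mem_erase hx)) ?_ ?_
  -- The true row `s • w` gives the condition of the row `w` only for `s ≠ 0`.
  · refine (hfin.union (Set.finite_singleton (0 : ℝ))).subset ?_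
    intro s hs
    by_contra hcon
    simp only [Set.mem_union, Set.mem_ofPred_eq, not_or, not_not, Set.mem_singleton_iff] at hcon
    obtain ⟨⟨h1, h2⟩, hs0⟩ := hcon
    refine hs ⟨h1, fun q hq => h2 q fun x hx y hy => ?_⟩
    by_cases hxy : x = u ∧ y = v
    · obtain ⟨rfl, rfl⟩ := hxy
      have h3 := hq x hu y hv hRuv
      rw [hsum']
      rw [huv, smul_dotProduct, smul_eq_mul, mul_eq_zero] at h3
      exact h3.resolve_left hs0
    · rw [hsum s x y hxy]
      by_cases h' : R x y ∧ ¬ (x = v ∧ y = u)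
      · rw [if_pos h']
        exact hq x hx y hy h'.1
      · rw [if_neg h', zero_dotProduct]
  · intro q hq
    have hq' : ∀ x ∈ B, ∀ y ∈ B, R x y → (p x - p y) ⬝ᵥ (q x - q y) = 0 := by
      intro x hx y hy hxy
      by_cases h1 : x = u ∧ y = v
      · rw [h1.1, h1.2, hpu, sub_self, zero_dotProduct]
      by_cases h2 : x = v ∧ y = u
      · rw [h2.1, h2.2, hpu, sub_self, zero_dotProduct]
      have h3 := hq x hx y hy
      simp only [δ₀] at h3
      rwa [if_neg h1, if_pos ⟨hxy, h2⟩] at h3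
    -- The edges from `z ∈ Z` to both `u` and `v` make `q u - q v` orthogonal to `p z - p v`, and
    -- the extra row makes it orthogonal to `w`. The choice of `w` leaves only zero, so `q` is a
    -- motion of the contracted graph.
    have hquv : q u = q v := by
      rw [← sub_eq_zero]
      refine hw _ ?_ ?_
      · intro z hz
        rcases Finset.mem_insert.1 hz with rfl | hz
        · simp
        · have h1 := hq' z (hZB hz) u hu (hZ z hz).1
          have h2 := hq' z (hZB hz) v hv (hZ z hz).2
          rw [hpu] at h1
          simp only [dotProduct_sub] at h1 h2 ⊢
          linarith
      · have := hq u hu v hv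
        simpa [δ₀] using this
    obtain ⟨A, c, hA, hAc⟩ := hrig q fun x hx y hy hxy => by
      have hx' := Finset.mem_of_mem_erase hx
      have hy' := Finset.mem_of_mem_erase hy
      by_cases hxy' : x = y
      · simp [hxy']
      rcases hR' x hx y hy hxy hxy' with h | ⟨rfl, h⟩ | ⟨rfl, h⟩
      · exact hq' x hx' y hy' h
      · rw [← hpu, ← hquv]
        exact hq' u hu y hy' h
      · rw [← hpu, ← hquv]
        exact hq' x hx' u hu h
    refine ⟨A, c, hA, fun x hx => ?_⟩
    by_cases hxu : x = u
    · rw [hxu, hquv, hpu]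
      exact hAc v (Finset.mem_erase.2 ⟨hne.symm, hv⟩)
    · exact hAc x (Finset.mem_erase.2 ⟨hxu, hx⟩)
  · intro s A hA x _ y _
    by_cases hxy : x = u ∧ y = v
    · obtain ⟨rfl, rfl⟩ := hxy
      have := huv s
      simp only [Pi.add_apply, Pi.smul_apply] at this
      rw [hsum', this, Matrix.mulVec_smul, dotProduct_smul, dotProduct_mulVec_self_of_skew hA,
        smul_zero]
    · rw [hsum s x y hxy]
      by_cases h' : R x y ∧ ¬ (x = v ∧ y = u)
      · rw [if_pos h']
        exact dotProduct_mulVec_self_of_skew hA _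
      · rw [if_neg h', zero_dotProduct]

end Lines

end Z2Rigidity

namespace Z2Rigidity

/-! ### Symmetric configurations -/

section Symmetric

variable {V : Type*}

/-- `σ` restricts to a fixed-point-free involution of `X`. -/
structure IsFreePairing (X : Finset V) (σ : V → V) : Prop where
  mapsTo : ∀ u ∈ X, σ u ∈ X
  involutive : ∀ u ∈ X, σ (σ u) = u
  free : ∀ u ∈ X, σ u ≠ u

/-- The configurations with `p (σ u) = I_{t,d} p(u)` for all `u ∈ X`. -/
def symmetricSpace (t d : ℕ) (X : Finset V) (σ : V → V) : Submodule ℝ (V → Fin d → ℝ) where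
  carrier := {p | ∀ u ∈ X, p (σ u) = signMatrix t d *ᵥ p u}
  add_mem' {p r} hp hr u hu := by
    rw [Pi.add_apply, Pi.add_apply, hp u hu, hr u hu, Matrix.mulVec_add]
  zero_mem' u _ := by simp
  smul_mem' a p hp u hu := by
    rw [Pi.smul_apply, Pi.smul_apply, hp u hu, Matrix.mulVec_smul]

theorem signMatrix_transpose (t d : ℕ) : (signMatrix t d)ᵀ = signMatrix t d :=
  Matrix.diagonal_transpose _

theorem signMatrix_mul_self (t d : ℕ) : signMatrix t d * signMatrix t d = 1 := by
  have := (Matrix.mem_orthogonalGroup_iff (Fin d) ℝ).1 (signMatrix_mem t d)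
  rwa [signMatrix_transpose] at this

theorem signMatrix_mulVec_mulVec (t d : ℕ) (x : Fin d → ℝ) :
    signMatrix t d *ᵥ signMatrix t d *ᵥ x = x := by
  rw [Matrix.mulVec_mulVec, signMatrix_mul_self, Matrix.one_mulVec]

theorem dotProduct_signMatrix_of_fixed {t d : ℕ} {a : Fin d → ℝ}
    (ha : ∀ i : Fin d, t ≤ i → a i = 0) (x : Fin d → ℝ) :
    a ⬝ᵥ signMatrix t d *ᵥ x = a ⬝ᵥ x := by
  simp only [dotProduct, signMatrix, Matrix.mulVec_diagonal]
  refine Finset.sum_congr rfl fun i _ => ?_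
  by_cases h : (i : ℕ) < t
  · simp [h]
  · simp [ha i (not_lt.1 h)]

theorem dotProduct_signMatrix_of_reversed {t d : ℕ} {b : Fin d → ℝ}
    (hb : ∀ i : Fin d, (i : ℕ) < t → b i = 0) (x : Fin d → ℝ) :
    b ⬝ᵥ signMatrix t d *ᵥ x = -(b ⬝ᵥ x) := by
  simp only [dotProduct, signMatrix, Matrix.mulVec_diagonal, ← Finset.sum_neg_distrib]
  refine Finset.sum_congr rfl fun i _ => ?_
  by_cases h : (i : ℕ) < t
  · simp [hb i h]
  · simp [h]

theorem card_coord_ge (t d : ℕ) (h : t ≤ d) : Fintype.card {i : Fin d // t ≤ (i : ℕ)} = d - t := by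
  rw [Fintype.card_subtype]
  have h1 := Finset.card_filter_add_card_filter_not (s := (Finset.univ : Finset (Fin d)))
    (fun i : Fin d => (i : ℕ) < t)
  rw [Finset.card_univ, Fintype.card_fin, Fin.card_filter_val_lt, min_eq_right h] at h1
  simp only [not_lt] at h1
  omega

theorem card_coord_lt (t d : ℕ) (h : t ≤ d) : Fintype.card {i : Fin d // (i : ℕ) < t} = t := by
  rw [Fintype.card_subtype, Fin.card_filter_val_lt, min_eq_right h]

/-- Evaluation of affine functionals. -/
def evalAffine {d : ℕ} (x : Fin d → ℝ) : ((Fin d → ℝ) × ℝ) →ₗ[ℝ] ℝ where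
  toFun α := α.1 ⬝ᵥ x + α.2
  map_add' α β := by simp only [Prod.fst_add, Prod.snd_add, add_dotProduct]; ring
  map_smul' s α := by
    simp only [Prod.smul_fst, Prod.smul_snd, smul_dotProduct, smul_eq_mul, RingHom.id_apply]; ring

/-- A coordinate of the gradient of affine functionals. -/
def coordAffine {d : ℕ} (i : Fin d) : ((Fin d → ℝ) × ℝ) →ₗ[ℝ] ℝ :=
  LinearMap.proj i ∘ₗ LinearMap.fst ℝ (Fin d → ℝ) ℝ

variable [DecidableEq V] {t d : ℕ} {X : Finset V} {σ : V → V}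

theorem exists_modify (hσ : IsFreePairing X σ) {p : V → Fin d → ℝ}
    (hp : p ∈ symmetricSpace t d X σ) (v : V) (x : Fin d → ℝ) :
    ∃ p' ∈ symmetricSpace t d X σ, p' v = x ∧
      ∀ y, y ≠ v → (v ∈ X → y ≠ σ v) → p' y = p y := by
  refine ⟨fun y => if y = v then x else if v ∈ X ∧ y = σ v then signMatrix t d *ᵥ x else p y,
    ?_, by simp, ?_⟩
  · intro u hu
    by_cases huv : u = v
    · subst huv
      simp [hu, hσ.free u hu]
    by_cases huv' : v ∈ X ∧ u = σ v
    · obtain ⟨hv, rfl⟩ := huv'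
      simp [hσ.involutive v hv, huv, hv, signMatrix_mul_self]
    have h1 : σ u ≠ v := by
      rintro rfl
      exact huv' ⟨hσ.mapsTo u hu, (hσ.involutive u hu).symm⟩
    have h2 : ¬ (v ∈ X ∧ σ u = σ v) := by
      rintro ⟨hv, h⟩
      exact huv (by rw [← hσ.involutive u hu, h, hσ.involutive v hv])
    simp only [h1, h2, huv, huv', if_false]
    exact hp u hu
  · intro y hy hy'
    have : ¬ (v ∈ X ∧ y = σ v) := fun h => hy' h.1 h.2
    simp [hy, this]

/-- Vertices whose partner is absent can be placed freely. -/
theorem exists_ai_of_subset (hσ : IsFreePairing X σ) {K₀ K : Finset V} (hK : K₀ ⊆ K)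
    (h₀ : ∃ p ∈ symmetricSpace t d X σ, AI p K₀)
    (hs : ∀ v ∈ K, v ∉ K₀ → v ∈ X → σ v ∉ K) (hcard : K.card ≤ d + 1) :
    ∃ p ∈ symmetricSpace t d X σ, AI p K := by
  suffices h : ∀ M ⊆ K \ K₀, ∃ p ∈ symmetricSpace t d X σ, AI p (K₀ ∪ M) by
    have := h _ subset_rfl
    rwa [Finset.union_sdiff_of_subset hK] at this
  intro M
  induction M using Finset.induction_on with
  | empty => intro _; simpa using h₀
  | insert v M hvM ih =>
    intro hM
    obtain ⟨p, hp, hAI⟩ := ih fun x hx => hM (Finset.mem_insert_of_mem hx)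
    have hv := Finset.mem_sdiff.1 (hM (Finset.mem_insert_self v M))
    have hsub : K₀ ∪ M ⊆ K := Finset.union_subset hK fun x hx =>
      (Finset.mem_sdiff.1 (hM (Finset.mem_insert_of_mem hx))).1
    have hv' : v ∉ K₀ ∪ M := by simp [hv.2, hvM]
    have hlt := Finset.card_lt_card
      (Finset.ssubset_iff_subset_ne.2 ⟨hsub, fun h => hv' (h ▸ hv.1)⟩)
    -- At most `d` points are already placed, so they lie in the zero set of a nonzero affine
    -- functional; `v` is moved off it. Its partner is not in `K`, so the other points of `K` stay
    -- put.
    obtain ⟨⟨a, b⟩, hne, hab⟩ := exists_affineFunctional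
      (fun u : (K₀ ∪ M : Finset V) => evalAffine (p u)) (by simp only [Fintype.card_coe]; omega)
    obtain ⟨x, hx⟩ : ∃ x : Fin d → ℝ, a ⬝ᵥ x + b ≠ 0 := by
      by_cases hb : b = 0
      · refine ⟨a, ?_⟩
        rw [hb, add_zero, Ne, dotProduct_self_eq_zero]
        rintro rfl
        exact hne (by rw [hb]; rfl)
      · exact ⟨0, by simpa using hb⟩
    obtain ⟨p', hp', hv'x, hagree⟩ := exists_modify hσ hp v x
    have hagree' : ∀ y ∈ K₀ ∪ M, p' y = p y := fun y hy =>
      hagree y (fun h => hv' (h ▸ hy)) fun hvX h => hs v hv.1 hv.2 hvX (h ▸ hsub hy)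
    refine ⟨p', hp', ?_⟩
    rw [Finset.union_insert]
    refine (hAI.congr hagree').insert_of_functional hv' a b (fun u hu => ?_) (by rwa [hv'x])
    rw [hagree' u hu]
    exact hab ⟨u, hu⟩

/-- Several pairs can be placed in general position, within the limits set by the dimensions of
the two eigenspaces. -/
theorem exists_ai_pairs (hσ : IsFreePairing X σ) (htd : t ≤ d) (P : Finset V) (hPX : P ⊆ X)
    (hP : ∀ u ∈ P, σ u ∉ P) (h1 : P.card ≤ t + 1) (h2 : P.card ≤ d - t) :
    ∃ p ∈ symmetricSpace t d X σ, AI p (P ∪ P.image σ) := by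
  induction P using Finset.induction_on with
  | empty => exact ⟨0, Submodule.zero_mem _, by simp [AI]⟩
  | insert u P huP ih =>
    rw [Finset.card_insert_of_notMem huP] at h1 h2
    have hPX' : P ⊆ X := fun x hx => hPX (Finset.mem_insert_of_mem hx)
    obtain ⟨p, hp, hAI⟩ := ih hPX'
      (fun x hx h => hP x (Finset.mem_insert_of_mem hx) (Finset.mem_insert_of_mem h))
      (by omega) (by omega)
    have huX : u ∈ X := hPX (Finset.mem_insert_self u P)
    have huσP : u ∉ P ∪ P.image σ := by
      simp only [Finset.mem_union, huP, Finset.mem_image, false_or, not_exists, not_and]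
      rintro x hx rfl
      exact hP x (Finset.mem_insert_of_mem hx) (Finset.mem_insert_self _ _)
    have hσuP : σ u ∉ P ∪ P.image σ := by
      simp only [Finset.mem_union, Finset.mem_image, not_or, not_exists, not_and]
      refine ⟨fun h => hP u (Finset.mem_insert_self u P) (Finset.mem_insert_of_mem h), ?_⟩
      intro x hx h
      rw [← hσ.involutive x (hPX' hx), h, hσ.involutive u huX] at hx
      exact huP hx
    -- An invariant functional, depending on fixed coordinates only, that vanishes on the old pairs;
    -- it exists because fewer than `t + 1` pairs have been placed.
    obtain ⟨⟨a, α⟩, hne, ha⟩ := exists_affineFunctional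
      (Sum.elim (fun z : P => evalAffine (p z))
        fun i : {i : Fin d // t ≤ (i : ℕ)} => coordAffine i.1)
      (by rw [Fintype.card_sum, Fintype.card_coe, card_coord_ge t d htd]; omega)
    -- A sign-changing functional, homogeneous in the reversed coordinates, that vanishes on the old
    -- pairs; it exists because fewer than `d - t` pairs have been placed.
    obtain ⟨⟨b, β⟩, hne', hb⟩ := exists_affineFunctional
      (Sum.elim (fun z : P => evalAffine (p z)) (Sum.elim
        (fun i : {i : Fin d // (i : ℕ) < t} => coordAffine i.1)
        fun _ : Unit => LinearMap.snd ℝ (Fin d → ℝ) ℝ))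
      (by rw [Fintype.card_sum, Fintype.card_coe, Fintype.card_sum, card_coord_lt t d htd,
            Fintype.card_unit]; omega)
    have hβ : β = 0 := hb (Sum.inr (Sum.inr ()))
    subst hβ
    have ha1 : ∀ i : Fin d, t ≤ i → a i = 0 := fun i hi => ha (Sum.inr ⟨i, hi⟩)
    have hb1 : ∀ i : Fin d, (i : ℕ) < t → b i = 0 := fun i hi => hb (Sum.inr (Sum.inl ⟨i, hi⟩))
    have ha2 : ∀ z ∈ P, a ⬝ᵥ p z + α = 0 := fun z hz => ha (Sum.inl ⟨z, hz⟩)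
    have hb2 : ∀ z ∈ P, b ⬝ᵥ p z = 0 := fun z hz => by
      have : b ⬝ᵥ p z + 0 = 0 := hb (Sum.inl ⟨z, hz⟩)
      rwa [add_zero] at this
    have hab : a ⬝ᵥ b = 0 := Finset.sum_eq_zero fun i _ => by
      by_cases hi : (i : ℕ) < t
      · simp [hb1 i hi]
      · simp [ha1 i (not_lt.1 hi)]
    have hbb : b ⬝ᵥ b ≠ 0 := by
      rw [Ne, dotProduct_self_eq_zero]
      rintro rfl
      exact hne' rfl
    obtain ⟨x, hxa, hxb⟩ : ∃ x : Fin d → ℝ, a ⬝ᵥ x + α ≠ 0 ∧ b ⬝ᵥ x ≠ 0 := by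
      by_cases hα : α = 0
      · refine ⟨a + b, ?_, ?_⟩
        · rw [hα, add_zero, dotProduct_add, hab, add_zero, Ne, dotProduct_self_eq_zero]
          rintro rfl
          exact hne (by rw [hα]; rfl)
        · rwa [dotProduct_add, dotProduct_comm, hab, zero_add]
      · exact ⟨b, by rwa [hab, zero_add], hbb⟩
    obtain ⟨p', hp', hux, hagree⟩ := exists_modify hσ hp u x
    have hσux : p' (σ u) = signMatrix t d *ᵥ x := by rw [hp' u huX, hux]
    have hagree' : ∀ y ∈ P ∪ P.image σ, p' y = p y := fun y hy =>
      hagree y (fun h => huσP (h ▸ hy)) fun _ h => hσuP (h ▸ hy)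
    have hva : ∀ y ∈ P ∪ P.image σ, a ⬝ᵥ p' y + α = 0 ∧ b ⬝ᵥ p' y = 0 := by
      intro y hy
      rw [hagree' y hy]
      rcases Finset.mem_union.1 hy with hy | hy
      · exact ⟨ha2 y hy, hb2 y hy⟩
      · obtain ⟨z, hz, rfl⟩ := Finset.mem_image.1 hy
        rw [hp z (hPX' hz), dotProduct_signMatrix_of_fixed ha1,
          dotProduct_signMatrix_of_reversed hb1, hb2 z hz, neg_zero]
        exact ⟨ha2 z hz, rfl⟩
    have hins := (hAI.congr hagree').insert_of_functional huσP a α (fun y hy => (hva y hy).1)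
      (by rwa [hux])
    have hσu' : σ u ∉ insert u (P ∪ P.image σ) := by
      rw [Finset.mem_insert, not_or]
      exact ⟨hσ.free u huX, hσuP⟩
    -- This combination vanishes at the new point `x`. The invariant part agrees at the mirror image
    -- of `x` and the other part changes sign, so its value there is twice a product of two nonzero
    -- numbers.
    have hins' := hins.insert_of_functional hσu' ((b ⬝ᵥ x) • a - (a ⬝ᵥ x + α) • b)
      ((b ⬝ᵥ x) * α) ?_ ?_
    · refine ⟨p', hp', ?_⟩
      rwa [Finset.image_insert, Finset.insert_union, Finset.union_insert, Finset.insert_comm]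
    · intro y hy
      simp only [sub_dotProduct, smul_dotProduct, smul_eq_mul]
      rcases Finset.mem_insert.1 hy with rfl | hy
      · rw [hux]; ring
      · linear_combination (b ⬝ᵥ x) * (hva y hy).1 - (a ⬝ᵥ x + α) * (hva y hy).2
    · simp only [sub_dotProduct, smul_dotProduct, smul_eq_mul]
      rw [hσux, dotProduct_signMatrix_of_fixed ha1, dotProduct_signMatrix_of_reversed hb1]
      have : 2 * ((b ⬝ᵥ x) * (a ⬝ᵥ x + α)) ≠ 0 :=
        mul_ne_zero two_ne_zero (mul_ne_zero hxb hxa)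
      convert this using 1
      ring

/-- `K` contains at most one pair `{u, σ u}`. -/
def FewPairs (X : Finset V) (σ : V → V) (K : Finset V) : Prop :=
  ∀ u ∈ K, ∀ v ∈ K, u ∈ X → v ∈ X → σ u ∈ K → σ v ∈ K → v = u ∨ v = σ u

theorem holdsGenerically_ai_of_subset (hσ : IsFreePairing X σ) {K₀ K : Finset V} (hK : K₀ ⊆ K)
    (h₀ : ∃ p ∈ symmetricSpace t d X σ, AI p K₀)
    (hs : ∀ v ∈ K, v ∉ K₀ → v ∈ X → σ v ∉ K) (hcard : K.card ≤ d + 1) :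
    HoldsGenerically (symmetricSpace t d X σ) fun p => AI p K :=
  ⟨lineOpen_ai K, exists_ai_of_subset hσ hK h₀ hs hcard⟩

/-- A single pair can always be placed, since `t < d` provides a reversed coordinate. The other
vertices of `K` have no partner in `K` and are free. -/
theorem FewPairs.holdsGenerically_ai (hσ : IsFreePairing X σ) (htd : t < d) {K : Finset V}
    (hK : FewPairs X σ K) (hcard : K.card ≤ d + 1) :
    HoldsGenerically (symmetricSpace t d X σ) fun p => AI p K := by
  by_cases h : ∃ u ∈ K, u ∈ X ∧ σ u ∈ K
  · obtain ⟨u, hu, huX, hσu⟩ := h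
    refine holdsGenerically_ai_of_subset hσ (K₀ := {u} ∪ ({u} : Finset V).image σ) ?_
      (exists_ai_pairs hσ htd.le {u} (by simpa using huX) (by simpa using hσ.free u huX)
        (by simp) (by simp; omega)) ?_ hcard
    · simp [Finset.insert_subset_iff, hu, hσu]
    · intro v hv hv' hvX hσv
      refine hv' ?_
      rcases hK u hu v hv huX hvX hσu hσv with rfl | rfl <;> simp
  · push Not at h
    exact holdsGenerically_ai_of_subset hσ (Finset.empty_subset K)
      ⟨0, Submodule.zero_mem _, by simp [AI]⟩ (fun v hv _ hvX => h v hv hvX) hcard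

/-- A largest subset containing no pair works: a vertex outside it and its image could be added. -/
theorem IsFreePairing.exists_transversal (hσ : IsFreePairing X σ) :
    ∃ P ⊆ X, (∀ u ∈ P, σ u ∉ P) ∧ X = P ∪ P.image σ ∧ X.card = 2 * P.card := by
  obtain ⟨P, hP, hmax⟩ := Finset.exists_max_image
    (X.powerset.filter fun P => ∀ u ∈ P, σ u ∉ P) Finset.card ⟨∅, by simp⟩
  obtain ⟨hPX, hPσ⟩ := Finset.mem_filter.1 hP
  rw [Finset.mem_powerset] at hPX
  have hX : X = P ∪ P.image σ := by
    refine Finset.Subset.antisymm (fun x hx => ?_) (Finset.union_subset hPX fun x hx => ?_)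
    · by_contra hcon
      simp only [Finset.mem_union, Finset.mem_image, not_or, not_exists, not_and] at hcon
      have := hmax (insert x P) (Finset.mem_filter.2
        ⟨Finset.mem_powerset.2 (Finset.insert_subset hx hPX), fun u hu h => ?_⟩)
      · rw [Finset.card_insert_of_notMem hcon.1] at this
        omega
      · rcases Finset.mem_insert.1 hu with rfl | hu <;> rcases Finset.mem_insert.1 h with h | h
        · exact hσ.free u hx h
        · exact hcon.2 (σ u) h (hσ.involutive u hx)
        · exact hcon.2 u hu h
        · exact hPσ u hu h
    · obtain ⟨z, hz, rfl⟩ := Finset.mem_image.1 hx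
      exact hσ.mapsTo z (hPX hz)
  refine ⟨P, hPX, hPσ, hX, ?_⟩
  have hinj : Set.InjOn σ P := fun a ha b hb hab => by
    rw [← hσ.involutive a (hPX ha), hab, hσ.involutive b (hPX hb)]
  have hdisj : Disjoint P (P.image σ) := by
    rw [Finset.disjoint_right]
    intro x hx
    obtain ⟨z, hz, rfl⟩ := Finset.mem_image.1 hx
    exact hPσ z hz
  conv_lhs => rw [hX]
  rw [Finset.card_union_of_disjoint hdisj, Finset.card_image_of_injOn hinj]
  ring

end Symmetric

end Z2Rigidity

namespace Z2Rigidity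

/-! ### Cycles modulo two -/

section Chains

variable {V : Type*} [DecidableEq V]

/-- The number of facets of `C` containing `G`. -/
def deg (C : Finset (Finset V)) (G : Finset V) : ℕ := (C.filter fun F => G ⊆ F).card

/-- `C` is a `k`-cycle modulo two. -/
def Cyc (k : ℕ) (C : Finset (Finset V)) : Prop :=
  (∀ F ∈ C, F.card = k + 1) ∧ ∀ G : Finset V, G.card = k → Even (deg C G)

/-- `C` is a minimal non-empty cycle. -/
def Circuit (k : ℕ) (C : Finset (Finset V)) : Prop :=
  Cyc k C ∧ C.Nonempty ∧ ∀ D ⊆ C, D.Nonempty → Cyc k D → D = C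

theorem deg_union {C D : Finset (Finset V)} (h : Disjoint C D) (G : Finset V) :
    deg (C ∪ D) G = deg C G + deg D G := by
  rw [deg, Finset.filter_union, Finset.card_union_of_disjoint (Finset.disjoint_filter_filter h)]
  rfl

theorem deg_sdiff {C D : Finset (Finset V)} (h : D ⊆ C) (G : Finset V) :
    deg (C \ D) G + deg D G = deg C G := by
  rw [← deg_union Finset.sdiff_disjoint, Finset.sdiff_union_of_subset h]

theorem Cyc.sdiff {k : ℕ} {C D : Finset (Finset V)} (hC : Cyc k C) (hD : Cyc k D) (h : D ⊆ C) :
    Cyc k (C \ D) := by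
  refine ⟨fun F hF => hC.1 F (Finset.mem_sdiff.1 hF).1, fun G hG => ?_⟩
  have h1 := hC.2 G hG
  rw [← deg_sdiff h] at h1
  exact (Nat.even_add.1 h1).2 (hD.2 G hG)

theorem Cyc.union {k : ℕ} {C D : Finset (Finset V)} (hC : Cyc k C) (hD : Cyc k D)
    (h : Disjoint C D) : Cyc k (C ∪ D) := by
  refine ⟨fun F hF => (Finset.mem_union.1 hF).elim (hC.1 F) (hD.1 F), fun G hG => ?_⟩
  rw [deg_union h]
  exact (hC.2 G hG).add (hD.2 G hG)

theorem Cyc.exists_circuit {k : ℕ} {C : Finset (Finset V)} (hC : Cyc k C) (hne : C.Nonempty) :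
    ∃ D ⊆ C, Circuit k D := by
  induction C using Finset.strongInduction with
  | H C ih =>
    by_cases h : ∀ D ⊆ C, D.Nonempty → Cyc k D → D = C
    · exact ⟨C, subset_rfl, hC, hne, h⟩
    · push Not at h
      obtain ⟨D, hDC, hD, hcyc, hDne⟩ := h
      obtain ⟨D', hD', hcirc⟩ := ih D (Finset.ssubset_iff_subset_ne.2 ⟨hDC, hDne⟩) hcyc hD
      exact ⟨D', hD'.trans hDC, hcirc⟩

theorem Cyc.exists_circuit_mem {k : ℕ} {C : Finset (Finset V)} (hC : Cyc k C) {F : Finset V}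
    (hF : F ∈ C) : ∃ D ⊆ C, Circuit k D ∧ F ∈ D := by
  induction C using Finset.strongInduction with
  | H C ih =>
    obtain ⟨D, hDC, hD⟩ := hC.exists_circuit ⟨F, hF⟩
    by_cases hFD : F ∈ D
    · exact ⟨D, hDC, hD, hFD⟩
    · obtain ⟨D', hD', h⟩ := ih (C \ D) (Finset.sdiff_ssubset hDC hD.2.1) (hC.sdiff hD.1 hDC)
        (Finset.mem_sdiff.2 ⟨hF, hFD⟩)
      exact ⟨D', hD'.trans Finset.sdiff_subset, h⟩

/-- A set of facets that no circuit crosses is a cycle. -/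
theorem Cyc.of_circuits {k : ℕ} {C W : Finset (Finset V)} (hC : Cyc k C) (hW : W ⊆ C)
    (h : ∀ D ⊆ C, Circuit k D → D ⊆ W ∨ Disjoint D W) : Cyc k W := by
  induction C using Finset.strongInduction generalizing W with
  | H C ih =>
    rcases C.eq_empty_or_nonempty with rfl | hne
    · rwa [Finset.subset_empty.1 hW]
    · obtain ⟨D, hDC, hD⟩ := hC.exists_circuit hne
      have h1 : Cyc k (W \ D) := by
        refine ih (C \ D) (Finset.sdiff_ssubset hDC hD.2.1) (hC.sdiff hD.1 hDC)
          (Finset.sdiff_subset_sdiff hW subset_rfl) fun D' hD' hcirc => ?_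
        rcases h D' (hD'.trans Finset.sdiff_subset) hcirc with h2 | h2
        · exact Or.inl fun F hF => Finset.mem_sdiff.2 ⟨h2 hF, (Finset.mem_sdiff.1 (hD' hF)).2⟩
        · exact Or.inr (h2.mono_right Finset.sdiff_subset)
      rcases h D hDC hD with h2 | h2
      · rw [← Finset.sdiff_union_of_subset h2]
        exact h1.union hD.1 Finset.sdiff_disjoint
      · rwa [Finset.sdiff_eq_self_of_disjoint h2.symm] at h1

/-- The boundary of a chain is a cycle: the number of odd `k`-sets containing a given
`(k-1)`-set is not one. -/
theorem exists_odd_deg_ne {k : ℕ} {C : Finset (Finset V)} (hC : ∀ F ∈ C, F.card = k + 1)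
    {G J : Finset V} (hG : G.card = k) (hJG : J ⊆ G) (hJ : J.card + 1 = k)
    (hodd : Odd (deg C G)) :
    ∃ G' : Finset V, G'.card = k ∧ J ⊆ G' ∧ G' ≠ G ∧ Odd (deg C G') := by
  by_contra hcon
  push Not at hcon
  let N : Finset (Finset V) := ((C.biUnion id).powersetCard k).filter fun G => J ⊆ G
  -- Double counting of incidences: a facet containing `J` contains exactly two `k`-sets that
  -- contain `J`, so the total is even.
  have hsum : ∑ G ∈ N, deg C G = ∑ F ∈ C, (N.filter fun G => G ⊆ F).card := by
    simp only [deg, Finset.card_filter]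
    exact Finset.sum_comm
  have heven : Even (∑ G ∈ N, deg C G) := by
    rw [hsum]
    refine Finset.even_sum _ fun F hF => ?_
    by_cases hJF : J ⊆ F
    · have : N.filter (fun G => G ⊆ F) = (F \ J).image fun x => insert x J := by
        ext G
        simp only [N, Finset.mem_filter, Finset.mem_powersetCard, Finset.mem_image,
          Finset.mem_sdiff]
        constructor
        · rintro ⟨⟨⟨-, hGk⟩, hJG⟩, hGF⟩
          have hc : (G \ J).card = 1 := by
            rw [Finset.card_sdiff_of_subset hJG]; omega
          obtain ⟨x, hx⟩ := Finset.card_eq_one.1 hc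
          have hx' : x ∈ G \ J := by rw [hx]; exact Finset.mem_singleton_self x
          refine ⟨x, ⟨hGF (Finset.mem_sdiff.1 hx').1, (Finset.mem_sdiff.1 hx').2⟩, ?_⟩
          rw [← Finset.sdiff_union_of_subset hJG, hx]
          rfl
        · rintro ⟨x, ⟨hxF, hxJ⟩, rfl⟩
          have hsub : insert x J ⊆ F := Finset.insert_subset hxF hJF
          refine ⟨⟨⟨hsub.trans (Finset.subset_biUnion_of_mem id hF), ?_⟩,
            Finset.subset_insert x J⟩, hsub⟩
          rw [Finset.card_insert_of_notMem hxJ, hJ]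
      rw [this, Finset.card_image_of_injOn, Finset.card_sdiff_of_subset hJF, hC F hF]
      · exact ⟨1, by omega⟩
      · intro x hx y hy hxy
        have hx' := (Finset.mem_sdiff.1 hx).2
        have : x ∈ insert y J := by
          rw [← show insert x J = insert y J from hxy]; exact Finset.mem_insert_self x J
        exact (Finset.mem_insert.1 this).resolve_right hx'
    · rw [Finset.filter_eq_empty_iff.2]
      · simp
      · intro G hGN hGF
        exact hJF ((Finset.mem_filter.1 hGN).2.trans hGF)
  have hGN : G ∈ N := by
    obtain ⟨F, hF⟩ := Finset.card_pos.1 hodd.pos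
    obtain ⟨hF, hGF⟩ := Finset.mem_filter.1 hF
    exact Finset.mem_filter.2 ⟨Finset.mem_powersetCard.2
      ⟨hGF.trans (Finset.subset_biUnion_of_mem id hF), hG⟩, hJG⟩
  rw [← Finset.add_sum_erase _ _ hGN] at heven
  have h2 : Even (∑ G' ∈ N.erase G, deg C G') := Finset.even_sum _ fun G' hG' => by
    obtain ⟨hne, hG'N⟩ := Finset.mem_erase.1 hG'
    obtain ⟨h3, h4⟩ := Finset.mem_filter.1 hG'N
    exact Nat.not_odd_iff_even.1 (hcon G' (Finset.mem_powersetCard.1 h3).2 h4 hne)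
  exact Nat.not_even_iff_odd.2 hodd ((Nat.even_add.1 heven).2 h2)

/-- The image of a set modulo two. -/
def oddImage {α β : Type*} [DecidableEq β] (g : α → β) (A : Finset α) : Finset β :=
  (A.image g).filter fun b => Odd (A.filter fun a => g a = b).card

theorem odd_card_oddImage {α β : Type*} [DecidableEq β] (g : α → β) (A : Finset α)
    (P : β → Prop) [DecidablePred P] :
    Odd ((oddImage g A).filter P).card ↔ Odd (A.filter fun a => P (g a)).card := by
  have h1 : (A.filter fun a => P (g a)).card =
      ∑ b ∈ (A.image g).filter P, (A.filter fun a => g a = b).card := by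
    rw [Finset.card_eq_sum_card_fiberwise (f := g) (t := (A.image g).filter P)]
    · refine Finset.sum_congr rfl fun b hb => ?_
      rw [Finset.filter_filter]
      congr 1
      refine Finset.filter_congr fun a _ => ?_
      constructor
      · exact fun h => h.2
      · rintro rfl
        exact ⟨(Finset.mem_filter.1 hb).2, rfl⟩
    · intro a ha
      have ha' := Finset.mem_filter.1 ha
      exact Finset.mem_filter.2 ⟨Finset.mem_image_of_mem g ha'.1, ha'.2⟩
  rw [h1, Finset.odd_sum_iff_odd_card_odd, oddImage, Finset.filter_filter, Finset.filter_filter]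
  simp only [and_comm]

/-! ### Contraction of an edge -/

/-- Replace the vertex `u` by `v`. -/
def merge (u v : V) (F : Finset V) : Finset V := if u ∈ F then insert v (F.erase u) else F

/-- The facets that do not contain the edge `uv`. -/
def cut (u v : V) (C : Finset (Finset V)) : Finset (Finset V) :=
  C.filter fun F => ¬ (u ∈ F ∧ v ∈ F)

/-- The contraction of `u` to `v`, modulo two. -/
def push (u v : V) (C : Finset (Finset V)) : Finset (Finset V) :=
  oddImage (merge u v) (cut u v C)

theorem mem_cut {u v : V} {C : Finset (Finset V)} {F : Finset V} :
    F ∈ cut u v C ↔ F ∈ C ∧ ¬ (u ∈ F ∧ v ∈ F) := Finset.mem_filter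

theorem merge_of_mem {u v : V} {F : Finset V} (h : u ∈ F) : merge u v F = insert v (F.erase u) :=
  if_pos h

theorem merge_of_notMem {u v : V} {F : Finset V} (h : u ∉ F) : merge u v F = F := if_neg h

theorem notMem_merge {u v : V} (huv : u ≠ v) (F : Finset V) : u ∉ merge u v F := by
  by_cases h : u ∈ F
  · rw [merge_of_mem h]; simp [huv]
  · rwa [merge_of_notMem h]

theorem card_merge {u v : V} {F : Finset V} (h : ¬ (u ∈ F ∧ v ∈ F)) :
    (merge u v F).card = F.card := by
  by_cases hu : u ∈ F
  · rw [merge_of_mem hu, Finset.card_insert_of_notMem (by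
      rw [Finset.mem_erase, not_and]; exact fun _ hv => h ⟨hu, hv⟩),
      Finset.card_erase_add_one hu]
  · rw [merge_of_notMem hu]

theorem merge_insert_left {u v : V} {H : Finset V} (hu : u ∉ H) :
    merge u v (insert u H) = insert v H := by
  rw [merge_of_mem (Finset.mem_insert_self u H), Finset.erase_insert hu]

theorem merge_insert_right {u v : V} (huv : u ≠ v) {H : Finset V} (hu : u ∉ H) :
    merge u v (insert v H) = insert v H :=
  merge_of_notMem (by simp [huv, hu])

theorem mem_merge_of_ne {u v x : V} {F : Finset V} (hxu : x ≠ u) (hxv : x ≠ v) :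
    x ∈ merge u v F ↔ x ∈ F := by
  by_cases h : u ∈ F
  · rw [merge_of_mem h]; simp [hxu, hxv]
  · rw [merge_of_notMem h]

/-- Elements of a face after contraction come from elements before contraction. -/
theorem exists_of_mem_merge {u v x : V} {F : Finset V} (h : x ∈ merge u v F) :
    x ∈ F ∨ (x = v ∧ u ∈ F) := by
  by_cases hu : u ∈ F
  · rw [merge_of_mem hu, Finset.mem_insert, Finset.mem_erase] at h
    rcases h with h | h
    · exact Or.inr ⟨h, hu⟩
    · exact Or.inl h.2
  · rw [merge_of_notMem hu] at h
    exact Or.inl h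

/-- `merge` is injective on the faces through `u` that avoid `v` and is the identity on those
avoiding `u`, so a collision involves one face of each kind. -/
theorem merge_eq_cases {u v : V} {F F' : Finset V} (hF : ¬ (u ∈ F ∧ v ∈ F))
    (hF' : ¬ (u ∈ F' ∧ v ∈ F')) (h : merge u v F = merge u v F') (hne : F ≠ F') :
    ∃ H, u ∉ H ∧ v ∉ H ∧
      (F = insert u H ∧ F' = insert v H ∨ F = insert v H ∧ F' = insert u H) := by
  by_cases hu : u ∈ F <;> by_cases hu' : u ∈ F'
  · rw [merge_of_mem hu, merge_of_mem hu'] at h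
    have hv : v ∉ F.erase u := fun hv => hF ⟨hu, Finset.mem_of_mem_erase hv⟩
    have hv' : v ∉ F'.erase u := fun hv => hF' ⟨hu', Finset.mem_of_mem_erase hv⟩
    refine absurd ?_ hne
    rw [← Finset.insert_erase hu, ← Finset.insert_erase hu', ← Finset.erase_insert hv, h,
      Finset.erase_insert hv']
  · rw [merge_of_mem hu, merge_of_notMem hu'] at h
    exact ⟨F.erase u, Finset.notMem_erase u F, fun hv => hF ⟨hu, Finset.mem_of_mem_erase hv⟩,
      Or.inl ⟨(Finset.insert_erase hu).symm, h.symm⟩⟩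
  · rw [merge_of_notMem hu, merge_of_mem hu'] at h
    exact ⟨F'.erase u, Finset.notMem_erase u F', fun hv => hF' ⟨hu', Finset.mem_of_mem_erase hv⟩,
      Or.inr ⟨h, (Finset.insert_erase hu').symm⟩⟩
  · rw [merge_of_notMem hu, merge_of_notMem hu'] at h
    exact absurd h hne

theorem mem_push {u v : V} {C : Finset (Finset V)} {b : Finset V} :
    b ∈ push u v C ↔ Odd ((cut u v C).filter fun F => merge u v F = b).card := by
  rw [push, oddImage, Finset.mem_filter, and_iff_right_iff_imp]
  intro h
  obtain ⟨F, hF⟩ := Finset.card_pos.1 h.pos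
  exact Finset.mem_image.2 ⟨F, Finset.mem_filter.1 hF⟩

theorem exists_of_mem_push {u v : V} {C : Finset (Finset V)} {b : Finset V}
    (h : b ∈ push u v C) : ∃ F ∈ C, ¬ (u ∈ F ∧ v ∈ F) ∧ merge u v F = b := by
  obtain ⟨F, hF⟩ := Finset.card_pos.1 (mem_push.1 h).pos
  have hF' := Finset.mem_filter.1 hF
  exact ⟨F, (mem_cut.1 hF'.1).1, (mem_cut.1 hF'.1).2, hF'.2⟩

theorem card_of_mem_push {k : ℕ} {u v : V} {C : Finset (Finset V)} {b : Finset V}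
    (hC : ∀ F ∈ C, F.card = k + 1) (h : b ∈ push u v C) : b.card = k + 1 := by
  obtain ⟨F, hF, hF', rfl⟩ := exists_of_mem_push h
  rw [card_merge hF', hC F hF]

/-- The facets of `C` that do not contain `uv` either survive in the contraction or cancel
in pairs. -/
theorem mem_push_or {u v : V} (huv : u ≠ v) {C : Finset (Finset V)} {F : Finset V} (hF : F ∈ C)
    (hF' : ¬ (u ∈ F ∧ v ∈ F)) :
    (merge u v F ∈ push u v C ∧
      (cut u v C).filter (fun F' => merge u v F' = merge u v F) = {F}) ∨
    (merge u v F ∉ push u v C ∧ ∃ H, u ∉ H ∧ v ∉ H ∧ insert u H ∈ C ∧ insert v H ∈ C ∧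
      (F = insert u H ∨ F = insert v H) ∧
      (cut u v C).filter (fun F' => merge u v F' = merge u v F) = {insert u H, insert v H}) := by
  by_cases h : (cut u v C).filter (fun F' => merge u v F' = merge u v F) = {F}
  · refine Or.inl ⟨?_, h⟩
    rw [mem_push, h]
    simp
  · right
    have hFmem : F ∈ (cut u v C).filter (fun F' => merge u v F' = merge u v F) :=
      Finset.mem_filter.2 ⟨mem_cut.2 ⟨hF, hF'⟩, rfl⟩
    obtain ⟨F', hF'mem, hne⟩ : ∃ F' ∈ (cut u v C).filter (fun F' => merge u v F' = merge u v F),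
        F' ≠ F := by
      by_contra hcon
      push Not at hcon
      exact h (Finset.eq_singleton_iff_unique_mem.2 ⟨hFmem, hcon⟩)
    obtain ⟨hF'c, hmerge⟩ := Finset.mem_filter.1 hF'mem
    obtain ⟨hF'C, hF'uv⟩ := mem_cut.1 hF'c
    obtain ⟨H, huH, hvH, hcase⟩ := merge_eq_cases hF'uv hF' hmerge hne
    have hmem : insert u H ∈ C ∧ insert v H ∈ C ∧ (F = insert u H ∨ F = insert v H) := by
      rcases hcase with ⟨rfl, rfl⟩ | ⟨rfl, rfl⟩
      · exact ⟨hF'C, hF, Or.inr rfl⟩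
      · exact ⟨hF, hF'C, Or.inl rfl⟩
    have hmF : merge u v F = insert v H := by
      rcases hmem.2.2 with rfl | rfl
      · exact merge_insert_left huH
      · exact merge_insert_right huv huH
    have hfib : (cut u v C).filter (fun F' => merge u v F' = merge u v F) =
        {insert u H, insert v H} := by
      ext E
      rw [Finset.mem_filter, mem_cut, hmF, Finset.mem_insert, Finset.mem_singleton]
      constructor
      · rintro ⟨⟨-, hEuv⟩, hE⟩
        by_cases huE : u ∈ E
        · left
          have hvE : v ∉ E.erase u := fun h => hEuv ⟨huE, Finset.mem_of_mem_erase h⟩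
          rw [merge_of_mem huE] at hE
          rw [← Finset.insert_erase huE, ← Finset.erase_insert hvE, hE, Finset.erase_insert hvH]
        · right
          rwa [merge_of_notMem huE] at hE
      · rintro (rfl | rfl)
        · exact ⟨⟨hmem.1, by simp [huv.symm, hvH]⟩, merge_insert_left huH⟩
        · exact ⟨⟨hmem.2.1, by simp [huv, huH]⟩, merge_insert_right huv huH⟩
    refine ⟨?_, H, huH, hvH, hmem.1, hmem.2.1, hmem.2.2, hfib⟩
    rw [mem_push, hfib, Finset.card_pair]
    · decide
    · intro hEq
      have : u ∈ insert v H := hEq ▸ Finset.mem_insert_self u H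
      simp [huv, huH] at this

/-- A facet that survives contraction in `C` is alone in its fibre, and so it is alone in any
subfamily. -/
theorem merge_mem_push_of_subset {u v : V} (huv : u ≠ v) {C Z : Finset (Finset V)} (hZ : Z ⊆ C)
    {F : Finset V} (hF : F ∈ Z) (hF' : ¬ (u ∈ F ∧ v ∈ F)) (h : merge u v F ∈ push u v C) :
    merge u v F ∈ push u v Z := by
  have hfib : (cut u v Z).filter (fun F' => merge u v F' = merge u v F) = {F} := by
    rcases mem_push_or huv (hZ hF) hF' with ⟨-, h1⟩ | ⟨h1, -⟩
    · refine Finset.eq_singleton_iff_unique_mem.2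
        ⟨Finset.mem_filter.2 ⟨mem_cut.2 ⟨hF, hF'⟩, rfl⟩, fun E hE => ?_⟩
      rw [← Finset.mem_singleton, ← h1]
      exact Finset.filter_subset_filter _ (Finset.filter_subset_filter _ hZ) hE
    · exact absurd h h1
  rw [mem_push, hfib]
  simp

/-- The contraction of a subfamily can have new facets only if the subfamily separates two facets
that cancel in `C`; closure under cancelling pairs excludes this. -/
theorem push_subset_push {u v : V} (huv : u ≠ v) {C Z : Finset (Finset V)} (hZ : Z ⊆ C)
    (hcl : ∀ H, u ∉ H → v ∉ H → insert u H ∈ C → insert v H ∈ C →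
      (insert u H ∈ Z ↔ insert v H ∈ Z)) : push u v Z ⊆ push u v C := by
  intro b hb
  obtain ⟨F, hF, hF', rfl⟩ := exists_of_mem_push hb
  rcases mem_push_or huv (hZ hF) hF' with ⟨h1, -⟩ | ⟨-, H, huH, hvH, hu, hv, hFH, hfib⟩
  · exact h1
  · exfalso
    have hboth : insert u H ∈ Z ∧ insert v H ∈ Z := by
      rcases hFH with rfl | rfl
      · exact ⟨hF, (hcl H huH hvH hu hv).1 hF⟩
      · exact ⟨(hcl H huH hvH hu hv).2 hF, hF⟩
    rw [mem_push] at hb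
    have hfibZ : (cut u v Z).filter (fun F' => merge u v F' = merge u v F) =
        {insert u H, insert v H} := by
      refine Finset.Subset.antisymm ?_ ?_
      · rw [← hfib]
        exact Finset.filter_subset_filter _ (Finset.filter_subset_filter _ hZ)
      · intro E hE
        have hE' := hE
        rw [← hfib] at hE'
        obtain ⟨h2, h3⟩ := Finset.mem_filter.1 hE'
        refine Finset.mem_filter.2 ⟨mem_cut.2 ⟨?_, (mem_cut.1 h2).2⟩, h3⟩
        rcases Finset.mem_insert.1 hE with rfl | hE
        · exact hboth.1
        · rw [Finset.mem_singleton.1 hE]; exact hboth.2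
    rw [hfibZ, Finset.card_pair] at hb
    · exact absurd hb (by decide)
    · intro hEq
      have : u ∈ insert v H := hEq ▸ Finset.mem_insert_self u H
      simp [huv, huH] at this

theorem odd_deg_push {u v : V} {C : Finset (Finset V)} (G : Finset V) :
    Odd (deg (push u v C) G) ↔ Odd ((cut u v C).filter fun F => G ⊆ merge u v F).card :=
  odd_card_oddImage _ _ _

theorem deg_eq_deg_cut_add {u v : V} (C : Finset (Finset V)) (G : Finset V) :
    deg C G = deg (cut u v C) G + deg (C.filter fun F => u ∈ F ∧ v ∈ F) G := by
  rw [add_comm, ← deg_union, cut, Finset.filter_union_filter_not_eq]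
  exact Finset.disjoint_filter_filter_not _ _ _

/-- A lost facet through `G` would contain `G`, `u` and `v`, which are `k + 2` vertices. -/
theorem odd_deg_push_of_notMem {k : ℕ} {u v : V} (huv : u ≠ v) {C : Finset (Finset V)}
    (hC : ∀ F ∈ C, F.card = k + 1) {G : Finset V} (hG : G.card = k) (hu : u ∉ G) (hv : v ∉ G) :
    Odd (deg (push u v C) G) ↔ Odd (deg C G) := by
  rw [odd_deg_push, deg_eq_deg_cut_add (u := u) (v := v) C G]
  have h0 : deg (C.filter fun F => u ∈ F ∧ v ∈ F) G = 0 := by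
    rw [deg, Finset.card_eq_zero, Finset.filter_eq_empty_iff]
    intro F hF hGF
    obtain ⟨hF, huF, hvF⟩ := Finset.mem_filter.1 hF
    have h1 : insert u (insert v G) ⊆ F :=
      Finset.insert_subset huF (Finset.insert_subset hvF hGF)
    have h2 := Finset.card_le_card h1
    rw [Finset.card_insert_of_notMem (by simp [huv, hu]), Finset.card_insert_of_notMem hv, hG,
      hC F hF] at h2
    omega
  rw [h0, add_zero, deg]
  have : ((cut u v C).filter fun F => G ⊆ merge u v F) = (cut u v C).filter fun F => G ⊆ F := by
    refine Finset.filter_congr fun F _ => ?_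
    refine forall_congr' fun x => imp_congr_right fun hx => ?_
    exact mem_merge_of_ne (fun h => hu (h ▸ hx)) (fun h => hv (h ▸ hx))
  rw [this]

/-- Facets through both `u` and `v` count equally for `insert u H` and `insert v H`, so they drop
out of the sum modulo two. -/
theorem odd_deg_push_insert {u v : V} {C : Finset (Finset V)} {H : Finset V}
    (hu : u ∉ H) (hv : v ∉ H) :
    Odd (deg (push u v C) (insert v H)) ↔ Odd (deg C (insert u H) + deg C (insert v H)) := by
  rw [odd_deg_push, deg_eq_deg_cut_add (u := u) (v := v) C (insert u H),
    deg_eq_deg_cut_add (u := u) (v := v) C (insert v H)]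
  have h1 : deg (C.filter fun F => u ∈ F ∧ v ∈ F) (insert u H) =
      deg (C.filter fun F => u ∈ F ∧ v ∈ F) (insert v H) := by
    rw [deg, deg]
    congr 1
    refine Finset.filter_congr fun F hF => ?_
    obtain ⟨-, huF, hvF⟩ := Finset.mem_filter.1 hF
    simp [Finset.insert_subset_iff, huF, hvF]
  have h2 : ((cut u v C).filter fun F => insert v H ⊆ merge u v F) =
      ((cut u v C).filter fun F => insert u H ⊆ F) ∪
        (cut u v C).filter fun F => insert v H ⊆ F := by
    rw [← Finset.filter_or]
    refine Finset.filter_congr fun F hF => ?_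
    have hF' := (mem_cut.1 hF).2
    have hH : H ⊆ merge u v F ↔ H ⊆ F := forall_congr' fun x => imp_congr_right fun hx =>
      mem_merge_of_ne (fun h => hu (h ▸ hx)) (fun h => hv (h ▸ hx))
    rw [Finset.insert_subset_iff, Finset.insert_subset_iff, Finset.insert_subset_iff, hH,
      ← or_and_right]
    refine and_congr_left fun _ => ?_
    by_cases huF : u ∈ F
    · simp [merge_of_mem huF, huF]
    · simp [merge_of_notMem huF, huF]
  have h3 : Disjoint ((cut u v C).filter fun F => insert u H ⊆ F)
      ((cut u v C).filter fun F => insert v H ⊆ F) := by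
    rw [Finset.disjoint_left]
    intro F hF hF'
    obtain ⟨hFc, hFu⟩ := Finset.mem_filter.1 hF
    exact (mem_cut.1 hFc).2 ⟨hFu (Finset.mem_insert_self _ _),
      (Finset.mem_filter.1 hF').2 (Finset.mem_insert_self _ _)⟩
  rw [h2, Finset.card_union_of_disjoint h3, h1]
  change Odd (deg _ _ + deg _ _) ↔ _
  rw [show ∀ a b c : ℕ, a + c + (b + c) = (a + b) + 2 * c by intros; ring]
  exact (Nat.odd_add.trans (by simp)).symm

theorem Cyc.push {k : ℕ} {u v : V} (huv : u ≠ v) {C : Finset (Finset V)} (hC : Cyc k C) :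
    Cyc k (push u v C) := by
  refine ⟨fun F hF => card_of_mem_push hC.1 hF, fun G hG => ?_⟩
  by_cases huG : u ∈ G
  · have : deg (Z2Rigidity.push u v C) G = 0 := by
      rw [deg, Finset.card_eq_zero, Finset.filter_eq_empty_iff]
      intro F hF hGF
      obtain ⟨F', -, -, rfl⟩ := exists_of_mem_push hF
      exact notMem_merge huv F' (hGF huG)
    rw [this]
    exact Even.zero
  rw [← Nat.not_odd_iff_even]
  by_cases hvG : v ∈ G
  · obtain ⟨H, hvH, rfl⟩ : ∃ H, v ∉ H ∧ insert v H = G :=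
      ⟨G.erase v, Finset.notMem_erase v G, Finset.insert_erase hvG⟩
    have huH : u ∉ H := fun h => huG (Finset.mem_insert_of_mem h)
    rw [odd_deg_push_insert huH hvH, Nat.not_odd_iff_even]
    refine (hC.2 _ ?_).add (hC.2 _ hG)
    rw [Finset.card_insert_of_notMem huH, ← Finset.card_insert_of_notMem hvH, hG]
  · rw [odd_deg_push_of_notMem huv hC.1 hG huG hvG, Nat.not_odd_iff_even]
    exact hC.2 G hG

/-- The facets of `C` that are mapped to `D`. -/
def lift (u v : V) (C D : Finset (Finset V)) : Finset (Finset V) :=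
  (cut u v C).filter fun F => merge u v F ∈ D

theorem mem_lift {u v : V} {C D : Finset (Finset V)} {F : Finset V} :
    F ∈ lift u v C D ↔ F ∈ C ∧ ¬ (u ∈ F ∧ v ∈ F) ∧ merge u v F ∈ D := by
  rw [lift, Finset.mem_filter, mem_cut, and_assoc]

/-- Fibres over members of `D` are lifted whole, so their parities are unchanged. -/
theorem push_lift {u v : V} {C D : Finset (Finset V)} (hD : D ⊆ push u v C) :
    push u v (lift u v C D) = D := by
  have hfib : ∀ b ∈ D, (cut u v (lift u v C D)).filter (fun F => merge u v F = b) =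
      (cut u v C).filter fun F => merge u v F = b := by
    intro b hb
    ext F
    simp only [Finset.mem_filter, mem_cut, mem_lift]
    constructor
    · rintro ⟨⟨⟨h1, h2, -⟩, -⟩, h3⟩
      exact ⟨⟨h1, h2⟩, h3⟩
    · rintro ⟨⟨h1, h2⟩, h3⟩
      exact ⟨⟨⟨h1, h2, h3 ▸ hb⟩, h2⟩, h3⟩
  ext b
  constructor
  · intro hb
    obtain ⟨F, hF, -, rfl⟩ := exists_of_mem_push hb
    exact (mem_lift.1 hF).2.2
  · intro hb
    rw [mem_push, hfib b hb, ← mem_push]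
    exact hD hb

end Chains

end Z2Rigidity

namespace Z2Rigidity

/-! ### Contraction step -/

section Contraction

variable {V : Type*}

theorem Rigid.congr {d : ℕ} {R : V → V → Prop} {B : Finset V} {p p' : V → Fin d → ℝ}
    (h : Rigid R B p) (hp : ∀ v ∈ B, p' v = p v) : Rigid R B p' := by
  intro q hq
  obtain ⟨A, c, hA, hAc⟩ := h q fun u hu v hv => by
    rw [← hp u hu, ← hp v hv]
    exact hq u hu v hv
  exact ⟨A, c, hA, fun v hv => by rw [hp v hv, hAc v hv]⟩

theorem Faithful.congr {d : ℕ} {B : Finset V} {p p' : V → Fin d → ℝ}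
    (h : Faithful B p) (hp : ∀ v ∈ B, p' v = p v) : Faithful B p' :=
  fun A c hA hz => h A c hA fun v hv => by rw [← hp v hv, hz v hv]

/-- Motions may be normalised to vanish on a rigid part. -/
theorem Rigid.of_pinned {d : ℕ} {R : V → V → Prop} {B K : Finset V} {p : V → Fin d → ℝ}
    (hK : Rigid R K p) (hKB : K ⊆ B)
    (h : ∀ q : V → Fin d → ℝ, (∀ u ∈ B, ∀ v ∈ B, R u v → (p u - p v) ⬝ᵥ (q u - q v) = 0) →
      (∀ v ∈ K, q v = 0) → ∀ v ∈ B, q v = 0) : Rigid R B p := by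
  intro q hq
  obtain ⟨A, c, hA, hAc⟩ := hK q fun u hu v hv => hq u (hKB hu) v (hKB hv)
  refine ⟨A, c, hA, fun v hv => ?_⟩
  have := h (fun v => q v - (A *ᵥ p v + c)) (fun u hu v hv huv => ?_)
    (fun v hv => by simp [hAc v hv]) v hv
  · exact sub_eq_zero.1 this
  · rw [sub_sub_sub_comm, dotProduct_sub, hq u hu v hv huv, trivial_isMotion hA, sub_zero]

variable [DecidableEq V]

/-- Adjacency in the graph of a chain. -/
def facetAdj (C : Finset (Finset V)) (u v : V) : Prop := ∃ F ∈ C, u ∈ F ∧ v ∈ F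

/-- The vertices of a chain. -/
def verts (C : Finset (Finset V)) : Finset V := C.biUnion id

theorem mem_verts {C : Finset (Finset V)} {v : V} : v ∈ verts C ↔ ∃ F ∈ C, v ∈ F := by
  simp [verts]

theorem subset_verts {C : Finset (Finset V)} {F : Finset V} (h : F ∈ C) : F ⊆ verts C :=
  Finset.subset_biUnion_of_mem id h

omit [DecidableEq V] in
theorem facetAdj_symm {C : Finset (Finset V)} {u v : V} (h : facetAdj C u v) : facetAdj C v u :=
  let ⟨F, hF, hu, hv⟩ := h
  ⟨F, hF, hv, hu⟩

theorem exists_facet_of_odd {C : Finset (Finset V)} {G : Finset V} (h : Odd (deg C G)) :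
    ∃ F ∈ C, G ⊆ F := by
  obtain ⟨F, hF⟩ := Finset.card_pos.1 h.pos
  exact ⟨F, Finset.mem_filter.1 hF⟩

/-- No facet contains a pair. -/
def NoPairs (X : Finset V) (σ : V → V) (C : Finset (Finset V)) : Prop :=
  ∀ F ∈ C, ∀ u ∈ F, u ∈ X → σ u ∉ F

/-- The properties of a configuration required of the vertices of `C`: rigidity. -/
def GenericallyRigid (t k : ℕ) (X : Finset V) (σ : V → V) (R : V → V → Prop) (B : Finset V) :
    Prop :=
  HoldsGenerically (symmetricSpace t (k + 1) X σ) fun p => Faithful B p ∧ Rigid R B p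

variable {X : Finset V} {σ : V → V}

omit [DecidableEq V] in
theorem fewPairs_of_noPair {K : Finset V} (h : ∀ u ∈ K, u ∈ X → σ u ∉ K) : FewPairs X σ K :=
  fun u hu _ _ huX _ hσ => absurd hσ (h u hu huX)

theorem fewPairs_insert_of_notMem (hσ : IsFreePairing X σ) {K : Finset V} {v : V} (hv : v ∉ X)
    (h : FewPairs X σ K) : FewPairs X σ (insert v K) := by
  have key : ∀ a ∈ insert v K, a ∈ X → a ∈ K := fun a ha haX =>
    (Finset.mem_insert.1 ha).resolve_left fun h => hv (h ▸ haX)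
  intro a ha b hb haX hbX hσa hσb
  exact h a (key a ha haX) b (key b hb hbX) haX hbX (key _ hσa (hσ.mapsTo a haX))
    (key _ hσb (hσ.mapsTo b hbX))

/-- The only possible pair is `{g, h}`. This is the case needed for the common neighbours in vertex
splitting, which come from facets through `g` and facets through `h`. -/
theorem fewPairs_insert_insert {H : Finset V} {g h : V}
    (hg : ∀ u ∈ insert g H, u ∈ X → σ u ∉ insert g H)
    (hh : ∀ u ∈ insert h H, u ∈ X → σ u ∉ insert h H) :
    FewPairs X σ (insert g (insert h H)) := by
  have key : ∀ a ∈ insert g (insert h H), a ∈ X → σ a ∈ insert g (insert h H) →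
      a = g ∧ σ a = h ∨ a = h ∧ σ a = g := by
    intro a ha haX hσa
    have h1 := hg a
    have h2 := hh a
    simp only [Finset.mem_insert] at *
    tauto
  intro a ha b hb haX hbX hσa hσb
  rcases key a ha haX hσa with h1 | h1 <;> rcases key b hb hbX hσb with h2 | h2
  · exact Or.inl (h2.1.trans h1.1.symm)
  · exact Or.inr (h2.1.trans h1.2.symm)
  · exact Or.inr (h2.1.trans h1.2.symm)
  · exact Or.inl (h2.1.trans h1.1.symm)

theorem holdsGenerically_forall_ai {t k : ℕ} (hσ : IsFreePairing X σ) (ht : t ≤ k)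
    (W : Finset V) : HoldsGenerically (symmetricSpace t (k + 1) X σ) fun p =>
      ∀ K ⊆ W, FewPairs X σ K → K.card ≤ k + 2 → AI p K := by
  classical
  have := HoldsGenerically.forall_finset (L := symmetricSpace t (k + 1) X σ)
    (W.powerset.filter fun K => FewPairs X σ K ∧ K.card ≤ k + 2) (P := fun K p => AI p K)
    fun K hK => by
      obtain ⟨-, h1, h2⟩ := Finset.mem_filter.1 hK
      exact h1.holdsGenerically_ai hσ (by omega) h2
  simpa only [Finset.mem_filter, Finset.mem_powerset, and_imp] using this

/-- The part of a circuit over a circuit of its contraction contains both ends of the contracted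
edge, with many common neighbours. -/
theorem exists_common_neighbours {k : ℕ} (hk : 2 ≤ k) {C D : Finset (Finset V)}
    (hC : Circuit k C) {u v : V} (huv : u ≠ v) {F₀ : Finset V} (hF₀ : F₀ ∈ C) (hu₀ : u ∈ F₀)
    (hv₀ : v ∈ F₀) (hD : Circuit k D) (hDC : D ⊆ push u v C) :
    ∃ (H : Finset V) (g h : V), g ∉ insert h H ∧ h ∉ H ∧ H.card + 2 = k ∧
      u ∉ insert g (insert h H) ∧ v ∉ insert g (insert h H) ∧
      (∃ F ∈ lift u v C D, insert u (insert g H) ⊆ F) ∧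
      (∃ F ∈ lift u v C D, insert v (insert g H) ⊆ F) ∧
      (∃ F ∈ lift u v C D, insert u (insert h H) ⊆ F) ∧
      (∃ F ∈ lift u v C D, insert v (insert h H) ⊆ F) := by
  set E := lift u v C D with hE
  have hEC : E ⊆ C := fun F hF => (mem_lift.1 hF).1
  have hEcard : ∀ F ∈ E, F.card = k + 1 := fun F hF => hC.1.1 F (hEC hF)
  have hpush : push u v E = D := push_lift hDC
  have hEuv : ∀ F ∈ E, ¬ (u ∈ F ∧ v ∈ F) := fun F hF => (mem_lift.1 hF).2.1
  have hne : E.Nonempty := by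
    obtain ⟨b, hb⟩ := hD.2.1
    rw [← hpush] at hb
    obtain ⟨F, hF, -⟩ := exists_of_mem_push hb
    exact ⟨F, hF⟩
  -- No facet in the lift contains both `u` and `v`, whereas `F₀` does; a cycle there would be a
  -- proper part of the circuit `C`.
  have hnot : ¬ Cyc k E := fun hcyc => by
    have hF₀E := hF₀
    rw [← hC.2.2 E hEC hne hcyc] at hF₀E
    exact hEuv F₀ hF₀E ⟨hu₀, hv₀⟩
  obtain ⟨G, hG, hodd⟩ : ∃ G : Finset V, G.card = k ∧ Odd (deg E G) := by
    by_contra hcon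
    push Not at hcon
    exact hnot ⟨hEcard, fun G hG => Nat.not_odd_iff_even.1 (hcon G hG)⟩
  -- The boundary of `E` cancels under contraction, so it is symmetric under exchange of `u` and
  -- `v`.
  have hiff : ∀ H : Finset V, u ∉ H → v ∉ H → H.card + 1 = k →
      (Odd (deg E (insert u H)) ↔ Odd (deg E (insert v H))) := by
    intro H hu hv hH
    have h1 := odd_deg_push_insert (C := E) hu hv
    rw [hpush] at h1
    have h2 : ¬ Odd (deg D (insert v H)) :=
      Nat.not_odd_iff_even.2 (hD.1.2 _ (by rw [Finset.card_insert_of_notMem hv, hH]))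
    rw [h1, Nat.not_odd_iff_even, Nat.even_add] at h2
    rw [← Nat.not_even_iff_odd, ← Nat.not_even_iff_odd, h2]
  have hGuv : ∀ G : Finset V, Odd (deg E G) → ¬ (u ∈ G ∧ v ∈ G) := fun G hG hG' => by
    obtain ⟨F, hF, hGF⟩ := exists_facet_of_odd hG
    exact hEuv F hF ⟨hGF hG'.1, hGF hG'.2⟩
  have hGor : u ∈ G ∨ v ∈ G := by
    by_contra hcon
    rw [not_or] at hcon
    have h1 := (odd_deg_push_of_notMem huv hEcard hG hcon.1 hcon.2).2 hodd
    rw [hpush] at h1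
    exact Nat.not_even_iff_odd.2 h1 (hD.1.2 G hG)
  obtain ⟨H, huH, hvH, hH, hoddH⟩ : ∃ H : Finset V, u ∉ H ∧ v ∉ H ∧ H.card + 1 = k ∧
      Odd (deg E (insert u H)) := by
    rcases hGor with huG | hvG
    · have hvG : v ∉ G := fun hv => hGuv G hodd ⟨huG, hv⟩
      exact ⟨G.erase u, Finset.notMem_erase u G, fun h => hvG (Finset.mem_of_mem_erase h),
        by rw [Finset.card_erase_add_one huG, hG], by rwa [Finset.insert_erase huG]⟩
    · have huG : u ∉ G := fun hu => hGuv G hodd ⟨hu, hvG⟩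
      have h1 : (G.erase v).card + 1 = k := by rw [Finset.card_erase_add_one hvG, hG]
      have h2 : u ∉ G.erase v := fun h => huG (Finset.mem_of_mem_erase h)
      refine ⟨G.erase v, h2, Finset.notMem_erase v G, h1, ?_⟩
      rwa [hiff _ h2 (Finset.notMem_erase v G) h1, Finset.insert_erase hvG]
  -- Here `k ≥ 2` is needed. A second boundary set through `u` and `H` without `h` supplies `g`; the
  -- common neighbours are then `g`, `h` and the other `k - 2` elements of `H`.
  obtain ⟨h, hh⟩ : H.Nonempty := Finset.card_pos.1 (by omega)
  have hH₀ : (H.erase h).card + 1 = H.card := Finset.card_erase_add_one hh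
  have huH₀ : u ∉ H.erase h := fun hu => huH (Finset.mem_of_mem_erase hu)
  have hvH₀ : v ∉ H.erase h := fun hu => hvH (Finset.mem_of_mem_erase hu)
  have hJ : (insert u (H.erase h)).card + 1 = k := by
    rw [Finset.card_insert_of_notMem huH₀]; omega
  obtain ⟨G', hG'card, hJG', hG'ne, hG'odd⟩ := exists_odd_deg_ne hEcard
    (G := insert u H) (J := insert u (H.erase h))
    (by rw [Finset.card_insert_of_notMem huH, hH])
    (Finset.insert_subset_insert u (Finset.erase_subset h H)) hJ hoddH
  obtain ⟨g, hgJ, hgG'⟩ : ∃ g, g ∉ insert u (H.erase h) ∧ insert g (insert u (H.erase h)) = G' := by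
    have hc : (G' \ insert u (H.erase h)).card = 1 := by
      rw [Finset.card_sdiff_of_subset hJG']; omega
    obtain ⟨g, hg⟩ := Finset.card_eq_one.1 hc
    have hg' : g ∈ G' \ insert u (H.erase h) := by rw [hg]; exact Finset.mem_singleton_self g
    refine ⟨g, (Finset.mem_sdiff.1 hg').2, ?_⟩
    rw [← Finset.sdiff_union_of_subset hJG', hg]
    rfl
  have hgu : g ≠ u := fun hg => hgJ (hg ▸ Finset.mem_insert_self _ _)
  have hgH₀ : g ∉ H.erase h := fun hg => hgJ (Finset.mem_insert_of_mem hg)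
  have hgv : g ≠ v := by
    rintro rfl
    refine hGuv G' hG'odd ⟨?_, ?_⟩ <;> rw [← hgG'] <;> simp
  have hgh : g ≠ h := by
    rintro rfl
    apply hG'ne
    rw [← hgG', Finset.insert_comm, Finset.insert_erase hh]
  rw [Finset.insert_comm] at hgG'
  have e1 : insert h (H.erase h) = H := Finset.insert_erase hh
  refine ⟨H.erase h, g, h, by simp [hgh, hgH₀], Finset.notMem_erase h H, by omega,
    ?_, ?_, exists_facet_of_odd (hgG' ▸ hG'odd), ?_, ?_, ?_⟩
  · rw [e1]; simp [hgu.symm, huH]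
  · rw [e1]; simp [hgv.symm, hvH]
  · refine exists_facet_of_odd ((hiff _ ?_ ?_ ?_).1 (hgG' ▸ hG'odd))
    · simp [hgu.symm, huH]
    · simp [hgv.symm, hvH]
    · rw [Finset.card_insert_of_notMem hgH₀]; omega
  · rw [e1]; exact exists_facet_of_odd hoddH
  · rw [e1]; exact exists_facet_of_odd ((hiff H huH hvH hH).1 hoddH)

theorem single_mem_symmetricSpace {t d : ℕ} (hσ : IsFreePairing X σ) {u : V} (hu : u ∉ X)
    (w : Fin d → ℝ) : (Pi.single u w : V → Fin d → ℝ) ∈ symmetricSpace t d X σ := by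
  intro x hx
  have h1 : x ≠ u := fun h => hu (h ▸ hx)
  have h2 : σ x ≠ u := fun h => hu (h ▸ hσ.mapsTo x hx)
  simp [h1, h2]

/-- Place `u` on top of `v` in a rigid realisation of `D` and split it off again. Both lie outside
`X`, so `u` moves without breaking the symmetry, and `F₀` supplies the edge `uv` even though it is
not in the lift. -/
theorem genericallyRigid_lift {t k : ℕ} (hσ : IsFreePairing X σ) (ht : t ≤ k) (hk : 2 ≤ k)
    {C D : Finset (Finset V)} (hC : Circuit k C) (hCX : NoPairs X σ C) {u v : V} (huv : u ≠ v)
    (hu : u ∉ X) (hv : v ∉ X) {F₀ : Finset V} (hF₀ : F₀ ∈ C) (hu₀ : u ∈ F₀)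
    (hv₀ : v ∈ F₀) (hD : Circuit k D) (hDC : D ⊆ push u v C)
    (ih : GenericallyRigid t k X σ (facetAdj D) (verts D)) :
    u ∈ verts (lift u v C D) ∧ v ∈ verts (lift u v C D) ∧
      GenericallyRigid t k X σ (facetAdj C) (verts (lift u v C D)) := by
  obtain ⟨H, g, h, hg, hh, hH, huZ, hvZ, ⟨Fug, hFug, hug⟩, ⟨Fvg, hFvg, hvg⟩, ⟨Fuh, hFuh, huh⟩,
    ⟨Fvh, hFvh, hvh⟩⟩ := exists_common_neighbours hk hC huv hF₀ hu₀ hv₀ hD hDC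
  have hEC : ∀ F ∈ lift u v C D, F ∈ C := fun F hF => (mem_lift.1 hF).1
  set B := verts (lift u v C D) with hB
  set Z := insert g (insert h H) with hZdef
  have huB : u ∈ B := mem_verts.2 ⟨_, hFug, hug (Finset.mem_insert_self _ _)⟩
  have hvB : v ∈ B := mem_verts.2 ⟨_, hFvg, hvg (Finset.mem_insert_self _ _)⟩
  have hmem : ∀ z ∈ Z, z ∈ insert g H ∨ z ∈ insert h H := by
    intro z hz
    simp only [hZdef, Finset.mem_insert] at hz ⊢
    tauto
  have hZB : Z ⊆ B := by
    intro z hz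
    rcases hmem z hz with hz | hz
    · exact mem_verts.2 ⟨_, hFug, hug (Finset.mem_insert_of_mem hz)⟩
    · exact mem_verts.2 ⟨_, hFuh, huh (Finset.mem_insert_of_mem hz)⟩
  have hZR : ∀ z ∈ Z, facetAdj C z u ∧ facetAdj C z v := by
    intro z hz
    rcases hmem z hz with hz | hz
    · exact ⟨⟨_, hEC _ hFug, hug (Finset.mem_insert_of_mem hz), hug (Finset.mem_insert_self _ _)⟩,
        ⟨_, hEC _ hFvg, hvg (Finset.mem_insert_of_mem hz), hvg (Finset.mem_insert_self _ _)⟩⟩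
    · exact ⟨⟨_, hEC _ hFuh, huh (Finset.mem_insert_of_mem hz), huh (Finset.mem_insert_self _ _)⟩,
        ⟨_, hEC _ hFvh, hvh (Finset.mem_insert_of_mem hz), hvh (Finset.mem_insert_self _ _)⟩⟩
  have hZcard : Z.card = k := by
    rw [hZdef, Finset.card_insert_of_notMem hg, Finset.card_insert_of_notMem hh]; omega
  have hfew : FewPairs X σ (insert v Z) := by
    refine fewPairs_insert_of_notMem hσ hv (fewPairs_insert_insert ?_ ?_)
    · intro a ha haX hσa
      exact hCX _ (hEC _ hFug) a (hug (Finset.mem_insert_of_mem ha)) haX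
        (hug (Finset.mem_insert_of_mem hσa))
    · intro a ha haX hσa
      exact hCX _ (hEC _ hFuh) a (huh (Finset.mem_insert_of_mem ha)) haX
        (huh (Finset.mem_insert_of_mem hσa))
  have hBD : B.erase u = verts D := by
    ext x
    rw [Finset.mem_erase, hB, mem_verts, mem_verts]
    constructor
    · rintro ⟨hxu, F, hF, hxF⟩
      obtain ⟨-, hFuv, hFD⟩ := mem_lift.1 hF
      refine ⟨_, hFD, ?_⟩
      by_cases hxv : x = v
      · subst hxv
        rw [merge_of_notMem fun h => hFuv ⟨h, hxF⟩]
        exact hxF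
      · exact (mem_merge_of_ne hxu hxv).2 hxF
    · rintro ⟨F, hF, hxF⟩
      obtain ⟨F', hF', hFuv, rfl⟩ := exists_of_mem_push (hDC hF)
      refine ⟨fun h => notMem_merge huv F' (h ▸ hxF), ?_⟩
      rcases exists_of_mem_merge hxF with h | ⟨rfl, -⟩
      · exact ⟨F', mem_lift.2 ⟨hF', hFuv, hF⟩, h⟩
      · exact mem_verts.1 hvB
  refine ⟨huB, hvB, lineOpen_rigid _ _, ?_⟩
  obtain ⟨p₀, hp₀, ⟨hf, hr⟩, hai⟩ := (ih.and (hfew.holdsGenerically_ai (t := t) (d := k + 1) hσ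
    (by omega) (by rw [Finset.card_insert_of_notMem hvZ]; omega))).2
  obtain ⟨p, hp, hpu, hagree⟩ := exists_modify hσ hp₀ u (p₀ v)
  have hagree' : ∀ y, y ≠ u → p y = p₀ y := fun y hy => hagree y hy fun h => absurd h hu
  obtain ⟨w, hw⟩ := Rigid.split (R := facetAdj C) (R' := facetAdj D) (Z := Z) huB hvB huv
    (by rw [hpu, hagree' v huv.symm]) hZB huZ hvZ (by rw [hZcard]) hZR
    (hai.congr fun y hy => hagree' y (by
      rintro rfl
      rcases Finset.mem_insert.1 hy with h | h
      · exact huv h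
      · exact huZ h))
    (by
      rw [hBD]
      exact hf.congr fun y hy => hagree' y fun h => Finset.notMem_erase u B (hBD ▸ h ▸ hy))
    (by
      rw [hBD]
      exact hr.congr fun y hy => hagree' y fun h => Finset.notMem_erase u B (hBD ▸ h ▸ hy))
    (by
      rintro x - y - ⟨F, hF, hxF, hyF⟩ hxy
      obtain ⟨F', hF', -, rfl⟩ := exists_of_mem_push (hDC hF)
      rcases exists_of_mem_merge hxF with h1 | ⟨h1, h1'⟩ <;>
        rcases exists_of_mem_merge hyF with h2 | ⟨h2, h2'⟩
      · exact Or.inl ⟨F', hF', h1, h2⟩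
      · exact Or.inr (Or.inr ⟨h2, F', hF', h1, h2'⟩)
      · exact Or.inr (Or.inl ⟨h1, F', hF', h1', h2⟩)
      · exact absurd (h1.trans h2.symm) hxy)
    ⟨F₀, hF₀, hu₀, hv₀⟩
  obtain ⟨s, hs⟩ := hw.infinite_compl.nonempty
  simp only [Set.mem_compl_iff, Set.mem_ofPred_eq, not_not] at hs
  exact ⟨_, Submodule.add_mem _ hp
    (Submodule.smul_mem _ s (single_mem_symmetricSpace hσ hu w)), hs⟩

/-- Pin a motion on `F₀`. The facets on which it vanishes are shown to form a cycle, which by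
minimality is all of `C`. The lifted circuits and the cancelling pairs are rigid bodies containing
`u` and `v`, so bodies sharing a suitable `k`-set share `d = k + 1` points. -/
theorem rigid_of_lifts {k : ℕ} (hσ : IsFreePairing X σ) (hk : 2 ≤ k)
    {C : Finset (Finset V)} (hC : Circuit k C) (hCX : NoPairs X σ C) {u v : V} (huv : u ≠ v)
    (hu : u ∉ X) (hv : v ∉ X) {F₀ : Finset V} (hF₀ : F₀ ∈ C) (hu₀ : u ∈ F₀)
    (hv₀ : v ∈ F₀) {p : V → Fin (k + 1) → ℝ}
    (hai : ∀ K ⊆ verts C, FewPairs X σ K → K.card ≤ k + 2 → AI p K)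
    (hlift : ∀ D ⊆ push u v C, Circuit k D → u ∈ verts (lift u v C D) ∧
      v ∈ verts (lift u v C D) ∧ Rigid (facetAdj C) (verts (lift u v C D)) p) :
    Rigid (facetAdj C) (verts C) p := by
  have hfewF : ∀ F ∈ C, FewPairs X σ F := fun F hF => fewPairs_of_noPair (hCX F hF)
  have haiF : ∀ F ∈ C, AI p F := fun F hF =>
    hai F (subset_verts hF) (hfewF F hF) (by rw [hC.1.1 F hF]; omega)
  have hfaith : ∀ K : Finset V, AI p K → K.card = k + 1 → Faithful K p := fun K hK hcard =>
    hK.faithful hcard (Finset.card_pos.1 (by omega)) subset_rfl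
  have hneF : ∀ F ∈ C, F.Nonempty := fun F hF => Finset.card_pos.1 (by rw [hC.1.1 F hF]; omega)
  have hclique : ∀ F ∈ C, Rigid (facetAdj C) F p := fun F hF =>
    (haiF F hF).rigid_clique (hC.1.1 F hF) (hneF F hF) fun a ha b hb _ => ⟨F, hF, ha, hb⟩
  have hvertslift : ∀ D, verts (lift u v C D) ⊆ verts C := fun D x hx => by
    obtain ⟨F, hF, hxF⟩ := mem_verts.1 hx
    exact mem_verts.2 ⟨F, (mem_lift.1 hF).1, hxF⟩
  -- The simplex on `u` and `H` is rigid, and `v` is joined to all its `k + 1` vertices: to `H` by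
  -- the second facet, to `u` by `F₀`.
  have hpair : ∀ H, u ∉ H → v ∉ H → insert u H ∈ C → insert v H ∈ C →
      Rigid (facetAdj C) (insert u H ∪ {v}) p := by
    intro H huH hvH huC hvC
    refine (hclique _ huC).attach fun x hx => ?_
    rw [Finset.mem_singleton.1 hx]
    have hvuH : v ∉ insert u H := by simp [huv.symm, hvH]
    refine ⟨insert u H, subset_rfl, hC.1.1 _ huC, hvuH, ?_, ?_⟩
    · intro z hz
      rcases Finset.mem_insert.1 hz with rfl | hz
      · exact ⟨F₀, hF₀, hu₀, hv₀⟩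
      · exact ⟨_, hvC, Finset.mem_insert_of_mem hz, Finset.mem_insert_self _ _⟩
    · refine hai _ ?_ (fewPairs_insert_of_notMem hσ hv (hfewF _ huC)) ?_
      · exact Finset.insert_subset (subset_verts hF₀ hv₀) (subset_verts huC)
      · rw [Finset.card_insert_of_notMem hvuH, hC.1.1 _ huC]
  have hbody : ∀ F ∈ C, ∃ B ⊆ verts C, F ⊆ B ∧ u ∈ B ∧ v ∈ B ∧ Rigid (facetAdj C) B p := by
    intro F hF
    by_cases hFuv : u ∈ F ∧ v ∈ F
    · exact ⟨F, subset_verts hF, subset_rfl, hFuv.1, hFuv.2, hclique F hF⟩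
    rcases mem_push_or huv hF hFuv with ⟨h1, -⟩ | ⟨-, H, huH, hvH, huC, hvC, hFH, -⟩
    · obtain ⟨D, hDC, hD, hFD⟩ := (hC.1.push huv).exists_circuit_mem h1
      obtain ⟨h2, h3, h4⟩ := hlift D hDC hD
      exact ⟨_, hvertslift D, subset_verts (mem_lift.2 ⟨hF, hFuv, hFD⟩), h2, h3, h4⟩
    · refine ⟨_, ?_, ?_, ?_, ?_, hpair H huH hvH huC hvC⟩
      · exact Finset.union_subset (subset_verts huC)
          (Finset.singleton_subset_iff.2 (subset_verts hF₀ hv₀))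
      · rcases hFH with rfl | rfl
        · exact Finset.subset_union_left
        · intro x hx
          simp only [Finset.mem_insert, Finset.mem_union, Finset.mem_singleton] at hx ⊢
          tauto
      · simp
      · simp
  refine (hclique F₀ hF₀).of_pinned (subset_verts hF₀) fun q hq hq₀ => ?_
  have hq' : ∀ B ⊆ verts C, ∀ a ∈ B, ∀ b ∈ B, facetAdj C a b →
      (p a - p b) ⬝ᵥ (q a - q b) = 0 := fun B hB a ha b hb => hq a (hB ha) b (hB hb)
  have hvan : ∀ B ⊆ verts C, Rigid (facetAdj C) B p → ∀ F ∈ C, F ⊆ B → (∀ x ∈ F, q x = 0) →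
      ∀ x ∈ B, q x = 0 := fun B hB hr F hF hFB h0 =>
    hr.eq_zero (hq' B hB) (hfaith F (haiF F hF) (hC.1.1 F hF)) hFB h0
  let Z : Finset (Finset V) := C.filter fun F => ∀ x ∈ F, q x = 0
  have hZC : Z ⊆ C := Finset.filter_subset _ _
  have hcl : ∀ H, u ∉ H → v ∉ H → insert u H ∈ C → insert v H ∈ C →
      (insert u H ∈ Z ↔ insert v H ∈ Z) := by
    intro H huH hvH huC hvC
    have hB : insert u H ∪ {v} ⊆ verts C := Finset.union_subset (subset_verts huC)
      (Finset.singleton_subset_iff.2 (subset_verts hF₀ hv₀))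
    have hsub : insert v H ⊆ insert u H ∪ {v} := by
      intro x hx
      simp only [Finset.mem_insert, Finset.mem_union, Finset.mem_singleton] at hx ⊢
      tauto
    have hr := hpair H huH hvH huC hvC
    constructor
    · intro h
      refine Finset.mem_filter.2 ⟨hvC, fun x hx => ?_⟩
      exact hvan _ hB hr _ huC Finset.subset_union_left (Finset.mem_filter.1 h).2 x (hsub hx)
    · intro h
      refine Finset.mem_filter.2 ⟨huC, fun x hx => ?_⟩
      exact hvan _ hB hr _ hvC hsub (Finset.mem_filter.1 h).2 x (Finset.mem_union_left _ hx)
  -- If one facet over a circuit `D` is pinned, the rigid lift of `D` is pinned entirely; thus no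
  -- circuit of the contraction crosses `push u v Z`.
  have hpushZ : Cyc k (push u v Z) := by
    refine (hC.1.push huv).of_circuits (push_subset_push huv hZC hcl) fun D hDC hD => ?_
    by_cases hdisj : Disjoint D (push u v Z)
    · exact Or.inr hdisj
    left
    obtain ⟨b, hbD, hbZ⟩ := Finset.not_disjoint_iff.1 hdisj
    obtain ⟨F, hF, hFuv, rfl⟩ := exists_of_mem_push hbZ
    obtain ⟨-, -, hr⟩ := hlift D hDC hD
    have h0 := hvan _ (hvertslift D) hr F (hZC hF)
      (subset_verts (mem_lift.2 ⟨hZC hF, hFuv, hbD⟩)) (Finset.mem_filter.1 hF).2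
    intro b' hb'
    obtain ⟨F', hF', hF'uv, rfl⟩ := exists_of_mem_push (hDC hb')
    refine merge_mem_push_of_subset huv hZC (Finset.mem_filter.2 ⟨hF', fun x hx => ?_⟩) hF'uv
      (hDC hb')
    exact h0 x (subset_verts (mem_lift.2 ⟨hF', hF'uv, hb'⟩) hx)
  -- Odd degree in `Z` means that `G` lies in a pinned facet and in an unpinned one. Their bodies
  -- share `G` together with the missing one of `u` and `v`, which is enough to pin the second body
  -- as well.
  have hone : ∀ G : Finset V, G.card = k → (u ∈ G ∨ v ∈ G) → ¬ (u ∈ G ∧ v ∈ G) →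
      Even (deg Z G) := by
    intro G hG hor hnand
    by_contra hodd
    rw [Nat.not_even_iff_odd] at hodd
    obtain ⟨F₁, hF₁, hGF₁⟩ := exists_facet_of_odd hodd
    obtain ⟨F₂, hF₂, hGF₂⟩ : ∃ F ∈ C \ Z, G ⊆ F := by
      refine exists_facet_of_odd ?_
      have h1 := hC.1.2 G hG
      rw [← deg_sdiff hZC] at h1
      rw [← Nat.not_even_iff_odd, Nat.even_add.1 h1, Nat.not_even_iff_odd]
      exact hodd
    obtain ⟨hF₂C, hF₂Z⟩ := Finset.mem_sdiff.1 hF₂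
    obtain ⟨B₁, hB₁, hFB₁, huB₁, hvB₁, hr₁⟩ := hbody F₁ (hZC hF₁)
    obtain ⟨B₂, hB₂, hFB₂, huB₂, hvB₂, hr₂⟩ := hbody F₂ hF₂C
    have h0 := hvan B₁ hB₁ hr₁ F₁ (hZC hF₁) hFB₁ (Finset.mem_filter.1 hF₁).2
    obtain ⟨K, hK, hGK, hKsub, hKfew⟩ : ∃ K : Finset V, K.card = k + 1 ∧ G ⊆ K ∧
        (∀ x ∈ K, x = u ∨ x = v ∨ x ∈ G) ∧ FewPairs X σ K := by
      have hfewG : FewPairs X σ G := fewPairs_of_noPair fun a ha haX hσa =>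
        hCX F₂ hF₂C a (hGF₂ ha) haX (hGF₂ hσa)
      by_cases huG : u ∈ G
      · refine ⟨insert v G, ?_, Finset.subset_insert _ _, fun x hx => ?_,
          fewPairs_insert_of_notMem hσ hv hfewG⟩
        · rw [Finset.card_insert_of_notMem fun h => hnand ⟨huG, h⟩, hG]
        · exact (Finset.mem_insert.1 hx).elim (fun h => Or.inr (Or.inl h))
            fun h => Or.inr (Or.inr h)
      · refine ⟨insert u G, ?_, Finset.subset_insert _ _, fun x hx => ?_,
          fewPairs_insert_of_notMem hσ hu hfewG⟩
        · rw [Finset.card_insert_of_notMem huG, hG]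
        · exact (Finset.mem_insert.1 hx).elim Or.inl fun h => Or.inr (Or.inr h)
    have hKB₁ : K ⊆ B₁ := fun x hx => by
      rcases hKsub x hx with rfl | rfl | h
      · exact huB₁
      · exact hvB₁
      · exact hFB₁ (hGF₁ h)
    have hKB₂ : K ⊆ B₂ := fun x hx => by
      rcases hKsub x hx with rfl | rfl | h
      · exact huB₂
      · exact hvB₂
      · exact hFB₂ (hGF₂ h)
    have hKai : AI p K := hai K (hKB₁.trans hB₁) hKfew (by omega)
    have h2 := hr₂.eq_zero (hq' B₂ hB₂) (hfaith K hKai hK) hKB₂ fun x hx => h0 x (hKB₁ hx)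
    exact hF₂Z (Finset.mem_filter.2 ⟨hF₂C, fun x hx => h2 x (hFB₂ hx)⟩)
  have hZcard : ∀ F ∈ Z, F.card = k + 1 := fun F hF => hC.1.1 F (hZC hF)
  have hZ : Cyc k Z := by
    refine ⟨hZcard, fun G hG => ?_⟩
    by_cases huG : u ∈ G <;> by_cases hvG : v ∈ G
    · by_contra hodd
      rw [Nat.not_even_iff_odd] at hodd
      -- The boundary of `Z` contains another `k`-set through `G` without `v`; it contains `u` but
      -- not `v`, the case already excluded.
      obtain ⟨G', hG', hJG', hne, hodd'⟩ := exists_odd_deg_ne hZcard hG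
        (Finset.erase_subset v G) (by rw [Finset.card_erase_add_one hvG, hG]) hodd
      have huG' : u ∈ G' := hJG' (Finset.mem_erase.2 ⟨huv, huG⟩)
      have hvG' : v ∉ G' := by
        intro hvG'
        refine hne (Finset.eq_of_subset_of_card_le (fun x hx => ?_) (by rw [hG, hG'])).symm
        by_cases hxv : x = v
        · rwa [hxv]
        · exact hJG' (Finset.mem_erase.2 ⟨hxv, hx⟩)
      exact Nat.not_even_iff_odd.2 hodd' (hone G' hG' (Or.inl huG') fun h => hvG' h.2)
    · exact hone G hG (Or.inl huG) fun h => hvG h.2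
    · exact hone G hG (Or.inr hvG) fun h => huG h.1
    · rw [← Nat.not_odd_iff_even, ← odd_deg_push_of_notMem huv hZcard hG huG hvG,
        Nat.not_odd_iff_even]
      exact hpushZ.2 G hG
  have hZeq : Z = C := hC.2.2 Z hZC ⟨F₀, Finset.mem_filter.2 ⟨hF₀, hq₀⟩⟩ hZ
  intro x hx
  obtain ⟨F, hF, hxF⟩ := mem_verts.1 hx
  rw [← hZeq] at hF
  exact (Finset.mem_filter.1 hF).2 x hxF

end Contraction

end Z2Rigidity

namespace Z2Rigidity

/-! ### Circuits with symmetrically placed vertices -/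

section Circuits

variable {V : Type*} [DecidableEq V] {X : Finset V} {σ : V → V} {k : ℕ}
  {C : Finset (Finset V)}

theorem Cyc.exists_ne (hC : Cyc k C) {F G : Finset V} (hF : F ∈ C) (hG : G.card = k)
    (hGF : G ⊆ F) : ∃ F' ∈ C, F' ≠ F ∧ ∃ x, x ∉ G ∧ F' = insert x G := by
  have hmem : F ∈ C.filter fun F => G ⊆ F := Finset.mem_filter.2 ⟨hF, hGF⟩
  have hlt : 1 < (C.filter fun F => G ⊆ F).card := by
    have h1 := Finset.card_pos.2 ⟨F, hmem⟩
    obtain ⟨m, hm⟩ := hC.2 G hG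
    rw [deg] at hm
    omega
  obtain ⟨F', hF', hne⟩ := Finset.exists_mem_ne hlt F
  obtain ⟨hF'C, hGF'⟩ := Finset.mem_filter.1 hF'
  refine ⟨F', hF'C, hne, ?_⟩
  have hc : (F' \ G).card = 1 := by
    rw [Finset.card_sdiff_of_subset hGF', hC.1 F' hF'C]; omega
  obtain ⟨x, hx⟩ := Finset.card_eq_one.1 hc
  have hx' : x ∈ F' \ G := by rw [hx]; exact Finset.mem_singleton_self x
  refine ⟨x, (Finset.mem_sdiff.1 hx').2, ?_⟩
  rw [← Finset.sdiff_union_of_subset hGF', hx]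
  rfl

omit [DecidableEq V] in
theorem fewPairs_of_forall (hσ : IsFreePairing X σ) {K : Finset V} {x : V} (hx : x ∈ X)
    (h : ∀ a ∈ K, a ∈ X → σ a ∈ K → a = x ∨ a = σ x) : FewPairs X σ K := by
  intro a ha b hb haX hbX hσa hσb
  rcases h a ha haX hσa with rfl | rfl
  · exact h b hb hbX hσb
  · rcases h b hb hbX hσb with rfl | rfl
    · exact Or.inr (hσ.involutive b hx).symm
    · exact Or.inl rfl

/-- If every facet has at most one vertex outside `X`, then `C` is a suspended cross-polytope. -/
theorem facet_structure (hσ : IsFreePairing X σ) (hC : Cyc k C) (hCX : NoPairs X σ C)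
    (hX : X.card ≤ 2 * k) (hY : ∀ F ∈ C, ∀ a ∈ F, ∀ b ∈ F, a ∉ X → b ∉ X → a = b)
    {F : Finset V} (hF : F ∈ C) :
    ∃ y τ, y ∉ X ∧ τ ⊆ X ∧ F = insert y τ ∧ τ.card = k ∧ ∀ x ∈ X, x ∉ τ → σ x ∈ τ := by
  let τ := F.filter (· ∈ X)
  let υ := F.filter (· ∉ X)
  have hτX : τ ⊆ X := fun x hx => (Finset.mem_filter.1 hx).2
  have hτF : τ ⊆ F := Finset.filter_subset _ _
  have hsum : τ.card + υ.card = k + 1 := by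
    rw [Finset.card_filter_add_card_filter_not, hC.1 F hF]
  have hυ : υ.card ≤ 1 := Finset.card_le_one.2 fun a ha b hb =>
    hY F hF a (Finset.mem_filter.1 ha).1 b (Finset.mem_filter.1 hb).1
      (Finset.mem_filter.1 ha).2 (Finset.mem_filter.1 hb).2
  have hinj : Set.InjOn σ τ := fun a ha b hb hab => by
    rw [← hσ.involutive a (hτX ha), hab, hσ.involutive b (hτX hb)]
  have hdisj : Disjoint τ (τ.image σ) := by
    rw [Finset.disjoint_right]
    intro x hx
    obtain ⟨z, hz, rfl⟩ := Finset.mem_image.1 hx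
    exact fun h => hCX F hF z (hτF hz) (hτX hz) (hτF h)
  -- `τ` and its image are disjoint in `X`, so `2|τ| ≤ 2k`, while at least `k` vertices of `F` lie
  -- in `X`; equality holds throughout.
  have hsub : τ ∪ τ.image σ ⊆ X := Finset.union_subset hτX fun x hx => by
    obtain ⟨z, hz, rfl⟩ := Finset.mem_image.1 hx
    exact hσ.mapsTo z (hτX hz)
  have hcard : (τ ∪ τ.image σ).card = 2 * τ.card := by
    rw [Finset.card_union_of_disjoint hdisj, Finset.card_image_of_injOn hinj]
    ring
  have hle := Finset.card_le_card hsub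
  have hτk : τ.card = k := by omega
  have hXeq : τ ∪ τ.image σ = X := Finset.eq_of_subset_of_card_le hsub (by omega)
  obtain ⟨y, hy⟩ := Finset.card_eq_one.1 (show υ.card = 1 by omega)
  have hyυ : y ∈ υ := by rw [hy]; exact Finset.mem_singleton_self y
  refine ⟨y, τ, (Finset.mem_filter.1 hyυ).2, hτX, ?_, hτk, fun x hx hxτ => ?_⟩
  · have : υ ∪ τ = F := by
      rw [Finset.union_comm]; exact Finset.filter_union_filter_not_eq _ _
    rw [← this, hy]
    rfl
  · rw [← hXeq, Finset.mem_union, or_iff_right hxτ] at hx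
    obtain ⟨z, hz, rfl⟩ := Finset.mem_image.1 hx
    rwa [hσ.involutive z (hτX hz)]

/-- Replace `σ x` by `x`: a second facet through `F` without `σ x` cannot gain a vertex outside `X`,
and any vertex of `X` other than `x` would complete a pair. -/
theorem exists_flip (hσ : IsFreePairing X σ) (hC : Cyc k C) (hCX : NoPairs X σ C)
    (hX : X.card ≤ 2 * k) (hY : ∀ F ∈ C, ∀ a ∈ F, ∀ b ∈ F, a ∉ X → b ∉ X → a = b)
    {F : Finset V} (hF : F ∈ C) {x : V} (hx : x ∈ X) :
    ∃ F' ∈ C, x ∈ F' ∧ ∀ z ∈ F, z ≠ σ x → z ∈ F' := by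
  by_cases hxF : x ∈ F
  · exact ⟨F, hF, hxF, fun z hz _ => hz⟩
  obtain ⟨y, τ, hy, hτX, rfl, hτ, hσx⟩ := facet_structure hσ hC hCX hX hY hF
  have hxτ : x ∉ τ := fun h => hxF (Finset.mem_insert_of_mem h)
  have hσxF : σ x ∈ insert y τ := Finset.mem_insert_of_mem (hσx x hx hxτ)
  obtain ⟨F', hF', hne, x', hx', rfl⟩ := hC.exists_ne hF
    (G := (insert y τ).erase (σ x)) (by
      rw [Finset.card_erase_of_mem hσxF, hC.1 _ hF]; omega) (Finset.erase_subset _ _)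
  have hyσ : y ≠ σ x := fun h => hy (h ▸ hσ.mapsTo x hx)
  have hyG : y ∈ (insert y τ).erase (σ x) := Finset.mem_erase.2 ⟨hyσ, Finset.mem_insert_self _ _⟩
  have hx'X : x' ∈ X := by
    by_contra hx'X
    have := hY _ hF' x' (Finset.mem_insert_self _ _) y (Finset.mem_insert_of_mem hyG) hx'X hy
    exact hx' (this ▸ hyG)
  have hx'σ : x' ≠ σ x := by
    rintro rfl
    exact hne (Finset.insert_erase hσxF)
  have hx'τ : x' ∉ τ := fun h =>
    hx' (Finset.mem_erase.2 ⟨hx'σ, Finset.mem_insert_of_mem h⟩)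
  have h1 : σ x' ∈ τ := hσx x' hx'X hx'τ
  have h2 : σ x' = σ x := by
    by_contra h
    exact hCX _ hF' x' (Finset.mem_insert_self _ _) hx'X (Finset.mem_insert_of_mem
      (Finset.mem_erase.2 ⟨h, Finset.mem_insert_of_mem h1⟩))
  have h3 : x' = x := by rw [← hσ.involutive x' hx'X, h2, hσ.involutive x hx]
  subst h3
  exact ⟨_, hF', Finset.mem_insert_self _ _, fun z hz hzσ =>
    Finset.mem_insert_of_mem (Finset.mem_erase.2 ⟨hzσ, hz⟩)⟩

/-- All vertices of `X` are adjacent except partners, and every vertex outside `X` is an apex joined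
to all of `X`. Contracting an apex `y₁` to `x₁ ∈ X` adds the edge from `x₁` to `σ x₁`; the
contracted graph is built by attaching vertices, then `y₁` is split off and the remaining apexes are
attached. -/
theorem genericallyRigid_crosspolytope {t : ℕ} (hσ : IsFreePairing X σ) (ht : t ≤ k)
    (hk : 2 ≤ k) (hC : Circuit k C) (hCX : NoPairs X σ C) (hX : X.card ≤ 2 * k)
    (hY : ∀ F ∈ C, ∀ a ∈ F, ∀ b ∈ F, a ∉ X → b ∉ X → a = b) :
    GenericallyRigid t k X σ (facetAdj C) (verts C) := by
  have hflip := fun {F : Finset V} (hF : F ∈ C) {x : V} (hx : x ∈ X) =>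
    exists_flip hσ hC.1 hCX hX hY hF hx
  have hadjY : ∀ y ∈ verts C, y ∉ X → ∀ x ∈ X, facetAdj C x y := by
    intro y hy hyX x hx
    obtain ⟨F, hF, hyF⟩ := mem_verts.1 hy
    obtain ⟨F', hF', hxF', h⟩ := hflip hF hx
    exact ⟨F', hF', hxF', h y hyF fun h => hyX (h ▸ hσ.mapsTo x hx)⟩
  obtain ⟨F₀, hF₀⟩ := hC.2.1
  have hadjX : ∀ x ∈ X, ∀ x' ∈ X, x ≠ σ x' → facetAdj C x x' := by
    intro x hx x' hx' hne
    obtain ⟨F₁, hF₁, hxF₁, -⟩ := hflip hF₀ hx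
    obtain ⟨F₂, hF₂, hxF₂, h⟩ := hflip hF₁ hx'
    exact ⟨F₂, hF₂, h x hxF₁ hne, hxF₂⟩
  have hXC : X ⊆ verts C := fun x hx => by
    obtain ⟨F, hF, hxF, -⟩ := hflip hF₀ hx
    exact mem_verts.2 ⟨F, hF, hxF⟩
  have hσinj : ∀ a ∈ X, ∀ b ∈ X, σ a = σ b → a = b := fun a ha b hb hab => by
    rw [← hσ.involutive a ha, hab, hσ.involutive b hb]
  obtain ⟨y₁, τ, hy₁, hτX, rfl, hτ, hτσ⟩ := facet_structure hσ hC.1 hCX hX hY hF₀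
  have hnp : ∀ a ∈ τ, σ a ∉ τ := fun a ha h =>
    hCX _ hF₀ a (Finset.mem_insert_of_mem ha) (hτX ha) (Finset.mem_insert_of_mem h)
  have hy₁τ : y₁ ∉ τ := fun h => hy₁ (hτX h)
  obtain ⟨F₁, hF₁, hne, y₂, hy₂τ, rfl⟩ := hC.1.exists_ne hF₀ hτ (Finset.subset_insert _ _)
  have hyne : y₁ ≠ y₂ := by
    rintro rfl
    exact hne rfl
  have hy₂ : y₂ ∉ X := by
    intro hy₂X
    exact hCX _ hF₁ y₂ (Finset.mem_insert_self _ _) hy₂X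
      (Finset.mem_insert_of_mem (hτσ y₂ hy₂X hy₂τ))
  have hy₁C : y₁ ∈ verts C := mem_verts.2 ⟨_, hF₀, Finset.mem_insert_self _ _⟩
  have hy₂C : y₂ ∈ verts C := mem_verts.2 ⟨_, hF₁, Finset.mem_insert_self _ _⟩
  -- `x₁` is the vertex to be split. The pair of a different `x₀`, available as `k ≥ 2`, completes
  -- the `k` common neighbours of `y₁` and `x₁`.
  obtain ⟨x₁, hx₁, x₀, hx₀, hx₁₀⟩ := Finset.one_lt_card.1 (show 1 < τ.card by omega)
  have hx₁X := hτX hx₁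
  have hx₀X := hτX hx₀
  set R' : V → V → Prop := fun a b => facetAdj C a b ∨ a = x₁ ∧ b = σ x₁ ∨ a = σ x₁ ∧ b = x₁
    with hR'
  have hXsplit : ∀ x ∈ X, x ∈ τ ∨ ∃ z ∈ τ, x = σ z := fun x hx => by
    by_cases hxτ : x ∈ τ
    · exact Or.inl hxτ
    · exact Or.inr ⟨σ x, hτσ x hx hxτ, (hσ.involutive x hx).symm⟩
  have hσx₁τ : σ x₁ ∉ τ := hnp x₁ hx₁
  have hσx₀τ : σ x₀ ∉ τ := hnp x₀ hx₀
  have hσx₁X := hσ.mapsTo x₁ hx₁X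
  have hσx₀X := hσ.mapsTo x₀ hx₀X
  have hy₂σx₁ : y₂ ≠ σ x₁ := fun h => hy₂ (h ▸ hσx₁X)
  have hK₁σ : σ x₁ ∉ insert y₂ τ := by simp [hy₂σx₁.symm, hσx₁τ]
  -- The contracted graph is rigid in general position.
  have hbase : ∀ p : V → Fin (k + 1) → ℝ,
      (∀ K ⊆ insert y₂ X, FewPairs X σ K → K.card ≤ k + 2 → AI p K) →
      Rigid R' (insert y₂ X) p := by
    intro p hai
    have hK₁ : Rigid R' (insert y₂ τ) p := by
      refine (hai _ (Finset.insert_subset_insert _ hτX)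
        (fewPairs_of_noPair (hCX _ hF₁)) (by rw [hC.1.1 _ hF₁]; omega)).rigid_clique
        (hC.1.1 _ hF₁) ⟨y₂, Finset.mem_insert_self _ _⟩ fun a ha b hb _ => ?_
      exact Or.inl ⟨_, hF₁, ha, hb⟩
    have hK₂ : Rigid R' (insert y₂ τ ∪ {σ x₁}) p := by
      refine hK₁.attach fun x hx => ?_
      rw [Finset.mem_singleton.1 hx]
      refine ⟨_, subset_rfl, hC.1.1 _ hF₁, hK₁σ, ?_, ?_⟩
      · intro z hz
        rcases Finset.mem_insert.1 hz with rfl | hz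
        · exact Or.inl (facetAdj_symm (hadjY _ hy₂C hy₂ _ hσx₁X))
        · by_cases hzx : z = x₁
          · exact Or.inr (Or.inl ⟨hzx, rfl⟩)
          · exact Or.inl (hadjX z (hτX hz) _ hσx₁X (by rwa [hσ.involutive x₁ hx₁X]))
      · refine hai _ ?_ (fewPairs_of_forall hσ hx₁X ?_) ?_
        · exact Finset.insert_subset (Finset.mem_insert_of_mem hσx₁X)
            (Finset.insert_subset_insert _ hτX)
        · intro a ha haX hσa
          rcases Finset.mem_insert.1 ha with rfl | ha
          · exact Or.inr rfl
          rcases Finset.mem_insert.1 hσa with h | h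
          · exact Or.inl (hσinj _ haX _ hx₁X h)
          · exact absurd h (hCX _ hF₁ a ha haX)
        · rw [Finset.card_insert_of_notMem hK₁σ, hC.1.1 _ hF₁]
    -- Each further `σ z` is joined to everything in the previous body but `z`, which leaves `k + 1`
    -- neighbours, with `x₁` and `σ x₁` as their only possible pair.
    have hK₃ : Rigid R' (insert y₂ τ ∪ {σ x₁} ∪ (τ.erase x₁).image σ) p := by
      refine hK₂.attach fun x hx => ?_
      obtain ⟨z, hz, rfl⟩ := Finset.mem_image.1 hx
      obtain ⟨hzx₁, hzτ⟩ := Finset.mem_erase.1 hz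
      have hzX := hτX hzτ
      have hσzX := hσ.mapsTo z hzX
      have hzF : z ∈ insert y₂ τ ∪ {σ x₁} :=
        Finset.mem_union_left _ (Finset.mem_insert_of_mem hzτ)
      have hcard : ((insert y₂ τ ∪ {σ x₁}).erase z).card = k + 1 := by
        rw [Finset.card_erase_of_mem hzF, Finset.card_union_of_disjoint (by simpa using hK₁σ),
          hC.1.1 _ hF₁, Finset.card_singleton]
        omega
      have hxK : σ z ∉ (insert y₂ τ ∪ {σ x₁}).erase z := by
        simp only [Finset.mem_erase, Finset.mem_union, Finset.mem_insert, Finset.mem_singleton,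
          not_and, not_or]
        exact fun _ => ⟨⟨fun h => hy₂ (h ▸ hσzX), hnp z hzτ⟩,
          fun h => hzx₁ (hσinj _ hzX _ hx₁X h)⟩
      refine ⟨_, Finset.erase_subset z _, hcard, hxK, ?_, ?_⟩
      · intro w hw
        obtain ⟨hwz, hw⟩ := Finset.mem_erase.1 hw
        left
        rcases Finset.mem_union.1 hw with hw | hw
        · rcases Finset.mem_insert.1 hw with rfl | hw
          · exact facetAdj_symm (hadjY _ hy₂C hy₂ _ hσzX)
          · exact hadjX w (hτX hw) _ hσzX (by rwa [hσ.involutive z hzX])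
        · rw [Finset.mem_singleton.1 hw]
          refine hadjX _ hσx₁X _ hσzX ?_
          rw [hσ.involutive z hzX]
          exact fun h => hσx₁τ (h ▸ hzτ)
      · refine hai _ ?_ (fewPairs_of_forall hσ hx₁X ?_) ?_
        · refine Finset.insert_subset (Finset.mem_insert_of_mem hσzX)
            ((Finset.erase_subset z _).trans (Finset.union_subset
              (Finset.insert_subset_insert _ hτX) ?_))
          exact Finset.singleton_subset_iff.2 (Finset.mem_insert_of_mem hσx₁X)
        · have hcases : ∀ a ∈ insert (σ z) ((insert y₂ τ ∪ {σ x₁}).erase z), a ∈ X →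
              a = σ z ∨ (a ≠ z ∧ (a ∈ τ ∨ a = σ x₁)) := by
            intro a ha haX
            simp only [Finset.mem_erase, Finset.mem_union, Finset.mem_insert,
              Finset.mem_singleton] at ha
            rcases ha with h | ⟨h1, (h2 | h2) | h2⟩
            · exact Or.inl h
            · exact absurd (h2 ▸ haX) hy₂
            · exact Or.inr ⟨h1, Or.inl h2⟩
            · exact Or.inr ⟨h1, Or.inr h2⟩
          intro a ha haX hσa
          rcases hcases a ha haX with rfl | ⟨haz, haτ | rfl⟩
          · rw [hσ.involutive z hzX] at hσa
            rcases hcases z hσa hzX with h | ⟨h, -⟩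
            · exact absurd h.symm (hσ.free z hzX)
            · exact absurd rfl h
          · rcases hcases _ hσa (hσ.mapsTo a haX) with h | ⟨-, h | h⟩
            · exact absurd (hσinj _ haX _ hzX h) haz
            · exact absurd h (hnp a haτ)
            · exact Or.inl (hσinj _ haX _ hx₁X h)
          · exact Or.inr rfl
        · rw [Finset.card_insert_of_notMem hxK, hcard]
    convert hK₃ using 1
    ext x
    simp only [Finset.mem_union, Finset.mem_insert, Finset.mem_singleton, Finset.mem_image,
      Finset.mem_erase]
    constructor
    · rintro (rfl | hx)
      · simp
      · rcases hXsplit x hx with h | ⟨z, hz, rfl⟩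
        · simp [h]
        · by_cases hzx : z = x₁
          · simp [hzx]
          · exact Or.inr ⟨z, ⟨hzx, hz⟩, rfl⟩
    · rintro (((rfl | h) | rfl) | ⟨z, ⟨-, hz⟩, rfl⟩)
      · exact Or.inl rfl
      · exact Or.inr (hτX h)
      · exact Or.inr hσx₁X
      · exact Or.inr (hσ.mapsTo z (hτX hz))
  have hfewτ : FewPairs X σ (insert (σ x₀) τ) := by
    refine fewPairs_of_forall hσ hx₀X fun a ha haX hσa => ?_
    rcases Finset.mem_insert.1 ha with rfl | ha
    · exact Or.inr rfl
    rcases Finset.mem_insert.1 hσa with h | h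
    · exact Or.inl (hσinj _ haX _ hx₀X h)
    · exact absurd h (hnp a ha)
  have hcardτ : (insert (σ x₀) τ).card = k + 1 := by
    rw [Finset.card_insert_of_notMem hσx₀τ, hτ]
  have hsubτ : insert (σ x₀) τ ⊆ X := Finset.insert_subset hσx₀X hτX
  -- Splitting off the second apex.
  have htwo : GenericallyRigid t k X σ (facetAdj C) (insert y₁ (insert y₂ X)) := by
    refine ⟨lineOpen_rigid _ _, ?_⟩
    obtain ⟨p₀, hp₀, hai₀⟩ := (holdsGenerically_forall_ai (k := k) hσ ht (insert y₂ X)).2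
    obtain ⟨p, hp, hpu, hagree⟩ := exists_modify hσ hp₀ y₁ (p₀ x₁)
    have hy₁B : y₁ ∉ insert y₂ X := by simp [hyne, hy₁]
    have hagree' : ∀ y ∈ insert y₂ X, p y = p₀ y := fun y hy =>
      hagree y (fun h => hy₁B (h ▸ hy)) fun h => absurd h hy₁
    have hai : ∀ K ⊆ insert y₂ X, FewPairs X σ K → K.card ≤ k + 2 → AI p K :=
      fun K hK h1 h2 => (hai₀ K hK h1 h2).congr fun y hy => hagree' y (hK hy)
    have hσx₀τ' : σ x₀ ∉ τ.erase x₁ := fun h => hσx₀τ (Finset.mem_of_mem_erase h)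
    have hσx₀x₁ : σ x₀ ≠ x₁ := fun h => hσx₀τ (h ▸ hx₁)
    have hZX : insert (σ x₀) (τ.erase x₁) ⊆ X :=
      Finset.insert_subset hσx₀X ((Finset.erase_subset _ _).trans hτX)
    have herase : (insert y₁ (insert y₂ X)).erase y₁ = insert y₂ X := Finset.erase_insert hy₁B
    obtain ⟨w, hw⟩ := Rigid.split (R := facetAdj C) (R' := R')
      (B := insert y₁ (insert y₂ X)) (Z := insert (σ x₀) (τ.erase x₁)) (u := y₁) (v := x₁)
      (p := p) (Finset.mem_insert_self _ _)
      (Finset.mem_insert_of_mem (Finset.mem_insert_of_mem hx₁X)) (fun h => hy₁ (h ▸ hx₁X))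
      (by rw [hpu, hagree' x₁ (Finset.mem_insert_of_mem hx₁X)])
      (hZX.trans ((Finset.subset_insert _ _).trans (Finset.subset_insert _ _)))
      (fun h => hy₁ (hZX h))
      (by simp [hσx₀x₁.symm])
      (by
        rw [Finset.card_insert_of_notMem hσx₀τ', Finset.card_erase_of_mem hx₁]
        omega)
      (by
        intro z hz
        refine ⟨hadjY y₁ hy₁C hy₁ z (hZX hz), hadjX z (hZX hz) x₁ hx₁X ?_⟩
        rcases Finset.mem_insert.1 hz with rfl | hz
        · exact fun h => hx₁₀ (hσinj _ hx₀X _ hx₁X h).symm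
        · rintro rfl
          exact hσx₁τ (Finset.mem_of_mem_erase hz))
      (by
        rw [Finset.insert_comm, Finset.insert_erase hx₁]
        exact hai _ (hsubτ.trans (Finset.subset_insert _ _)) hfewτ (by omega))
      (by
        rw [herase]
        exact (hai _ (hsubτ.trans (Finset.subset_insert _ _)) hfewτ (by omega)).faithful hcardτ
          ⟨_, Finset.mem_insert_self _ _⟩ (hsubτ.trans (Finset.subset_insert _ _)))
      (by rw [herase]; exact hbase p hai)
      (by
        rintro a - b - (h | ⟨rfl, rfl⟩ | ⟨rfl, rfl⟩) -
        · exact Or.inl h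
        · exact Or.inr (Or.inl ⟨rfl, facetAdj_symm (hadjY y₁ hy₁C hy₁ _ hσx₁X)⟩)
        · exact Or.inr (Or.inr ⟨rfl, hadjY y₁ hy₁C hy₁ _ hσx₁X⟩))
      (facetAdj_symm (hadjY y₁ hy₁C hy₁ x₁ hx₁X))
    obtain ⟨s, hs⟩ := hw.infinite_compl.nonempty
    simp only [Set.mem_compl_iff, Set.mem_ofPred_eq, not_not] at hs
    exact ⟨_, Submodule.add_mem _ hp
      (Submodule.smul_mem _ s (single_mem_symmetricSpace hσ hy₁ w)), hs⟩
  refine ⟨lineOpen_rigid _ _, ?_⟩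
  obtain ⟨p, hp, ⟨-, hr⟩, hai⟩ := (htwo.and (holdsGenerically_forall_ai hσ ht (verts C))).2
  have hBC : insert y₁ (insert y₂ X) ⊆ verts C :=
    Finset.insert_subset hy₁C (Finset.insert_subset hy₂C hXC)
  have hXB : X ⊆ insert y₁ (insert y₂ X) :=
    (Finset.subset_insert _ _).trans (Finset.subset_insert _ _)
  refine ⟨p, hp, (hai _ (hsubτ.trans hXC) hfewτ (by omega)).faithful hcardτ
    ⟨_, Finset.mem_insert_self _ _⟩ (hsubτ.trans hXC), ?_⟩
  rw [← Finset.union_sdiff_of_subset hBC]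
  refine hr.attach fun y hy => ?_
  obtain ⟨hyC, hyB⟩ := Finset.mem_sdiff.1 hy
  have hyX : y ∉ X := fun h => hyB (hXB h)
  have hyK : y ∉ insert (σ x₀) τ := fun h => hyX (hsubτ h)
  exact ⟨_, hsubτ.trans hXB, hcardτ, hyK, fun z hz => hadjY y hyC hyX z (hsubτ hz),
    hai _ (Finset.insert_subset hyC (hsubτ.trans hXC)) (fewPairs_insert_of_notMem hσ hyX hfewτ)
      (by rw [Finset.card_insert_of_notMem hyK, hcardτ])⟩

/-- A circuit of dimension at least two is rigid in generic configurations in which up to `k`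
non-adjacent pairs of vertices are placed symmetrically. -/
theorem Circuit.genericallyRigid {t : ℕ} (hσ : IsFreePairing X σ) (ht : t ≤ k)
    (hk : 2 ≤ k) (hC : Circuit k C) (hCX : NoPairs X σ C) (hX : X.card ≤ 2 * k) :
    GenericallyRigid t k X σ (facetAdj C) (verts C) := by
  induction hn : (verts C \ X).card using Nat.strong_induction_on generalizing C with
  | _ n ih =>
    by_cases hY : ∀ F ∈ C, ∀ a ∈ F, ∀ b ∈ F, a ∉ X → b ∉ X → a = b
    · exact genericallyRigid_crosspolytope hσ ht hk hC hCX hX hY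
    push Not at hY
    obtain ⟨F₀, hF₀, u, hu₀, v, hv₀, hu, hv, huv⟩ := hY
    have hlift : ∀ D ⊆ push u v C, Circuit k D →
        u ∈ verts (lift u v C D) ∧ v ∈ verts (lift u v C D) ∧
          GenericallyRigid t k X σ (facetAdj C) (verts (lift u v C D)) := by
      intro D hDC hD
      -- The contraction loses the vertex `u ∉ X`, so the induction measure drops; since `v ∉ X`, no
      -- facet gains a vertex of `X` and no pair is created.
      refine genericallyRigid_lift hσ ht hk hC hCX huv hu hv hF₀ hu₀ hv₀ hD hDC
        (ih _ ?_ hD ?_ rfl)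
      · rw [← hn]
        refine Finset.card_lt_card (Finset.ssubset_iff_subset_ne.2 ⟨?_, ?_⟩)
        · intro x hx
          obtain ⟨hxD, hxX⟩ := Finset.mem_sdiff.1 hx
          obtain ⟨F, hF, hxF⟩ := mem_verts.1 hxD
          obtain ⟨F', hF', -, rfl⟩ := exists_of_mem_push (hDC hF)
          refine Finset.mem_sdiff.2 ⟨?_, hxX⟩
          rcases exists_of_mem_merge hxF with h | ⟨rfl, -⟩
          · exact mem_verts.2 ⟨F', hF', h⟩
          · exact mem_verts.2 ⟨F₀, hF₀, hv₀⟩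
        · intro heq
          have hmem : u ∈ verts C \ X := Finset.mem_sdiff.2 ⟨mem_verts.2 ⟨F₀, hF₀, hu₀⟩, hu⟩
          rw [← heq] at hmem
          obtain ⟨F, hF, huF⟩ := mem_verts.1 (Finset.mem_sdiff.1 hmem).1
          obtain ⟨F', -, -, rfl⟩ := exists_of_mem_push (hDC hF)
          exact notMem_merge huv F' huF
      · intro F hF a ha haX hσa
        obtain ⟨F', hF', -, rfl⟩ := exists_of_mem_push (hDC hF)
        have key : ∀ b ∈ merge u v F', b ∈ X → b ∈ F' := fun b hb hbX =>
          (exists_of_mem_merge hb).resolve_right fun h => hv (h.1 ▸ hbX)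
        exact hCX F' hF' a (key a ha haX) haX (key _ hσa (hσ.mapsTo a haX))
    classical
    have hall := HoldsGenerically.forall_finset (L := symmetricSpace t (k + 1) X σ)
      ((push u v C).powerset.filter (Circuit k))
      (P := fun D p => Faithful (verts (lift u v C D)) p ∧
        Rigid (facetAdj C) (verts (lift u v C D)) p)
      fun D hD => (hlift D (Finset.mem_powerset.1 (Finset.mem_filter.1 hD).1)
        (Finset.mem_filter.1 hD).2).2.2
    obtain ⟨p, hp, h1, hai⟩ := (hall.and (holdsGenerically_forall_ai hσ ht (verts C))).2
    have hcard := hC.1.1 F₀ hF₀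
    have haiF : AI p F₀ := hai F₀ (subset_verts hF₀) (fewPairs_of_noPair (hCX F₀ hF₀)) (by omega)
    refine ⟨lineOpen_rigid _ _, p, hp,
      haiF.faithful hcard ⟨u, hu₀⟩ (subset_verts hF₀), ?_⟩
    refine rigid_of_lifts hσ hk hC hCX huv hu hv hF₀ hu₀ hv₀ hai fun D hDC hD => ?_
    obtain ⟨h2, h3, -⟩ := hlift D hDC hD
    exact ⟨h2, h3, (h1 D (Finset.mem_filter.2 ⟨Finset.mem_powerset.2 hDC, hD⟩)).2⟩

end Circuits

end Z2Rigidity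

namespace Z2Rigidity

/-! ### Multicomplexes -/

section Multicomplexes

variable {V : Type*} [DecidableEq V] {S T : Multiset (Finset V)} {σ : V → V} {k : ℕ}

theorem mem_vertexSet {v : V} : v ∈ vertexSet S ↔ ∃ F ∈ S, v ∈ F := by
  simp [vertexSet]

theorem subset_vertexSet {F : Finset V} (hF : F ∈ S) : F ⊆ vertexSet S := fun _ hv =>
  mem_vertexSet.2 ⟨F, hF, hv⟩

theorem vertexSet_add : vertexSet (S + T) = vertexSet S ∪ vertexSet T := by
  ext v
  simp only [mem_vertexSet, Finset.mem_union, Multiset.mem_add, or_and_right, exists_or]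

theorem mem_starImage {F : Finset V} : F ∈ starImage σ T ↔ ∃ F' ∈ T, F'.image σ = F :=
  Multiset.mem_map

theorem mem_vertexSet_starImage {v : V} :
    v ∈ vertexSet (starImage σ T) ↔ ∃ w ∈ vertexSet T, σ w = v := by
  simp only [mem_vertexSet, mem_starImage]
  constructor
  · rintro ⟨_, ⟨F, hF, rfl⟩, hv⟩
    obtain ⟨w, hw, rfl⟩ := Finset.mem_image.1 hv
    exact ⟨w, ⟨F, hF, hw⟩, rfl⟩
  · rintro ⟨w, ⟨F, hF, hw⟩, rfl⟩
    exact ⟨_, ⟨F, hF, rfl⟩, Finset.mem_image_of_mem σ hw⟩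

/-- A `k`-set not contained in `V(S)` lies in no facet, so restricting the boundary to subsets of
`V(S)` loses nothing. -/
theorem isSimplicialCycle_iff : IsSimplicialCycle k S ↔
    IsMulticomplex k S ∧ ∀ G : Finset V, G.card = k → Even (S.countP fun U => G ⊆ U) := by
  refine and_congr_right fun _ => ?_
  rw [boundary, Finset.filter_eq_empty_iff]
  constructor
  · intro h G hG
    by_contra hodd
    rw [Nat.not_even_iff_odd] at hodd
    obtain ⟨F, hF, hGF⟩ := Multiset.countP_pos.1 hodd.pos
    exact h (Finset.mem_powersetCard.2 ⟨hGF.trans (subset_vertexSet hF), hG⟩) hodd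
  · intro h G hG hodd
    exact Nat.not_even_iff_odd.2 hodd (h G (Finset.mem_powersetCard.1 hG).2)

theorem countP_val (C : Finset (Finset V)) (G : Finset V) :
    C.val.countP (fun U => G ⊆ U) = deg C G := by
  rw [Multiset.countP_eq_card_filter]
  rfl

theorem isSimplicialCycle_val {C : Finset (Finset V)} : IsSimplicialCycle k C.val ↔ Cyc k C := by
  rw [isSimplicialCycle_iff, Cyc]
  simp only [countP_val]
  rfl

theorem IsSimplicialCircuit.circuit {C : Finset (Finset V)} (h : IsSimplicialCircuit k C.val) :
    Circuit k C := by
  refine ⟨isSimplicialCycle_val.1 h.1, ?_, fun D hDC hD hcyc => ?_⟩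
  · rw [Finset.nonempty_iff_ne_empty]
    rintro rfl
    exact h.2.1 rfl
  · by_contra hne
    refine h.2.2 D.val ?_ ?_ (isSimplicialCycle_val.2 hcyc)
    · exact Finset.val_lt_iff.2 (Finset.ssubset_iff_subset_ne.2 ⟨hDC, hne⟩)
    · rw [Ne, Finset.val_eq_zero]
      exact hD.ne_empty

/-- A circuit with a repeated facet consists of two copies of that facet. -/
theorem IsSimplicialCircuit.nodup_or (h : IsSimplicialCircuit k T) :
    T.Nodup ∨ ∃ F, T = {F, F} := by
  by_contra hcon
  push Not at hcon
  obtain ⟨h1, h2⟩ := hcon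
  rw [Multiset.nodup_iff_count_le_one] at h1
  push Not at h1
  obtain ⟨F, hF⟩ := h1
  have hle : ({F, F} : Multiset (Finset V)) ≤ T := by
    rw [show ({F, F} : Multiset (Finset V)) = Multiset.replicate 2 F from rfl,
      ← Multiset.le_count_iff_replicate_le]
    omega
  refine h.2.2 {F, F} (lt_of_le_of_ne hle (h2 F).symm) (by simp) ?_
  refine isSimplicialCycle_iff.2 ⟨fun E hE => h.1.1 E (Multiset.mem_of_le hle hE), fun G _ => ?_⟩
  rw [show ({F, F} : Multiset (Finset V)) = {F} + {F} from rfl, Multiset.countP_add]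
  exact ⟨_, rfl⟩

/-- Otherwise `{u, σ u}` would be a face preserved by `σ`. -/
theorem IsFreeSimplicialInvolution.notMem (hσ : IsFreeSimplicialInvolution S σ) {F : Finset V}
    (hF : F ∈ S) {u : V} (hu : u ∈ F) : σ u ∉ F := by
  intro hσu
  refine hσ.free F hF {u, σ u} (by simp [Finset.insert_subset_iff, hu, hσu]) (by simp) ?_
  rw [Finset.image_insert, Finset.image_singleton,
    hσ.involutive u (subset_vertexSet hF hu), Finset.pair_comm]

theorem IsFreeSimplicialInvolution.isFreePairing (hσ : IsFreeSimplicialInvolution S σ) :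
    IsFreePairing (vertexSet S) σ := by
  refine ⟨hσ.mapsTo, hσ.involutive, fun u hu h => ?_⟩
  obtain ⟨F, hF, huF⟩ := mem_vertexSet.1 hu
  exact hσ.notMem hF huF (by rwa [h])

theorem IsFreeSimplicialInvolution.isFreePairing_inter
    (hσ : IsFreeSimplicialInvolution (T + starImage σ T) σ) :
    IsFreePairing (vertexSet T ∩ vertexSet (starImage σ T)) σ := by
  have hP := hσ.isFreePairing
  rw [vertexSet_add] at hP
  have hsub : ∀ u ∈ vertexSet T ∩ vertexSet (starImage σ T),
      u ∈ vertexSet T ∪ vertexSet (starImage σ T) := fun u hu =>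
    Finset.mem_union_left _ (Finset.mem_inter.1 hu).1
  refine ⟨fun u hu => ?_, fun u hu => hP.involutive u (hsub u hu),
    fun u hu => hP.free u (hsub u hu)⟩
  obtain ⟨hu1, hu2⟩ := Finset.mem_inter.1 hu
  obtain ⟨w, hw, rfl⟩ := mem_vertexSet_starImage.1 hu2
  refine Finset.mem_inter.2 ⟨?_, mem_vertexSet_starImage.2 ⟨_, hu1, rfl⟩⟩
  rwa [hP.involutive w (Finset.mem_union_left _ hw)]

theorem mem_gam_iff {t d : ℕ} {γ : Matrix.orthogonalGroup (Fin d) ℝ} :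
    γ ∈ Gam t d ↔ γ = 1 ∨ γ = ⟨signMatrix t d, signMatrix_mem t d⟩ := by
  have hsq : (⟨signMatrix t d, signMatrix_mem t d⟩ : Matrix.orthogonalGroup (Fin d) ℝ) ^ (2 : ℤ)
      = 1 := by
    rw [zpow_ofNat, pow_two]
    exact Subtype.ext (signMatrix_mul_self t d)
  rw [Gam, Subgroup.mem_zpowers_iff]
  constructor
  · rintro ⟨n, rfl⟩
    rcases Int.even_or_odd' n with ⟨m, rfl | rfl⟩
    · left
      rw [zpow_mul, hsq, one_zpow]
    · right
      rw [zpow_add, zpow_mul, hsq, one_zpow, one_mul, zpow_one]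
  · rintro (rfl | rfl)
    · exact ⟨0, zpow_zero _⟩
    · exact ⟨1, zpow_one _⟩

theorem signMatrix_ne_one {t d : ℕ} (h : t < d) : signMatrix t d ≠ 1 := by
  intro heq
  have := congrFun (congrFun heq ⟨t, h⟩) ⟨t, h⟩
  norm_num [signMatrix] at this

/-- The condition `t < d` makes the generator nontrivial; otherwise the symmetry condition over
non-identity elements would be vacuous. -/
theorem isGammaRigid_iff {t d : ℕ} (htd : t < d) :
    IsGammaRigid (Gam t d) (graphOf S) (graphOf S).verts σ ↔
      ∃ p ∈ symmetricSpace t d (vertexSet S) σ, Rigid (graphOf S).Adj (vertexSet S) p := by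
  refine exists_congr fun p => and_congr ?_ ?_
  · constructor
    · intro h u hu
      exact h ⟨signMatrix t d, signMatrix_mem t d⟩ (mem_gam_iff.2 (Or.inr rfl))
        (fun heq => signMatrix_ne_one htd (congrArg Subtype.val heq)) u hu
    · intro h γ hγ hne u hu
      rw [(mem_gam_iff.1 hγ).resolve_left hne]
      exact h u hu
  · refine forall_congr' fun q => ?_
    constructor
    · intro h hq
      exact h fun i j hij => hq i ((graphOf S).edge_vert hij) j
        ((graphOf S).edge_vert hij.symm) hij
    · intro h hq
      exact h fun u _ v _ huv => hq u v huv

theorem dotProduct_signMatrix_mulVec {t d : ℕ} (x y : Fin d → ℝ) :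
    x ⬝ᵥ signMatrix t d *ᵥ y = (signMatrix t d *ᵥ x) ⬝ᵥ y := by
  rw [Matrix.dotProduct_mulVec, ← Matrix.mulVec_transpose, signMatrix_transpose]

end Multicomplexes

/-! ### The case of graphs -/

section Graphs

variable {V : Type*} [DecidableEq V]

theorem deg_insert {U : Finset (Finset V)} {F : Finset V} (hF : F ∉ U) (G : Finset V) :
    deg (insert F U) G = deg U G + if G ⊆ F then 1 else 0 := by
  rw [deg, Finset.filter_insert]
  split_ifs with h
  · rw [Finset.card_insert_of_notMem fun h => hF (Finset.mem_filter.1 h).1]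
    rfl
  · rfl

/-- Any two vertices of a `1`-circuit are the end vertices of a path in it. -/
theorem Circuit.exists_path {C : Finset (Finset V)} (hC : Circuit 1 C) {a b : V}
    (ha : a ∈ verts C) (hb : b ∈ verts C) :
    ∃ U ⊆ C, ∀ w, Odd (deg U {w}) ↔ ¬ (w = a ↔ w = b) := by
  -- A path is encoded as an edge set whose boundary modulo two is `{a, v}`, or empty if `v = a`.
  -- Toggling an edge moves the endpoint `v` across it.
  let P : V → Prop := fun v => ∃ U ⊆ C, ∀ w, Odd (deg U {w}) ↔ ¬ (w = a ↔ w = v)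
  have hPa : P a := ⟨∅, Finset.empty_subset C, fun w => by simp [deg]⟩
  have hstep : ∀ F ∈ C, ∀ v ∈ F, ∀ w ∈ F, P v → P w := by
    intro F hF v hv w hw ⟨U, hU, h⟩
    by_cases hvw : v = w
    · exact hvw ▸ ⟨U, hU, h⟩
    have hFeq : F = {v, w} := by
      symm
      refine Finset.eq_of_subset_of_card_le ?_ ?_
      · simp [Finset.insert_subset_iff, hv, hw]
      · rw [hC.1.1 F hF, Finset.card_pair hvw]
    have key : ∀ x, ({x} ⊆ F) ↔ (x = v ∨ x = w) := by
      intro x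
      rw [Finset.singleton_subset_iff, hFeq]
      simp
    by_cases hFU : F ∈ U
    · refine ⟨U.erase F, (Finset.erase_subset F U).trans hU, fun x => ?_⟩
      have h1 := h x
      rw [← Finset.insert_erase hFU, deg_insert (Finset.notMem_erase F U)] at h1
      by_cases hx : x = v ∨ x = w
      · rw [if_pos ((key x).2 hx), Nat.odd_add_one] at h1
        rw [← not_iff_not, h1]
        rcases hx with rfl | rfl
        · simp [hvw]
        · simp [Ne.symm hvw]
      · rw [if_neg (mt (key x).1 hx), add_zero] at h1
        rw [h1]
        simp only [not_or] at hx
        simp [hx.1, hx.2]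
    · refine ⟨insert F U, Finset.insert_subset hF hU, fun x => ?_⟩
      have h1 := h x
      rw [deg_insert hFU]
      by_cases hx : x = v ∨ x = w
      · rw [if_pos ((key x).2 hx), Nat.odd_add_one, h1]
        rcases hx with rfl | rfl
        · simp [hvw]
        · simp [Ne.symm hvw]
      · rw [if_neg (mt (key x).1 hx), add_zero, h1]
        simp only [not_or] at hx
        simp [hx.1, hx.2]
  classical
  -- The edges of the component of `a` form a nonempty cycle, so they are all of the circuit.
  let W := C.filter fun F => ∀ x ∈ F, P x
  have hWC : W ⊆ C := Finset.filter_subset _ _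
  have hW : Cyc 1 W := by
    refine ⟨fun F hF => hC.1.1 F (hWC hF), fun G hG => ?_⟩
    obtain ⟨x, rfl⟩ := Finset.card_eq_one.1 hG
    by_cases hx : P x
    · have : deg W {x} = deg C {x} := by
        rw [deg, deg]
        congr 1
        ext F
        simp only [W, Finset.mem_filter, Finset.singleton_subset_iff]
        exact ⟨fun h => ⟨h.1.1, h.2⟩, fun h => ⟨⟨h.1, fun y hy => hstep F h.1 x h.2 y hy hx⟩, h.2⟩⟩
      rw [this]
      exact hC.1.2 _ hG
    · have : deg W {x} = 0 := by
        rw [deg, Finset.card_eq_zero, Finset.filter_eq_empty_iff]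
        intro F hF hxF
        exact hx ((Finset.mem_filter.1 hF).2 x (Finset.singleton_subset_iff.1 hxF))
      rw [this]
      exact Even.zero
  obtain ⟨F, hF, haF⟩ := mem_verts.1 ha
  have hWeq := hC.2.2 W hWC ⟨F, Finset.mem_filter.2 ⟨hF, fun x hx => hstep F hF a haF x hx hPa⟩⟩ hW
  obtain ⟨F', hF', hbF'⟩ := mem_verts.1 hb
  rw [← hWeq] at hF'
  exact (Finset.mem_filter.1 hF').2 b hbF'

theorem count_image_starImage {σ : V → V} {S M : Multiset (Finset V)}
    (hσ : IsFreePairing (vertexSet S) σ) (hM : ∀ E ∈ M, E ⊆ vertexSet S) {F : Finset V}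
    (hF : F ⊆ vertexSet S) : (starImage σ M).count (F.image σ) = M.count F := by
  have hinv : ∀ E ⊆ vertexSet S, (E.image σ).image σ = E := fun E hE => by
    rw [Finset.image_image]
    refine (Finset.image_congr fun x hx => ?_).trans Finset.image_id
    exact hσ.involutive x (hE hx)
  rw [starImage, Multiset.count_map, Multiset.count_eq_card_filter_eq]
  congr 1
  refine Multiset.filter_congr fun E hE => ?_
  constructor
  · intro h
    rw [← hinv F hF, h, hinv E (hM E hE)]
  · rintro rfl
    rfl

/-- An irreducible `1`-cycle is not the sum of two circuits sharing a vertex. -/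
theorem inter_eq_empty_of_isIrreducibleCycle_one {σ : V → V} {C : Finset (Finset V)}
    (hS : IsIrreducibleCycle 1 (C.val + starImage σ C.val) σ) (hC : Circuit 1 C) :
    vertexSet C.val ∩ vertexSet (starImage σ C.val) = ∅ := by
  by_contra hne
  obtain ⟨a, ha⟩ := Finset.nonempty_iff_ne_empty.2 hne
  set S := C.val + starImage σ C.val with hSdef
  have hfree := hS.1.2
  have hP := hfree.isFreePairing
  have hX := (hSdef ▸ hfree).isFreePairing_inter
  have hverts : vertexSet C.val = verts C := by simp [vertexSet, verts]
  have haC := (Finset.mem_inter.1 ha).1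
  have hσaC := (Finset.mem_inter.1 (hX.mapsTo a ha)).1
  have hCS : vertexSet C.val ⊆ vertexSet S := by
    rw [hSdef, vertexSet_add]; exact Finset.subset_union_left
  have hσσa := hX.involutive a ha
  -- A path from `a` to `σ a` and its mirror image have the same boundary, so together they form a
  -- symmetric cycle. It is proper because `U`, having a boundary, is not all of `C`.
  obtain ⟨U, hUC, hU⟩ := hC.exists_path (hverts ▸ haC) (hverts ▸ hσaC)
  have hUa : Odd (deg U {a}) := (hU a).2 (by simpa using (hX.free a ha).symm)
  have hUne : U ≠ C := by
    rintro rfl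
    exact Nat.not_even_iff_odd.2 hUa (hC.1.2 {a} (Finset.card_singleton a))
  have hUle : U.val ≤ C.val := Finset.val_le_iff.2 hUC
  have hle : U.val + starImage σ U.val ≤ S :=
    add_le_add hUle (Multiset.map_le_map hUle)
  have hUS : ∀ E ∈ U.val, E ⊆ vertexSet S := fun E hE =>
    (subset_vertexSet (Multiset.mem_of_le hUle hE)).trans hCS
  have hsubS : ∀ E ∈ U.val + starImage σ U.val, E ∈ S := fun E hE => Multiset.mem_of_le hle hE
  have hstar : starImage σ (starImage σ U.val) = U.val := by
    rw [starImage, starImage, Multiset.map_map]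
    refine (Multiset.map_congr rfl fun E hE => ?_).trans (Multiset.map_id _)
    simp only [Function.comp_apply, Finset.image_image]
    refine (Finset.image_congr fun x hx => ?_).trans Finset.image_id
    exact hP.involutive x (hUS E hE hx)
  refine hS.2.2 (U.val + starImage σ U.val) (lt_of_le_of_ne hle fun heq => ?_) ?_ ⟨?_, ?_⟩
  · have h1 := congrArg Multiset.card heq
    have h2 := Finset.card_lt_card (Finset.ssubset_iff_subset_ne.2 ⟨hUC, hUne⟩)
    simp only [hSdef, starImage, Multiset.card_add, Multiset.card_map, Finset.card_val] at h1
    omega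
  · intro h0
    have h1 : U.val = 0 := (add_eq_zero.1 h0).1
    rw [Finset.val_eq_zero] at h1
    subst h1
    simp [deg] at hUa
  · refine isSimplicialCycle_iff.2 ⟨fun E hE => hS.1.1.1 E (hsubS E hE), fun G hG => ?_⟩
    obtain ⟨w, rfl⟩ := Finset.card_eq_one.1 hG
    rw [Multiset.countP_add, countP_val]
    by_cases hw : w ∈ vertexSet S
    · have h1 : (starImage σ U.val).countP (fun E => {w} ⊆ E) = deg U {σ w} := by
        rw [starImage, Multiset.countP_map, ← countP_val, Multiset.countP_eq_card_filter]
        congr 1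
        refine Multiset.filter_congr fun E hE => ?_
        rw [Finset.singleton_subset_iff, Finset.singleton_subset_iff, Finset.mem_image]
        constructor
        · rintro ⟨x, hx, rfl⟩
          rwa [hP.involutive x (hUS E hE hx)]
        · intro h
          exact ⟨_, h, hP.involutive w hw⟩
      have h2 : σ w = a ↔ w = σ a := by
        constructor
        · rintro rfl
          exact (hP.involutive w hw).symm
        · rintro rfl
          exact hσσa
      have h3 : σ w = σ a ↔ w = a := by
        constructor
        · intro h
          rw [← hP.involutive w hw, h, hσσa]
        · rintro rfl
          rfl
      have h4 := hU w
      have h5 := hU (σ w)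
      rw [h2, h3] at h5
      rw [h1, Nat.even_add, ← Nat.not_odd_iff_even, ← Nat.not_odd_iff_even, h4, h5, not_not,
        not_not]
      exact ⟨Iff.symm, Iff.symm⟩
    · have h1 : deg U {w} = 0 := by
        rw [deg, Finset.card_eq_zero, Finset.filter_eq_empty_iff]
        exact fun E hE hwE => hw (hUS E hE (Finset.singleton_subset_iff.1 hwE))
      have h2 : (starImage σ U.val).countP (fun E => {w} ⊆ E) = 0 := by
        rw [Multiset.countP_eq_zero]
        exact fun E hE hwE => hw (subset_vertexSet
          (hsubS E (Multiset.mem_add.2 (Or.inr hE))) (Finset.singleton_subset_iff.1 hwE))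
      rw [h1, h2]
      exact Even.zero
  · have hVS : vertexSet (U.val + starImage σ U.val) ⊆ vertexSet S := fun x hx => by
      obtain ⟨E, hE, hxE⟩ := mem_vertexSet.1 hx
      exact mem_vertexSet.2 ⟨E, hsubS E hE, hxE⟩
    refine ⟨fun x hx => ?_, fun x hx => hP.involutive x (hVS hx), fun F hF => ?_,
      fun E hE => hfree.free E (hsubS E hE)⟩
    · rw [vertexSet_add, Finset.mem_union] at hx ⊢
      rcases hx with hx | hx
      · exact Or.inr (mem_vertexSet_starImage.2 ⟨x, hx, rfl⟩)
      · obtain ⟨y, hy, rfl⟩ := mem_vertexSet_starImage.1 hx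
        left
        rwa [hP.involutive y (hVS (by rw [vertexSet_add]; exact Finset.mem_union_left _ hy))]
    · have hFS : F ⊆ vertexSet S := subset_vertexSet (hsubS F hF)
      have h1 := count_image_starImage hP hUS hFS
      have h2 := count_image_starImage (M := starImage σ U.val) hP
        (fun E hE => subset_vertexSet (hsubS E (Multiset.mem_add.2 (Or.inr hE)))) hFS
      rw [hstar] at h2
      rw [Multiset.count_add, Multiset.count_add, h1, h2, add_comm]

end Graphs

end Z2Rigidity

namespace Z2Rigidity

/-! ### Sufficiency -/

section Gluing

variable {V : Type*} [DecidableEq V] {T : Multiset (Finset V)} {σ : V → V} {k t : ℕ}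

/-- In a generic symmetric configuration, `X` contains `k + 1` affinely independent points. -/
theorem exists_holdsGenerically_ai {X : Finset V} (hσ : IsFreePairing X σ) (ht : t ≤ k)
    (hX : X.card ≤ 2 * k) (h : max (max (2 * (k - t)) (k + 1)) (2 * t) ≤ X.card) :
    ∃ K ⊆ X, K.card = k + 1 ∧
      HoldsGenerically (symmetricSpace t (k + 1) X σ) fun p => AI p K := by
  obtain ⟨P, hPX, hPσ, hXP, hcard⟩ := hσ.exists_transversal
  simp only [max_le_iff] at h
  -- `Q` is the set of pairs used in full, chosen so that `|P| + |Q| = k + 1`; it fits into `P`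
  -- because `h ≥ k + 1`.
  obtain ⟨Q, hQP, hQ⟩ := Finset.exists_subset_card_eq (show k + 1 - P.card ≤ P.card by omega)
  have hinj : Set.InjOn σ Q := fun a ha b hb hab => by
    rw [← hσ.involutive a (hPX (hQP ha)), hab, hσ.involutive b (hPX (hQP hb))]
  have hdisj : Disjoint P (Q.image σ) := by
    rw [Finset.disjoint_right]
    intro x hx
    obtain ⟨z, hz, rfl⟩ := Finset.mem_image.1 hx
    exact hPσ z (hQP hz)
  have hK : (P ∪ Q.image σ).card = k + 1 := by
    rw [Finset.card_union_of_disjoint hdisj, Finset.card_image_of_injOn hinj, hQ]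
    omega
  refine ⟨P ∪ Q.image σ, ?_, hK, ?_⟩
  · conv_rhs => rw [hXP]
    exact Finset.union_subset_union subset_rfl (Finset.image_subset_image hQP)
  -- The two limits on full pairs, `|Q| ≤ t + 1` and `|Q| ≤ k + 1 - t`, are exactly `h ≥ 2(k - t)`
  -- and `h ≥ 2t`.
  · refine holdsGenerically_ai_of_subset hσ (K₀ := Q ∪ Q.image σ)
      (Finset.union_subset_union hQP subset_rfl)
      (exists_ai_pairs hσ (by omega) Q (hQP.trans hPX) (fun u hu h => hPσ u (hQP hu) (hQP h))
        (by omega) (by omega)) ?_ (by omega)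
    intro v hv hvK _ hσv
    have hvP : v ∈ P := by
      rcases Finset.mem_union.1 hv with h | h
      · exact h
      · exact absurd (Finset.mem_union_right _ h) hvK
    rcases Finset.mem_union.1 hσv with h | h
    · exact hPσ v hvP h
    · obtain ⟨z, hz, hzv⟩ := Finset.mem_image.1 h
      have : z = v := by
        rw [← hσ.involutive z (hPX (hQP hz)), hzv, hσ.involutive v (hPX hvP)]
      exact hvK (Finset.mem_union_left _ (this ▸ hz))

/-- Gluing a rigid realisation of `T` with its mirror image along `X`. -/
theorem exists_rigid_of_half
    (hσ : IsFreeSimplicialInvolution (T + starImage σ T) σ)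
    {p : V → Fin (k + 1) → ℝ}
    (hp : p ∈ symmetricSpace t (k + 1) (vertexSet T ∩ vertexSet (starImage σ T)) σ)
    (hr : Rigid (graphOf T).Adj (vertexSet T) p) {K : Finset V}
    (hKX : K ⊆ vertexSet T ∩ vertexSet (starImage σ T)) (hK : Faithful K p) :
    ∃ r ∈ symmetricSpace t (k + 1) (vertexSet (T + starImage σ T)) σ,
      Rigid (graphOf (T + starImage σ T)).Adj (vertexSet (T + starImage σ T)) r := by
  have hP := hσ.isFreePairing
  rw [vertexSet_add] at hP ⊢
  have hinvT : ∀ v ∈ vertexSet T, σ (σ v) = v := fun v hv =>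
    hP.involutive v (Finset.mem_union_left _ hv)
  let r : V → Fin (k + 1) → ℝ := fun v =>
    if v ∈ vertexSet T then p v else signMatrix t (k + 1) *ᵥ p (σ v)
  have hrT : ∀ v ∈ vertexSet T, r v = p v := fun v hv => if_pos hv
  have hrσ : ∀ v ∈ vertexSet T, r (σ v) = signMatrix t (k + 1) *ᵥ p v := by
    intro v hv
    by_cases hσv : σ v ∈ vertexSet T
    · rw [hrT _ hσv]
      exact hp v (Finset.mem_inter.2 ⟨hv, mem_vertexSet_starImage.2 ⟨_, hσv, hinvT v hv⟩⟩)
    · simp only [r, if_neg hσv, hinvT v hv]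
  refine ⟨r, ?_, ?_⟩
  · intro u hu
    rcases Finset.mem_union.1 hu with hu | hu
    · rw [hrσ u hu, hrT u hu]
    · obtain ⟨w, hw, rfl⟩ := mem_vertexSet_starImage.1 hu
      rw [hinvT w hw, hrσ w hw, hrT w hw, signMatrix_mulVec_mulVec]
  intro q hq
  have hmot : ∀ F ∈ T + starImage σ T, ∀ u ∈ F, ∀ v ∈ F,
      (r u - r v) ⬝ᵥ (q u - q v) = 0 := by
    intro F hF u hu v hv
    by_cases huv : u = v
    · simp [huv]
    · have hsub := subset_vertexSet hF
      rw [vertexSet_add] at hsub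
      exact hq u (hsub hu) v (hsub hv) ⟨huv, F, hF, hu, hv⟩
  obtain ⟨A₁, c₁, hA₁, h₁⟩ := hr q fun u hu v hv ⟨_, F, hF, huF, hvF⟩ => by
    rw [← hrT u hu, ← hrT v hv]
    exact hmot F (Multiset.mem_add.2 (Or.inl hF)) u huF v hvF
  -- The velocities on the mirror half, reflected back, form a motion of `T`; its rigidity therefore
  -- makes `q` trivial on the mirror half as well.
  obtain ⟨A₂, c₂, hA₂, h₂⟩ := hr (fun v => signMatrix t (k + 1) *ᵥ q (σ v))
    fun u hu v hv ⟨_, F, hF, huF, hvF⟩ => by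
      rw [← Matrix.mulVec_sub, dotProduct_signMatrix_mulVec, Matrix.mulVec_sub, ← hrσ u hu,
        ← hrσ v hv]
      exact hmot _ (Multiset.mem_add.2 (Or.inr (mem_starImage.2 ⟨F, hF, rfl⟩)))
        _ (Finset.mem_image_of_mem σ huF) _ (Finset.mem_image_of_mem σ hvF)
  set J := signMatrix t (k + 1) with hJ
  have hJJ : ∀ x, J *ᵥ J *ᵥ x = x := signMatrix_mulVec_mulVec t (k + 1)
  have h₃ : ∀ v ∈ vertexSet T, q (σ v) = (J * A₂ * J) *ᵥ r (σ v) + J *ᵥ c₂ := by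
    intro v hv
    rw [← hJJ (q (σ v)), h₂ v hv, Matrix.mulVec_add, hrσ v hv, ← Matrix.mulVec_mulVec, hJJ,
      Matrix.mulVec_mulVec]
  have hA₃ : (J * A₂ * J)ᵀ = -(J * A₂ * J) := by
    rw [Matrix.transpose_mul, Matrix.transpose_mul, hA₂, hJ, signMatrix_transpose]
    simp [Matrix.mul_assoc]
  -- The trivial motions of the two halves agree on `K ⊆ X`, and `K` is faithful, so they are equal.
  have hdiff := hK (A₁ - J * A₂ * J) (c₁ - J *ᵥ c₂)
    (by rw [Matrix.transpose_sub, hA₁, hA₃]; abel) fun x hx => by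
      obtain ⟨hxT, hxs⟩ := Finset.mem_inter.1 (hKX hx)
      obtain ⟨w, hw, rfl⟩ := mem_vertexSet_starImage.1 hxs
      have e1 := h₁ _ hxT
      rw [h₃ w hw, hrT _ hxT] at e1
      rw [Matrix.sub_mulVec]
      linear_combination (exp := 1) -e1
  rw [sub_eq_zero, sub_eq_zero] at hdiff
  refine ⟨A₁, c₁, hA₁, fun v hv => ?_⟩
  rcases Finset.mem_union.1 hv with hv | hv
  · rw [hrT v hv, h₁ v hv]
  · obtain ⟨w, hw, rfl⟩ := mem_vertexSet_starImage.1 hv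
    rw [hdiff.1, hdiff.2, h₃ w hw]

end Gluing

/-! ### Necessity -/

section Necessity

variable {V : Type*}

/-- A rigid framework with more than `d` vertices affinely spans `ℝ^d`. -/
theorem Rigid.faithful {d : ℕ} {R : V → V → Prop} {B : Finset V} {p : V → Fin d → ℝ}
    (h : Rigid R B p) (hB : d + 1 ≤ B.card) : Faithful B p := by
  classical
  intro A c hA hz
  obtain ⟨v₀, hv₀⟩ : B.Nonempty := Finset.card_pos.1 (by omega)
  suffices hA0 : A = 0 by
    subst hA0
    exact ⟨rfl, by simpa using hz v₀ hv₀⟩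
  by_contra hA0
  obtain ⟨i, hi⟩ : ∃ i, A i ≠ 0 := by
    by_contra hcon
    push Not at hcon
    exact hA0 (funext hcon)
  have hai : ∀ v ∈ B, A i ⬝ᵥ p v + c i = 0 := fun v hv => congrFun (hz v hv) i
  -- A nonzero row of `A` gives a hyperplane containing all the points, so `d + 1` or more of them
  -- are affinely dependent.
  have hdep : ¬ AI p B := by
    intro hAI
    have hli : LinearIndependent ℝ (fun v : B => (p v, (1 : ℝ))) := hAI
    have hle := hli.fintype_card_le_finrank
    have hspan := hli.span_eq_top_of_card_eq_finrank' (by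
      rw [finrank_affineFunctional] at hle ⊢
      rw [Fintype.card_coe] at hle ⊢
      omega)
    let φ : ((Fin d → ℝ) × ℝ) →ₗ[ℝ] ℝ :=
      { toFun := fun x => A i ⬝ᵥ x.1 + c i * x.2
        map_add' := fun x y => by simp only [Prod.fst_add, Prod.snd_add, dotProduct_add]; ring
        map_smul' := fun s x => by
          simp only [Prod.smul_fst, Prod.smul_snd, dotProduct_smul, smul_eq_mul, RingHom.id_apply]
          ring }
    have hφ : φ = 0 := LinearMap.ext_on hspan (by
      rintro _ ⟨v, rfl⟩
      simpa [φ] using hai v v.2)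
    have h1 : A i ⬝ᵥ A i = 0 := by
      simpa [φ] using LinearMap.congr_fun hφ (A i, 0)
    exact hi (dotProduct_self_eq_zero.1 h1)
  rw [ai_iff] at hdep
  push Not at hdep
  obtain ⟨e, he1, he2, v, hv, hev⟩ := hdep
  -- Moving each point along the normal `A i` with speed its coefficient `e v` in the dependency is
  -- a motion. If it were trivial, applying the dependency to it would give `∑ e v ^ 2 = 0`.
  obtain ⟨A', c', -, hAc'⟩ := h (fun v => e v • A i) fun u hu w hw _ => by
    rw [← sub_smul, dotProduct_smul, sub_dotProduct, dotProduct_comm (p u),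
      dotProduct_comm (p w)]
    rw [show A i ⬝ᵥ p u - A i ⬝ᵥ p w = 0 by linear_combination hai u hu - hai w hw, smul_zero]
  have hsum : ∑ u ∈ B, e u • e u • A i = 0 := by
    have h1 : ∀ u ∈ B, e u • e u • A i = A' *ᵥ (e u • p u) + e u • c' := fun u hu => by
      rw [hAc' u hu, smul_add, Matrix.mulVec_smul]
    rw [Finset.sum_congr rfl h1, Finset.sum_add_distrib, ← Matrix.mulVec_sum, he1,
      ← Finset.sum_smul, he2, Matrix.mulVec_zero, zero_smul, add_zero]
  simp only [smul_smul] at hsum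
  rw [← Finset.sum_smul, smul_eq_zero, or_iff_left hi,
    Finset.sum_eq_zero_iff_of_nonneg fun u _ => mul_self_nonneg _] at hsum
  exact hev (mul_self_eq_zero.1 (hsum v hv))

/-- The infinitesimal rotation about the intersection of two hyperplanes. -/
theorem exists_rotation {d : ℕ} {α β : (Fin d → ℝ) × ℝ} (h : LinearIndependent ℝ ![α, β]) :
    ∃ (A : Matrix (Fin d) (Fin d) ℝ) (c : Fin d → ℝ), Aᵀ = -A ∧ ¬ (A = 0 ∧ c = 0) ∧
      ∀ x, evalAffine x α = 0 → evalAffine x β = 0 → A *ᵥ x + c = 0 := by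
  obtain ⟨a, a₀⟩ := α
  obtain ⟨b, b₀⟩ := β
  -- The velocity field is `x ↦ α(x) b - β(x) a`, where `α` and `β` denote the affine functionals
  -- and `a` and `b` their gradients.
  refine ⟨Matrix.vecMulVec b a - Matrix.vecMulVec a b, a₀ • b - b₀ • a, ?_, ?_, ?_⟩
  · rw [Matrix.transpose_sub, Matrix.transpose_vecMulVec, Matrix.transpose_vecMulVec]
    abel
  · rintro ⟨h1, h2⟩
    rw [LinearIndependent.pair_iff] at h
    have h1' : ∀ i j, b i * a j = a i * b j := fun i j => by
      have := congrFun (congrFun h1 i) j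
      simp only [Matrix.sub_apply, Matrix.vecMulVec_apply, Matrix.zero_apply] at this
      linarith
    have h2' : ∀ j, a₀ * b j = b₀ * a j := fun j => by
      have := congrFun h2 j
      simp only [Pi.sub_apply, Pi.smul_apply, smul_eq_mul, Pi.zero_apply] at this
      linarith
    have hj : ∀ j, a j = 0 ∧ b j = 0 := fun j => by
      have := h (b j) (-(a j)) (by
        refine Prod.ext (funext fun i => ?_) ?_
        · simp only [Prod.fst_add, Prod.smul_fst, Pi.add_apply, Pi.smul_apply, smul_eq_mul,
            Prod.fst_zero, Pi.zero_apply]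
          linarith [h1' i j]
        · simp only [Prod.snd_add, Prod.smul_snd, smul_eq_mul, Prod.snd_zero]
          linarith [h2' j])
      exact ⟨neg_eq_zero.1 this.2, this.1⟩
    have ha : a = 0 := funext fun j => (hj j).1
    have hb : b = 0 := funext fun j => (hj j).2
    subst ha hb
    have h3 := h b₀ (-a₀) (by
      refine Prod.ext (by simp) ?_
      simp only [Prod.snd_add, Prod.smul_snd, smul_eq_mul, Prod.snd_zero]
      ring)
    have ha₀ : a₀ = 0 := neg_eq_zero.1 h3.2
    have h4 := h 1 0 (by rw [ha₀]; simp)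
    exact one_ne_zero h4.1
  · intro x hα hβ
    have hα' : a ⬝ᵥ x + a₀ = 0 := hα
    have hβ' : b ⬝ᵥ x + b₀ = 0 := hβ
    rw [Matrix.sub_mulVec, Matrix.vecMulVec_mulVec, Matrix.vecMulVec_mulVec]
    ext i
    simp only [op_smul_eq_mul, Pi.add_apply, Pi.sub_apply, Pi.smul_apply,
      smul_eq_mul, Pi.zero_apply]
    linear_combination b i * hα' - a i * hβ'

variable [DecidableEq V] {X : Finset V} {σ : V → V} {k t : ℕ}

/-- If the numerical condition fails, a symmetric configuration of `X` spans a space of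
codimension at least two. -/
theorem exists_affineFunctional_pair_of_lt (hσ : IsFreePairing X σ) (ht : t ≤ k)
    (h : X.card < max (max (2 * (k - t)) (k + 1)) (2 * t)) {p : V → Fin (k + 1) → ℝ}
    (hp : p ∈ symmetricSpace t (k + 1) X σ) :
    ∃ α β : (Fin (k + 1) → ℝ) × ℝ, LinearIndependent ℝ ![α, β] ∧
      ∀ x ∈ X, evalAffine (p x) α = 0 ∧ evalAffine (p x) β = 0 := by
  obtain ⟨P, hPX, -, hXP, hcard⟩ := hσ.exists_transversal
  have hcases : ∀ x ∈ X, x ∈ P ∨ ∃ z ∈ P, σ z = x := fun x hx => by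
    rw [hXP, Finset.mem_union, Finset.mem_image] at hx
    exact hx
  rcases lt_max_iff.1 h with h | h
  · rcases lt_max_iff.1 h with h | h
    -- Sign-changing functionals form a space of dimension `k + 1 - t`, and `|P| ≤ k - t - 1`
    -- conditions leave two.
    · obtain ⟨α, β, hli, hαβ⟩ := exists_affineFunctional_pair
        (Sum.elim (fun z : P => evalAffine (p z)) (Sum.elim
          (fun i : {i : Fin (k + 1) // (i : ℕ) < t} => coordAffine i.1)
          fun _ : Unit => LinearMap.snd ℝ (Fin (k + 1) → ℝ) ℝ))
        (by rw [Fintype.card_sum, Fintype.card_coe, Fintype.card_sum,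
              card_coord_lt t (k + 1) (by omega), Fintype.card_unit]; omega)
      have key : ∀ γ : (Fin (k + 1) → ℝ) × ℝ, (∀ z ∈ P, evalAffine (p z) γ = 0) →
          (∀ i : Fin (k + 1), (i : ℕ) < t → γ.1 i = 0) → γ.2 = 0 →
          ∀ x ∈ X, evalAffine (p x) γ = 0 := by
        intro γ h1 h2 h3 x hx
        rcases hcases x hx with hx | ⟨z, hz, rfl⟩
        · exact h1 x hx
        · have h4 : γ.1 ⬝ᵥ p z + γ.2 = 0 := h1 z hz
          change γ.1 ⬝ᵥ p (σ z) + γ.2 = 0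
          rw [hp z (hPX hz), dotProduct_signMatrix_of_reversed h2, h3]
          linarith
      refine ⟨α, β, hli, fun x hx => ⟨key α ?_ ?_ ?_ x hx, key β ?_ ?_ ?_ x hx⟩⟩
      · exact fun z hz => (hαβ (Sum.inl ⟨z, hz⟩)).1
      · exact fun i hi => (hαβ (Sum.inr (Sum.inl ⟨i, hi⟩))).1
      · exact (hαβ (Sum.inr (Sum.inr ()))).1
      · exact fun z hz => (hαβ (Sum.inl ⟨z, hz⟩)).2
      · exact fun i hi => (hαβ (Sum.inr (Sum.inl ⟨i, hi⟩))).2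
      · exact (hαβ (Sum.inr (Sum.inr ()))).2
    · obtain ⟨α, β, hli, hαβ⟩ := exists_affineFunctional_pair
        (fun z : X => evalAffine (p z)) (by rw [Fintype.card_coe]; omega)
      exact ⟨α, β, hli, fun x hx => hαβ ⟨x, hx⟩⟩
  -- Invariant functionals form a space of dimension `t + 1`, and `|P| ≤ t - 1` conditions leave
  -- two.
  · obtain ⟨α, β, hli, hαβ⟩ := exists_affineFunctional_pair
      (Sum.elim (fun z : P => evalAffine (p z))
        fun i : {i : Fin (k + 1) // t ≤ (i : ℕ)} => coordAffine i.1)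
      (by rw [Fintype.card_sum, Fintype.card_coe, card_coord_ge t (k + 1) (by omega)]; omega)
    have key : ∀ γ : (Fin (k + 1) → ℝ) × ℝ, (∀ z ∈ P, evalAffine (p z) γ = 0) →
        (∀ i : Fin (k + 1), t ≤ (i : ℕ) → γ.1 i = 0) → ∀ x ∈ X, evalAffine (p x) γ = 0 := by
      intro γ h1 h2 x hx
      rcases hcases x hx with hx | ⟨z, hz, rfl⟩
      · exact h1 x hx
      · change γ.1 ⬝ᵥ p (σ z) + γ.2 = 0
        rw [hp z (hPX hz), dotProduct_signMatrix_of_fixed h2]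
        exact h1 z hz
    refine ⟨α, β, hli, fun x hx => ⟨key α ?_ ?_ x hx, key β ?_ ?_ x hx⟩⟩
    · exact fun z hz => (hαβ (Sum.inl ⟨z, hz⟩)).1
    · exact fun i hi => (hαβ (Sum.inr ⟨i, hi⟩)).1
    · exact fun z hz => (hαβ (Sum.inl ⟨z, hz⟩)).2
    · exact fun i hi => (hαβ (Sum.inr ⟨i, hi⟩)).2

/-- A rigid symmetric configuration can be replaced by one whose facets are also affinely
independent. If the bound failed, rotating only `T*` about a subspace of codimension two containing
`X` would be a motion. Being trivial and zero on a facet of `T` it would vanish, but on the mirror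
facet it is a nonzero trivial motion. -/
theorem le_card_of_rigid {T : Multiset (Finset V)} (ht : t ≤ k)
    (hcard : IsMulticomplex k (T + starImage σ T)) (hT : T ≠ 0)
    (hσ : IsFreeSimplicialInvolution (T + starImage σ T) σ) {p : V → Fin (k + 1) → ℝ}
    (hp : p ∈ symmetricSpace t (k + 1) (vertexSet (T + starImage σ T)) σ)
    (hr : Rigid (graphOf (T + starImage σ T)).Adj (vertexSet (T + starImage σ T)) p) :
    max (max (2 * (k - t)) (k + 1)) (2 * t) ≤
      (vertexSet T ∩ vertexSet (starImage σ T)).card := by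
  by_contra hlt
  rw [not_le] at hlt
  have hP := hσ.isFreePairing
  obtain ⟨F, hF⟩ := Multiset.exists_mem_of_ne_zero hT
  have hFS : F ∈ T + starImage σ T := Multiset.mem_add.2 (Or.inl hF)
  have hF' : F.image σ ∈ starImage σ T := mem_starImage.2 ⟨F, hF, rfl⟩
  have hF'S : F.image σ ∈ T + starImage σ T := Multiset.mem_add.2 (Or.inr hF')
  have hFsub := subset_vertexSet hFS
  have hF'sub := subset_vertexSet hF'S
  obtain ⟨x, hx⟩ : F.Nonempty := Finset.card_pos.1 (by rw [hcard F hFS]; omega)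
  -- A facet and the partner of one of its vertices already give `k + 2 = d + 1` vertices.
  have hf : Faithful (vertexSet (T + starImage σ T)) p := by
    refine hr.faithful ?_
    have h1 := Finset.card_le_card (Finset.insert_subset (hP.mapsTo x (hFsub hx)) hFsub)
    rw [Finset.card_insert_of_notMem (hσ.notMem hFS hx), hcard F hFS] at h1
    exact h1
  have hgen : HoldsGenerically (symmetricSpace t (k + 1) (vertexSet (T + starImage σ T)) σ)
      fun p => Faithful (vertexSet (T + starImage σ T)) p ∧
        Rigid (graphOf (T + starImage σ T)).Adj (vertexSet (T + starImage σ T)) p :=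
    ⟨lineOpen_rigid _ _, p, hp, hf, hr⟩
  obtain ⟨r, hrL, ⟨-, hrr⟩, hai⟩ := (hgen.and (holdsGenerically_forall_ai hP ht
    (vertexSet (T + starImage σ T)))).2
  have hfaith : ∀ E ∈ T + starImage σ T, Faithful E r := fun E hE => by
    refine (hai E (subset_vertexSet hE) (fewPairs_of_noPair fun u hu _ => hσ.notMem hE hu)
      (by rw [hcard E hE]; omega)).faithful (hcard E hE)
      (Finset.card_pos.1 (by rw [hcard E hE]; omega)) subset_rfl
  have hsub : vertexSet T ∩ vertexSet (starImage σ T) ⊆ vertexSet (T + starImage σ T) := by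
    rw [vertexSet_add]
    exact Finset.inter_subset_left.trans Finset.subset_union_left
  obtain ⟨α, β, hli, hαβ⟩ := exists_affineFunctional_pair_of_lt hσ.isFreePairing_inter ht hlt
    (p := r) fun u hu => hrL u (hsub hu)
  obtain ⟨A, c, hA, hne, hAc⟩ := exists_rotation hli
  -- The two prescriptions agree on `X`, where the rotation vanishes, and every edge lies within one
  -- of the halves.
  let q : V → Fin (k + 1) → ℝ := fun v => if v ∈ vertexSet T then 0 else A *ᵥ r v + c
  have hqT : ∀ v ∈ vertexSet T, q v = 0 := fun v hv => if_pos hv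
  have hqT' : ∀ v ∈ vertexSet (starImage σ T), q v = A *ᵥ r v + c := by
    intro v hv
    by_cases hvT : v ∈ vertexSet T
    · obtain ⟨h1, h2⟩ := hαβ v (Finset.mem_inter.2 ⟨hvT, hv⟩)
      rw [hqT v hvT, hAc _ h1 h2]
    · exact if_neg hvT
  obtain ⟨A', c', hA', h'⟩ := hrr q fun u _ v _ ⟨_, E, hE, huE, hvE⟩ => by
    rcases Multiset.mem_add.1 hE with hE | hE
    · rw [hqT u (subset_vertexSet hE huE), hqT v (subset_vertexSet hE hvE), sub_zero,
        dotProduct_zero]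
    · rw [hqT' u (subset_vertexSet hE huE), hqT' v (subset_vertexSet hE hvE)]
      exact trivial_isMotion hA c _ _
  obtain ⟨rfl, rfl⟩ := hfaith F hFS A' c' hA' fun v hv => by
    rw [← h' v (hFsub hv), hqT v (subset_vertexSet hF hv)]
  refine hne (hfaith _ hF'S A c hA fun v hv => ?_)
  rw [← hqT' v (subset_vertexSet hF' hv), h' v (hF'sub hv)]
  simp

end Necessity

end Z2Rigidity

/-! ### The numerical criterion for rigidity -/

theorem mainTheorem7 {V : Type*} [DecidableEq V] (k t : ℕ) (hk : 1 ≤ k) (ht : t ≤ k)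
    (S T : Multiset (Finset V)) (σ : V → V)
    (hS : Z2Rigidity.IsIrreducibleCycle k S σ)
    (hT : Z2Rigidity.IsSimplicialCircuit k T)
    (hST : S = T + Z2Rigidity.starImage σ T)
    (h : ℕ)
    (hh : h = (Z2Rigidity.vertexSet T ∩ Z2Rigidity.vertexSet (Z2Rigidity.starImage σ T)).card)
    (hle : h ≤ 2 * k) :
    Z2Rigidity.IsGammaRigid (Z2Rigidity.Gam t (k + 1)) (Z2Rigidity.graphOf S)
        (Z2Rigidity.graphOf S).verts σ ↔
      max (max (2 * (k - t)) (k + 1)) (2 * t) ≤ h := by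
  open Z2Rigidity in
  subst hST hh
  rw [isGammaRigid_iff (Nat.lt_succ_of_le ht)]
  have hσ := hS.1.2
  constructor
  · rintro ⟨p, hp, hr⟩
    exact le_card_of_rigid ht hS.1.1.1 hT.2.1 hσ hp hr
  intro hmax
  have hpos : (vertexSet T ∩ vertexSet (starImage σ T)).Nonempty :=
    Finset.card_pos.1 (by simp only [max_le_iff] at hmax; omega)
  have hX := hσ.isFreePairing_inter
  have hnm : ∀ F ∈ T, ∀ u ∈ F, σ u ∉ F := fun F hF u hu =>
    hσ.notMem (Multiset.mem_add.2 (Or.inl hF)) hu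
  rcases hT.nodup_or with hnd | ⟨F, rfl⟩
  · obtain ⟨C, rfl⟩ : ∃ C : Finset (Finset V), C.val = T := ⟨⟨T, hnd⟩, rfl⟩
    have hC := hT.circuit
    -- The lower bound makes `X` nonempty, which irreducibility excludes for `k = 1`.
    have hk2 : 2 ≤ k := by
      by_contra hlt
      obtain rfl : k = 1 := by omega
      exact hpos.ne_empty (inter_eq_empty_of_isIrreducibleCycle_one hS hC)
    obtain ⟨K, hKX, hK, hgen⟩ := exists_holdsGenerically_ai hX ht hle hmax
    have hrig := hC.genericallyRigid hX ht hk2 (fun F hF u hu _ => hnm F hF u hu) hle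
    obtain ⟨p, hp, ⟨-, hr⟩, hai⟩ := (hrig.and hgen).2
    have hverts : vertexSet C.val = verts C := by simp [vertexSet, verts]
    refine exists_rigid_of_half hσ hp ?_ hKX
      (hai.faithful hK (Finset.card_pos.1 (by omega)) subset_rfl)
    rw [hverts]
    intro q hq
    refine hr q fun u hu v hv ⟨F, hF, huF, hvF⟩ => ?_
    by_cases huv : u = v
    · simp [huv]
    · exact hq u hu v hv ⟨huv, F, hF, huF, hvF⟩
  -- All vertices of `T` lie in `F`, so a vertex of the invariant set `X` and its partner would both
  -- lie in `F`, against freeness.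
  · obtain ⟨x, hx⟩ := hpos
    have hmem : ∀ y ∈ vertexSet ({F, F} : Multiset (Finset V)), y ∈ F := fun y hy => by
      obtain ⟨E, hE, hyE⟩ := mem_vertexSet.1 hy
      have : E = F := by simpa using hE
      exact this ▸ hyE
    exact absurd (hmem _ (Finset.mem_inter.1 (hX.mapsTo x hx)).1)
      (hnm F (by simp) x (hmem x (Finset.mem_inter.1 hx).1))
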